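/- Let $T_1<T_2$, let $p,q,m\in C[T_1,T_2]$ with $p>0$ and $q\ge 0$ on $[T_1,T_2]$, and suppose that $m$ changes sign, i.e. $m^+\not\equiv0$ and $m^-\not\equiv0$ on $[T_1,T_2]$. For $(a,b)\in\mathbb R^2$ consider the Neumann problem $$-(p(t)u')'+q(t)u=m(t)\,[a u^+-b u^-]\ \text{ in } ]T_1,T_2[,\qquad u'(T_1)=0=u'(T_2),$$ where $u^\pm=\max\{\pm u,0\}$. For $k\ge 0$ let $C_k^>$ (resp. $C_k^<$) be the set of all $(a,b)\in\mathbb R^2$ for which this problem has a nontrivial solution $u$ with exactly $k$ zeros in $]T_1,T_2[$ and with $u(T_2)>0$ (resp. $u(T_2)<0$), and let $\Sigma^*=\bigcup_{k\ge1}(C_k^>\cup C_k^<)$. A point $s\in\,]T_1,T_2[$ is a simple point of change of sign of $m$ if there are $T_1<s'\le s$ and $\varepsilon_0>0$ such that $m\equiv0$ on $[s',s]$ and either (i) for all $0<\varepsilon<\varepsilon_0$, $m\le0$, $m\not\equiv0$ on $]s'-\varepsilon,s'[$ and $m\ge0$, $m\not\equiv0$ on $]s,s+\varepsilon[$, or (ii)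 the same holds with $\le$ and $\ge$ exchanged. A point $s\in[T_1,T_2]$ is a multiple point of change of sign of $m$ if either $s>T_1$ and $m^+$ and $m^-$ are both $\not\equiv0$ on $]s-\varepsilon,s[\,\cap[T_1,T_2]$ for every $\varepsilon>0$, or $s<T_2$ and $m^+$ and $m^-$ are both $\not\equiv0$ on $]s,s+\varepsilon[\,\cap[T_1,T_2]$ for every $\varepsilon>0$. Let $N$ be the number of changes of sign of $m$: $N=+\infty$ if $m$ has at least one multiple point of change of sign in $[T_1,T_2]$, and otherwise $N$ is the number of simple points of change of sign of $m$ in $]T_1,T_2[$. Then $N\in\{1,2,\dots,+\infty\}$, and $\Sigma^*$ contains exactly $2N-1$ hyperbolic-like curves (with $2N-1=+\infty$ if $N=+\infty$) in each of the two quadrants $\mathbb R_+\times\mathbb R_-$ and $\mathbb R_-\times\mathbb R_+$. That is, if $Q$ is one of these quadrants, then exactly $2N-1$ of the sets $C_k^>\cap Q$, $C_k^<\cap Q$ $(k\ge1)$ are nonempty (counted by their labels, so that a curve is counted twice when $C_k^>\cap Q=C_k^<\cap Q\neq\emptyset$), $\Sigma^*\cap Q$ is the union of these sets, and each of them is a hyperbolic-like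 curve: the graph $\{(a,f(a))\}$ of a strictly increasing $C^1$-diffeomorphism $f$ from some $]\alpha,+\infty[$, $\alpha\ge0$, onto some $]-\infty,\beta[$, $\beta\le0$, when $Q=\mathbb R_+\times\mathbb R_-$, and from some $]-\infty,\gamma[$, $\gamma\le0$, onto some $]\eta,+\infty[$, $\eta\ge0$, when $Q=\mathbb R_-\times\mathbb R_+$. -/

import Mathlib

open Set

namespace Fucik

/-- `u` is a classical solution on `[T₁, T₂]` of the Neumann problem
`-(p u')' + q u = m (a u⁺ - b u⁻)` in `]T₁, T₂[`, `u'(T₁) = 0 = u'(T₂)`: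
`u` is `C¹` on `[T₁, T₂]` (one-sided at the end points) and `p u'` is differentiable in
`]T₁, T₂[` with the derivative prescribed by the equation.
Here `u⁺ = max u 0` and `u⁻ = max (-u) 0`. -/
structure IsSolution (p q m : ℝ → ℝ) (T₁ T₂ a b : ℝ) (u : ℝ → ℝ) : Prop where
  contDiffOn : ContDiffOn ℝ 1 u (Icc T₁ T₂)
  eqn : ∀ t ∈ Ioo T₁ T₂,
    HasDerivAt (fun s => p s * derivWithin u (Icc T₁ T₂) s)
      (q t * u t - m t * (a * max (u t) 0 - b * max (-u t) 0)) t
  left : derivWithin u (Icc T₁ T₂) T₁ = 0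
  right : derivWithin u (Icc T₁ T₂) T₂ = 0

/-- The part of the Fučík spectrum with exactly `k` zeros and prescribed end sign: the set
`C_k^>` (for `true`), resp. `C_k^<` (for `false`), of all `(a, b)` for which the problem has a
(nontrivial) solution with exactly `k` zeros in `]T₁, T₂[` and with `u(T₂) > 0`,
resp. `u(T₂) < 0`. -/
def piece (p q m : ℝ → ℝ) (T₁ T₂ : ℝ) (k : ℕ) : Bool → Set (ℝ × ℝ)
  | true => {x | ∃ u : ℝ → ℝ, IsSolution p q m T₁ T₂ x.1 x.2 u ∧
      {t ∈ Ioo T₁ T₂ | u t = 0}.encard = k ∧ 0 < u T₂}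
  | false => {x | ∃ u : ℝ → ℝ, IsSolution p q m T₁ T₂ x.1 x.2 u ∧
      {t ∈ Ioo T₁ T₂ | u t = 0}.encard = k ∧ u T₂ < 0}

/-- The nontrivial part `Σ* = ⋃_{k ≥ 1} (C_k^> ∪ C_k^<)` of the Fučík spectrum. -/
def sigmaStar (p q m : ℝ → ℝ) (T₁ T₂ : ℝ) : Set (ℝ × ℝ) :=
  ⋃ k ≥ 1, (piece p q m T₁ T₂ k true ∪ piece p q m T₁ T₂ k false)

/-- The indices `(k, ±)`, `k ≥ 1`, of those among the sets `C_k^>`, `C_k^<` that meet `Q`.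
Counting indices rather than sets counts a curve twice when `C_k^>` and `C_k^<` coincide
in `Q`. -/
def curveIndices (p q m : ℝ → ℝ) (T₁ T₂ : ℝ) (Q : Set (ℝ × ℝ)) : Set (ℕ × Bool) :=
  {i | 1 ≤ i.1 ∧ (piece p q m T₁ T₂ i.1 i.2 ∩ Q).Nonempty}

/-- The quadrant `ℝ₊ × ℝ₋`. -/
def posNeg : Set (ℝ × ℝ) := Ici 0 ×ˢ Iic 0

/-- The quadrant `ℝ₋ × ℝ₊`. -/
def negPos : Set (ℝ × ℝ) := Iic 0 ×ˢ Ici 0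

/-- `S` is the graph of a strictly increasing `C¹`-diffeomorphism from `I` onto `J`. -/
def IsIncreasingDiffeoGraph (I J : Set ℝ) (S : Set (ℝ × ℝ)) : Prop :=
  ∃ f g : ℝ → ℝ, ContDiffOn ℝ 1 f I ∧ ContDiffOn ℝ 1 g J ∧
    MapsTo f I J ∧ MapsTo g J I ∧ InvOn g f I J ∧ StrictMonoOn f I ∧
    S = (fun a => (a, f a)) '' I

/-- Hyperbolic-like curve in `ℝ₊ × ℝ₋`: the graph of a strictly increasing
`C¹`-diffeomorphism from some `]α, +∞[`, `α ≥ 0`, onto some `]-∞, β[`, `β ≤ 0`. -/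
def IsHyperbolicLikePosNeg (S : Set (ℝ × ℝ)) : Prop :=
  ∃ α β : ℝ, 0 ≤ α ∧ β ≤ 0 ∧ IsIncreasingDiffeoGraph (Ioi α) (Iio β) S

/-- Hyperbolic-like curve in `ℝ₋ × ℝ₊`: the graph of a strictly increasing
`C¹`-diffeomorphism from some `]-∞, γ[`, `γ ≤ 0`, onto some `]η, +∞[`, `η ≥ 0`. -/
def IsHyperbolicLikeNegPos (S : Set (ℝ × ℝ)) : Prop :=
  ∃ γ η : ℝ, γ ≤ 0 ∧ 0 ≤ η ∧ IsIncreasingDiffeoGraph (Iio γ) (Ioi η) S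

/-- `m ≥ 0` and `m ≢ 0` on `S`. -/
def NonnegNotZeroOn (m : ℝ → ℝ) (S : Set ℝ) : Prop :=
  (∀ t ∈ S, 0 ≤ m t) ∧ ∃ t ∈ S, m t ≠ 0

/-- `m ≤ 0` and `m ≢ 0` on `S`. -/
def NonposNotZeroOn (m : ℝ → ℝ) (S : Set ℝ) : Prop :=
  (∀ t ∈ S, m t ≤ 0) ∧ ∃ t ∈ S, m t ≠ 0

/-- `s ∈ ]T₁, T₂[` is a simple point of change of sign of `m`. (As `s' > T₁`, `s < T₂` and `ε₀`
may be shrunk, only the values of `m` on `[T₁, T₂]` matter.) -/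
def IsSimpleChange (m : ℝ → ℝ) (T₁ T₂ s : ℝ) : Prop :=
  s ∈ Ioo T₁ T₂ ∧ ∃ s' ε₀ : ℝ, T₁ < s' ∧ s' ≤ s ∧ 0 < ε₀ ∧ (∀ t ∈ Icc s' s, m t = 0) ∧
    ((∀ ε, 0 < ε → ε < ε₀ →
        NonposNotZeroOn m (Ioo (s' - ε) s') ∧ NonnegNotZeroOn m (Ioo s (s + ε))) ∨
     (∀ ε, 0 < ε → ε < ε₀ →
        NonnegNotZeroOn m (Ioo (s' - ε) s') ∧ NonposNotZeroOn m (Ioo s (s + ε))))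

/-- `m⁺` and `m⁻` are both `≢ 0` on `S`. -/
def BothSignsOn (m : ℝ → ℝ) (S : Set ℝ) : Prop :=
  (∃ t ∈ S, 0 < m t) ∧ ∃ t ∈ S, m t < 0

/-- `s ∈ [T₁, T₂]` is a multiple point of change of sign of `m`. -/
def IsMultipleChange (m : ℝ → ℝ) (T₁ T₂ s : ℝ) : Prop :=
  s ∈ Icc T₁ T₂ ∧
    ((T₁ < s ∧ ∀ ε > 0, BothSignsOn m (Ioo (s - ε) s ∩ Icc T₁ T₂)) ∨
     (s < T₂ ∧ ∀ ε > 0, BothSignsOn m (Ioo s (s + ε) ∩ Icc T₁ T₂)))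

open Classical in
/-- The number of changes of sign of `m`: `+∞` if `m` has a multiple point of change of sign in
`[T₁, T₂]`, and otherwise the number of its simple points of change of sign in `]T₁, T₂[`. -/
noncomputable def numSignChanges (m : ℝ → ℝ) (T₁ T₂ : ℝ) : ℕ∞ :=
  if ∃ s, IsMultipleChange m T₁ T₂ s then ⊤ else {s | IsSimpleChange m T₁ T₂ s}.encard

end Fucik

/-! The solution with u(T₁) = 1, u'(T₁) = 0 is written u = ρ cos θ, p u' = -ρ sin θ. The angle obeys
a scalar equation of its own, θ' = sin²θ/p - q cos²θ + m (a (cos⁺θ)² + b (cos⁻θ)²). Where cos θ = 0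
this gives θ' = 1/p > 0, so each value nπ - π/2 is crossed only upwards. The Neumann condition at T₂
says that `rot` = θ(T₂) is some kπ, and then u has exactly k interior zeros and final sign (-1)^k. A
solution starting negative is a negative multiple of the normalized solution for (b, a). Each
`piece` is therefore a level set of `rot`, possibly after swapping coordinates (`piece_eq`).

Fix k ≥ 1 and the quadrant a ≥ 0 ≥ b. Since q ≥ 0, a positive hump of u needs a m > 0 somewhere and
a negative one needs b m > 0 somewhere, so a point of the level set yields k + 1 points at which m
alternates in sign, starting with + (`alternates_of_rot_eq`). Conversely, given such points, a large
l forces the solution for (l, -l) to lose the prescribed sign near each of them, so `rot` exceeds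
kπ, while it is below π at the origin; the intermediate value theorem applies (`exists_rot_eq`).

The shape of the level set in the coordinates (a, -b) rests on two facts. Both partial derivatives
of `rot` are nonzero there, by an energy identity (`angleDeriv_ne_zero`), so it is locally a C¹
graph over either axis. Picone's identity forbids two points one of which is strictly larger in both
coordinates (`rot_ne_of_lt`). With closedness this yields one decreasing C¹ graph between half-lines
(`IsCurve.exists_graph`), which increases in (a, b).

For the count, the other label with the same k is the same question for -m, so it occurs iff m
alternates k times starting with -. N is the largest number of alternations with free first sign
(`hasAlternation_iff`). If k < N, dropping an end point realizes both first signs; if k = N only one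
occurs, since two would splice into N + 1 alternations; beyond N there are none. This makes 2(N - 1)
+ 1 labels. -/

open Set Filter Topology

/-! ### The Prüfer angle: existence, bounds, upward crossings -/

namespace Fucik

/-- The square of the positive part. -/
noncomputable def posSq (x : ℝ) : ℝ := max x 0 ^ 2

lemma posSq_of_nonneg {x : ℝ} (h : 0 ≤ x) : posSq x = x ^ 2 := by simp [posSq, h]

lemma posSq_of_nonpos {x : ℝ} (h : x ≤ 0) : posSq x = 0 := by simp [posSq, h]

lemma posSq_nonneg (x : ℝ) : 0 ≤ posSq x := by unfold posSq; positivity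

lemma posSq_le_one {x : ℝ} (h : |x| ≤ 1) : posSq x ≤ 1 := by
  have h1 : max x 0 ≤ 1 := max_le (le_trans (le_abs_self x) h) zero_le_one
  have h0 : 0 ≤ max x 0 := le_max_right _ _
  unfold posSq; nlinarith

lemma posSq_mul {c x : ℝ} (hc : 0 ≤ c) : posSq (c * x) = c ^ 2 * posSq x := by
  rcases le_total 0 x with h | h
  · rw [posSq_of_nonneg h, posSq_of_nonneg (mul_nonneg hc h)]; ring
  · rw [posSq_of_nonpos h, posSq_of_nonpos (mul_nonpos_of_nonneg_of_nonpos hc h)]; ring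

lemma continuous_posSq : Continuous posSq := by unfold posSq; fun_prop

/-- Squaring removes the kink of the positive part. This makes the Prüfer field C¹ in the angle, and
ultimately `rot` C¹ in the parameters. -/
lemma hasDerivAt_posSq (x : ℝ) : HasDerivAt posSq (2 * max x 0) x := by
  rcases lt_trichotomy x 0 with h | rfl | h
  · have : posSq =ᶠ[𝓝 x] fun _ => 0 := by
      filter_upwards [Iio_mem_nhds h] with y hy using posSq_of_nonpos (le_of_lt hy)
    rw [max_eq_right h.le, mul_zero]
    exact (hasDerivAt_const x (0 : ℝ)).congr_of_eventuallyEq this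
  · rw [max_self, mul_zero, hasDerivAt_iff_isLittleO]
    have h2 : (fun y : ℝ => posSq y - posSq 0 - (y - 0) • (0 : ℝ)) =O[𝓝 0]
        fun y : ℝ => y ^ 2 := by
      refine Asymptotics.IsBigO.of_bound 1 (Eventually.of_forall fun y => ?_)
      simp only [sub_zero, smul_zero, posSq_of_nonneg le_rfl, Real.norm_eq_abs, one_mul]
      rcases le_total 0 y with h | h
      · simp [posSq_of_nonneg h]
      · simp [posSq_of_nonpos h]; positivity
    refine h2.trans_isLittleO ?_
    simpa using (Asymptotics.isLittleO_pow_id (𝕜 := ℝ) (n := 2) one_lt_two)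
  · have : posSq =ᶠ[𝓝 x] fun y => y ^ 2 := by
      filter_upwards [Ioi_mem_nhds h] with y hy using posSq_of_nonneg (le_of_lt hy)
    rw [max_eq_left h.le]
    refine HasDerivAt.congr_of_eventuallyEq ?_ this
    simpa using hasDerivAt_pow 2 x

/-- Coefficients of the problem, continuous on the whole line and with uniform bounds. -/
structure Coeffs where
  (T₁ T₂ M : ℝ)
  (p q m : ℝ → ℝ)
  lt : T₁ < T₂
  hp : Continuous p
  hq : Continuous q
  hm : Continuous m
  p_pos : ∀ t, 0 < p t
  q_nonneg : ∀ t, 0 ≤ q t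
  one_le : 1 ≤ M
  p_le : ∀ t, p t ≤ M
  inv_le : ∀ t, (p t)⁻¹ ≤ M
  q_le : ∀ t, q t ≤ M
  m_le : ∀ t, |m t| ≤ M

namespace Coeffs

variable (C : Coeffs)

/-- The problem with weight `-m`. -/
def neg : Coeffs :=
  { C with
    m := fun t => -C.m t
    hm := C.hm.neg
    m_le := fun t => by simpa using C.m_le t }

lemma M_pos : 0 < C.M := lt_of_lt_of_le one_pos C.one_le

lemma inv_pos (t : ℝ) : 0 < (C.p t)⁻¹ := _root_.inv_pos.2 (C.p_pos t)

lemma continuous_inv : Continuous fun t => (C.p t)⁻¹ := C.hp.inv₀ fun t => (C.p_pos t).ne'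

lemma left_mem : C.T₁ ∈ Icc C.T₁ C.T₂ := left_mem_Icc.2 C.lt.le

lemma right_mem : C.T₂ ∈ Icc C.T₁ C.T₂ := right_mem_Icc.2 C.lt.le

/-- The vector field of the Prüfer angle. -/
noncomputable def field (x : ℝ × ℝ) (t θ : ℝ) : ℝ :=
  Real.sin θ ^ 2 * (C.p t)⁻¹ - C.q t * Real.cos θ ^ 2 +
    C.m t * (x.1 * posSq (Real.cos θ) + x.2 * posSq (-Real.cos θ))

/-- The derivative of `field` with respect to the angle. -/
noncomputable def fieldDeriv (x : ℝ × ℝ) (t θ : ℝ) : ℝ :=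
  2 * (Real.sin θ * Real.cos θ) * ((C.p t)⁻¹ + C.q t) -
    2 * C.m t * (x.1 * (Real.sin θ * max (Real.cos θ) 0) -
      x.2 * (Real.sin θ * max (-Real.cos θ) 0))

lemma hasDerivAt_field (x : ℝ × ℝ) (t θ : ℝ) :
    HasDerivAt (C.field x t) (C.fieldDeriv x t θ) θ := by
  have hs := Real.hasDerivAt_sin θ
  have hc := Real.hasDerivAt_cos θ
  have h1 := (hasDerivAt_posSq (Real.cos θ)).comp θ hc
  have h2 := (hasDerivAt_posSq (-Real.cos θ)).comp θ hc.neg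
  have := (((hs.pow 2).mul_const (C.p t)⁻¹).sub ((hc.pow 2).const_mul (C.q t))).add
    (((h1.const_mul x.1).add (h2.const_mul x.2)).const_mul (C.m t))
  refine this.congr_deriv ?_
  unfold fieldDeriv
  push_cast
  ring

/-- A Lipschitz constant of the field for parameters of size at most `R`. -/
noncomputable def bound (R : ℝ) : ℝ := 4 * C.M + 4 * C.M * R

lemma one_le_bound {R : ℝ} (hR : 0 ≤ R) : 1 ≤ C.bound R := by
  have h1 := C.one_le
  have : 0 ≤ 4 * C.M * R := by have := C.M_pos; positivity
  unfold bound; linarith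

lemma abs_lin_le {c d a b M R : ℝ} {w : ℝ} (hM : 0 ≤ M) (hw : |w| ≤ M)
    (ha : |a| ≤ R) (hb : |b| ≤ R) (hc : |c| ≤ 1) (hd : |d| ≤ 1) :
    |w * (a * c + b * d)| ≤ 2 * M * R := by
  have hR : 0 ≤ R := le_trans (abs_nonneg _) ha
  have h1 : |a * c| ≤ R := by
    rw [abs_mul]; nlinarith [abs_nonneg a, abs_nonneg c]
  have h2 : |b * d| ≤ R := by
    rw [abs_mul]; nlinarith [abs_nonneg b, abs_nonneg d]
  rw [abs_mul]
  have h3 : |a * c + b * d| ≤ 2 * R := (abs_add_le _ _).trans (by linarith)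
  calc |w| * |a * c + b * d| ≤ M * (2 * R) := mul_le_mul hw h3 (abs_nonneg _) hM
    _ = _ := by ring

lemma abs_posSq_le_one {x : ℝ} (h : |x| ≤ 1) : |posSq x| ≤ 1 := by
  rw [abs_of_nonneg (posSq_nonneg x)]; exact posSq_le_one h

lemma abs_max_cos_le (θ : ℝ) : |max (Real.cos θ) 0| ≤ 1 := by
  rw [abs_of_nonneg (le_max_right _ _)]
  exact max_le (Real.cos_le_one θ) zero_le_one

lemma abs_max_neg_cos_le (θ : ℝ) : |max (-Real.cos θ) 0| ≤ 1 := by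
  rw [abs_of_nonneg (le_max_right _ _)]
  exact max_le (by linarith [Real.neg_one_le_cos θ]) zero_le_one

lemma abs_mul_le_one {a b : ℝ} (ha : |a| ≤ 1) (hb : |b| ≤ 1) : |a * b| ≤ 1 := by
  rw [abs_mul]; exact mul_le_one₀ ha (abs_nonneg _) hb

lemma abs_field_le {x : ℝ × ℝ} {R : ℝ} (h1 : |x.1| ≤ R) (h2 : |x.2| ≤ R) (t θ : ℝ) :
    |C.field x t θ| ≤ C.bound R := by
  have hM := C.M_pos
  have hR : 0 ≤ R := le_trans (abs_nonneg _) h1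
  have hcos : |-Real.cos θ| ≤ 1 := by simpa using Real.abs_cos_le_one θ
  have e1 := abs_lin_le hM.le (C.m_le t) h1 h2
    (abs_posSq_le_one (Real.abs_cos_le_one θ)) (abs_posSq_le_one hcos)
  have e2 : |Real.sin θ ^ 2 * (C.p t)⁻¹| ≤ C.M := by
    rw [abs_of_nonneg (by have := C.inv_pos t; positivity)]
    nlinarith [Real.sin_sq_le_one θ, C.inv_pos t, C.inv_le t]
  have e3 : |C.q t * Real.cos θ ^ 2| ≤ C.M := by
    rw [abs_of_nonneg (by have := C.q_nonneg t; positivity)]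
    nlinarith [Real.cos_sq_le_one θ, C.q_nonneg t, C.q_le t]
  unfold field bound
  have : 0 ≤ C.M * R := by positivity
  have e4 := abs_add_le (Real.sin θ ^ 2 * (C.p t)⁻¹ - C.q t * Real.cos θ ^ 2)
    (C.m t * (x.1 * posSq (Real.cos θ) + x.2 * posSq (-Real.cos θ)))
  have e5 := abs_sub (Real.sin θ ^ 2 * (C.p t)⁻¹) (C.q t * Real.cos θ ^ 2)
  linarith

lemma abs_fieldDeriv_le {x : ℝ × ℝ} {R : ℝ} (h1 : |x.1| ≤ R) (h2 : |x.2| ≤ R) (t θ : ℝ) :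
    |C.fieldDeriv x t θ| ≤ C.bound R := by
  have hM := C.M_pos
  have hs := Real.abs_sin_le_one θ
  have hc := Real.abs_cos_le_one θ
  have e1 := abs_lin_le (w := -C.m t) (c := Real.sin θ * max (Real.cos θ) 0)
    (d := -(Real.sin θ * max (-Real.cos θ) 0)) hM.le (by simpa using C.m_le t) h1 h2
    (abs_mul_le_one hs (abs_max_cos_le θ))
    (by rw [abs_neg]; exact abs_mul_le_one hs (abs_max_neg_cos_le θ))
  have e2 : |(Real.sin θ * Real.cos θ) * ((C.p t)⁻¹ + C.q t)| ≤ 2 * C.M := by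
    rw [abs_mul, abs_of_nonneg (a := (C.p t)⁻¹ + C.q t)
      (by have := C.inv_pos t; have := C.q_nonneg t; positivity)]
    nlinarith [abs_mul_le_one hs hc, C.inv_pos t, C.inv_le t, C.q_nonneg t, C.q_le t,
      abs_nonneg (Real.sin θ * Real.cos θ)]
  have e3 := abs_add_le ((Real.sin θ * Real.cos θ) * ((C.p t)⁻¹ + C.q t))
    (-C.m t * (x.1 * (Real.sin θ * max (Real.cos θ) 0) +
      x.2 * -(Real.sin θ * max (-Real.cos θ) 0)))
  have e4 : C.fieldDeriv x t θ = 2 * ((Real.sin θ * Real.cos θ) * ((C.p t)⁻¹ + C.q t) +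
      -C.m t * (x.1 * (Real.sin θ * max (Real.cos θ) 0) +
      x.2 * -(Real.sin θ * max (-Real.cos θ) 0))) := by unfold fieldDeriv; ring
  rw [e4, abs_mul, abs_two]
  unfold bound
  linarith

lemma abs_field_sub_le {x : ℝ × ℝ} {R : ℝ} (h1 : |x.1| ≤ R) (h2 : |x.2| ≤ R) (t θ φ : ℝ) :
    |C.field x t θ - C.field x t φ| ≤ C.bound R * |θ - φ| := by
  have := Convex.norm_image_sub_le_of_norm_hasDerivWithin_le (s := univ)
    (f := C.field x t) (f' := C.fieldDeriv x t) (C := C.bound R) (x := φ) (y := θ)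
    (fun y _ => (C.hasDerivAt_field x t y).hasDerivWithinAt)
    (fun y _ => C.abs_fieldDeriv_le h1 h2 t y) convex_univ (mem_univ _) (mem_univ _)
  simpa [Real.norm_eq_abs] using this

lemma field_sub_param (x y : ℝ × ℝ) (t θ : ℝ) :
    C.field x t θ - C.field y t θ =
      C.m t * ((x.1 - y.1) * posSq (Real.cos θ) + (x.2 - y.2) * posSq (-Real.cos θ)) := by
  unfold field; ring

lemma abs_field_sub_param_le (x y : ℝ × ℝ) (t θ : ℝ) :
    |C.field x t θ - C.field y t θ| ≤ 2 * C.M * ‖x - y‖ := by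
  rw [field_sub_param]
  exact abs_lin_le C.M_pos.le (C.m_le t) (norm_fst_le (x - y)) (norm_snd_le (x - y))
    (abs_posSq_le_one (Real.abs_cos_le_one θ))
    (abs_posSq_le_one (by simpa using Real.abs_cos_le_one θ))

lemma continuous_field (x : ℝ × ℝ) : Continuous fun z : ℝ × ℝ => C.field x z.1 z.2 := by
  have h1 : Continuous fun z : ℝ × ℝ => (C.p z.1)⁻¹ := C.continuous_inv.comp continuous_fst
  have h2 : Continuous fun z : ℝ × ℝ => C.q z.1 := C.hq.comp continuous_fst
  have h3 : Continuous fun z : ℝ × ℝ => C.m z.1 := C.hm.comp continuous_fst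
  have h4 : Continuous fun z : ℝ × ℝ => Real.cos z.2 := by fun_prop
  have h5 : Continuous fun z : ℝ × ℝ => Real.sin z.2 := by fun_prop
  exact (((h5.pow 2).mul h1).sub (h2.mul (h4.pow 2))).add
    (h3.mul (((continuous_posSq.comp h4).const_mul x.1).add
      ((continuous_posSq.comp h4.neg).const_mul x.2)))

/-- The field is bounded and Lipschitz on the whole line of angles, so a single Picard–Lindelöf step
covers the interval. It is run on the larger interval [T₁ - 1, T₂ + 1] to get two-sided derivatives
at T₁ and T₂. -/
lemma exists_angle (x : ℝ × ℝ) : ∃ θ : ℝ → ℝ, θ C.T₁ = 0 ∧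
    ∀ t ∈ Icc C.T₁ C.T₂, HasDerivAt θ (C.field x t (θ t)) t := by
  set R := max |x.1| |x.2|
  have h1 : |x.1| ≤ R := le_max_left _ _
  have h2 : |x.2| ≤ R := le_max_right _ _
  have hR : 0 ≤ R := le_trans (abs_nonneg _) h1
  have hK := C.one_le_bound hR
  have hlt := C.lt
  set L : NNReal := ⟨C.bound R, by linarith⟩
  have hD : (0 : ℝ) ≤ C.bound R * (C.T₂ - C.T₁ + 1) := by nlinarith
  have hPL : IsPicardLindelof (tmin := C.T₁ - 1) (tmax := C.T₂ + 1) (C.field x)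
      ⟨C.T₁, by constructor <;> linarith⟩ 0 ⟨C.bound R * (C.T₂ - C.T₁ + 1), hD⟩ 0 L L := by
    refine ⟨fun t _ => ?_, fun θ _ => ?_, fun t _ θ _ => ?_, ?_⟩
    · refine LipschitzOnWith.of_dist_le_mul fun a _ b _ => ?_
      exact C.abs_field_sub_le h1 h2 t a b
    · exact ((C.continuous_field x).comp (Continuous.prodMk_left θ)).continuousOn
    · exact C.abs_field_le h1 h2 t θ
    · have : max (C.T₂ + 1 - C.T₁) (C.T₁ - (C.T₁ - 1)) = C.T₂ - C.T₁ + 1 := by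
        rw [max_eq_left] <;> linarith
      simp only [this, NNReal.coe_zero, sub_zero]
      exact le_rfl
  obtain ⟨θ, h0, hθ⟩ := hPL.exists_eq_forall_mem_Icc_hasDerivWithinAt₀
  refine ⟨θ, h0, fun t ht => (hθ t ⟨by linarith [ht.1], by linarith [ht.2]⟩).hasDerivAt ?_⟩
  exact Icc_mem_nhds (by linarith [ht.1]) (by linarith [ht.2])

/-- The Prüfer angle of the solution starting with `u (T₁) = 1`, `u' (T₁) = 0`. -/
noncomputable def angle (x : ℝ × ℝ) : ℝ → ℝ := (C.exists_angle x).choose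

lemma angle_left (x : ℝ × ℝ) : C.angle x C.T₁ = 0 := (C.exists_angle x).choose_spec.1

lemma hasDerivAt_angle (x : ℝ × ℝ) {t : ℝ} (ht : t ∈ Icc C.T₁ C.T₂) :
    HasDerivAt (C.angle x) (C.field x t (C.angle x t)) t := (C.exists_angle x).choose_spec.2 t ht

lemma continuousOn_angle (x : ℝ × ℝ) : ContinuousOn (C.angle x) (Icc C.T₁ C.T₂) :=
  fun _ ht => (C.hasDerivAt_angle x ht).continuousAt.continuousWithinAt

/-- The total rotation of the Prüfer angle. -/
noncomputable def rot (x : ℝ × ℝ) : ℝ := C.angle x C.T₂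

lemma gronwall {f f' : ℝ → ℝ} {a b K ε : ℝ} (hK : 1 ≤ K) (hε : 0 ≤ ε)
    (hf : ∀ t ∈ Icc a b, HasDerivAt f (f' t) t) (h0 : f a = 0)
    (hb : ∀ t ∈ Icc a b, |f' t| ≤ K * |f t| + ε) {t : ℝ} (ht : t ∈ Icc a b) :
    |f t| ≤ ε * Real.exp (K * (b - a)) := by
  have := norm_le_gronwallBound_of_norm_deriv_right_le (f := f) (f' := f') (δ := 0) (K := K)
    (ε := ε) (a := a) (b := b) (fun s hs => (hf s hs).continuousAt.continuousWithinAt)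
    (fun s hs => (hf s (Ico_subset_Icc_self hs)).hasDerivWithinAt) (by simp [h0])
    (fun s hs => hb s (Ico_subset_Icc_self hs)) t ht
  rw [Real.norm_eq_abs, gronwallBound_of_K_ne_0 (by linarith)] at this
  refine this.trans ?_
  have e1 : Real.exp (K * (t - a)) ≤ Real.exp (K * (b - a)) := by
    apply Real.exp_le_exp.2; nlinarith [ht.2]
  have e2 : ε / K ≤ ε := div_le_self hε hK
  have e3 : 0 ≤ ε / K := by positivity
  have e4 : 1 ≤ Real.exp (K * (t - a)) := Real.one_le_exp (by nlinarith [ht.1])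
  calc 0 * Real.exp (K * (t - a)) + ε / K * (Real.exp (K * (t - a)) - 1)
      ≤ ε / K * Real.exp (K * (t - a)) := by nlinarith
    _ ≤ ε * Real.exp (K * (b - a)) := mul_le_mul e2 e1 (Real.exp_pos _).le hε

lemma abs_fst_le {x : ℝ × ℝ} {R : ℝ} (h : ‖x‖ ≤ R) : |x.1| ≤ R := (norm_fst_le x).trans h

lemma abs_snd_le {x : ℝ × ℝ} {R : ℝ} (h : ‖x‖ ≤ R) : |x.2| ≤ R := (norm_snd_le x).trans h

/-- The Gronwall constant for parameters of norm at most `R`. -/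
noncomputable def gconst (R : ℝ) : ℝ := Real.exp (C.bound R * (C.T₂ - C.T₁))

lemma gconst_pos (R : ℝ) : 0 < C.gconst R := Real.exp_pos _

/-- The difference of the fields is split through the field of `x` at the angle of `y`, so only the
size of `x` enters the Gronwall constant. -/
lemma abs_angle_sub_le {x y : ℝ × ℝ} {R : ℝ} (hx : ‖x‖ ≤ R) {t : ℝ}
    (ht : t ∈ Icc C.T₁ C.T₂) :
    |C.angle x t - C.angle y t| ≤ 2 * C.M * C.gconst R * ‖x - y‖ := by
  have hR : 0 ≤ R := (norm_nonneg x).trans hx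
  have hM := C.M_pos
  have := gronwall (f := fun t => C.angle x t - C.angle y t) (ε := 2 * C.M * ‖x - y‖)
    (C.one_le_bound hR) (by positivity)
    (fun s hs => (C.hasDerivAt_angle x hs).sub (C.hasDerivAt_angle y hs))
    (by simp [angle_left]) (fun s _ => ?_) ht
  · refine this.trans (le_of_eq ?_)
    unfold gconst; ring
  · have e1 := C.abs_field_sub_le (abs_fst_le hx) (abs_snd_le hx) s (C.angle x s) (C.angle y s)
    have e2 := C.abs_field_sub_param_le x y s (C.angle y s)
    exact (abs_sub_le _ (C.field x s (C.angle y s)) _).trans (by linarith)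

lemma continuous_rot : Continuous C.rot := by
  rw [continuous_iff_continuousAt]
  intro y
  rw [ContinuousAt, tendsto_iff_norm_sub_tendsto_zero]
  have hb : ∀ᶠ x in 𝓝 y, ‖C.rot x - C.rot y‖ ≤
      2 * C.M * C.gconst (‖y‖ + 1) * ‖x - y‖ := by
    filter_upwards [continuous_norm.continuousAt.eventually_lt continuousAt_const
      (show ‖y‖ < ‖y‖ + 1 by linarith)] with x hx
    exact C.abs_angle_sub_le hx.le C.right_mem
  refine squeeze_zero' (Eventually.of_forall fun _ => norm_nonneg _) hb ?_
  have : Continuous fun x => 2 * C.M * C.gconst (‖y‖ + 1) * ‖x - y‖ := by fun_prop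
  simpa using this.tendsto y

lemma field_of_cos_eq_zero (x : ℝ × ℝ) (t : ℝ) {θ : ℝ} (h : Real.cos θ = 0) :
    C.field x t θ = (C.p t)⁻¹ := by
  have : Real.sin θ ^ 2 = 1 := by have := Real.sin_sq_add_cos_sq θ; rw [h] at this; simpa using this
  simp [field, h, this, posSq]

/-- Levels at which the cosine vanishes are crossed upwards only. -/
lemma angle_gt_of_le (x : ℝ × ℝ) {c s t : ℝ} (hc : Real.cos c = 0) (hs : s ∈ Icc C.T₁ C.T₂)
    (ht : t ∈ Icc C.T₁ C.T₂) (hst : s < t) (h : c ≤ C.angle x s) : c < C.angle x t := by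
  have hsub : ∀ r ∈ Icc s t, r ∈ Icc C.T₁ C.T₂ := fun r hr => ⟨hs.1.trans hr.1, hr.2.trans ht.2⟩
  have key : ∀ r ∈ Icc s t, c ≤ C.angle x r := by
    intro r hr
    -- Barrier argument: at any contact with the constant `c`, the angle has slope 1/p > 0.
    refine image_le_of_deriv_right_lt_deriv_boundary' (f := fun _ => c) (f' := fun _ => 0)
      (B := C.angle x) (B' := fun r => C.field x r (C.angle x r)) continuousOn_const
      (fun _ _ => hasDerivWithinAt_const _ _ _) h
      (fun r hr => (C.hasDerivAt_angle x (hsub r hr)).continuousAt.continuousWithinAt)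
      (fun r hr => (C.hasDerivAt_angle x (hsub r (Ico_subset_Icc_self hr))).hasDerivWithinAt)
      (fun r _ hr => ?_) hr
    rw [← hr, C.field_of_cos_eq_zero x r hc]
    exact C.inv_pos r
  -- If the angle equalled `c` at `t`, its positive slope there would put it below `c` just before
  -- `t`, against `key`.
  refine lt_of_le_of_ne (key t ⟨hst.le, le_rfl⟩) fun heq => ?_
  have hd := C.hasDerivAt_angle x ht
  rw [← heq, C.field_of_cos_eq_zero x t hc] at hd
  have h2 := hd.tendsto_slope
  have h3 : ∀ᶠ r in 𝓝[≠] t, 0 < slope (C.angle x) t r := h2.eventually (lt_mem_nhds (C.inv_pos t))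
  have h4 : ∀ᶠ r in 𝓝[<] t, 0 < slope (C.angle x) t r :=
    h3.filter_mono (nhdsWithin_mono _ fun r hr => ne_of_lt hr)
  have h5 : ∀ᶠ r in 𝓝[<] t, r ∈ Ioo s t := Ioo_mem_nhdsLT hst
  obtain ⟨r, hr, hr2⟩ := (h4.and h5).exists
  rw [slope_def_field, ← heq] at hr
  have h6 := key r ⟨hr2.1.le, hr2.2.le⟩
  have : (C.angle x r - c) / (r - t) ≤ 0 :=
    div_nonpos_of_nonneg_of_nonpos (by linarith) (by linarith [hr2.2])
  linarith

end Coeffs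
end Fucik

/-! ### Differentiability of the rotation; return to the second-order equation -/

namespace Fucik

lemma posSq_eq_mul (x : ℝ) : posSq x = x * max x 0 := by
  rcases le_total 0 x with h | h
  · rw [posSq_of_nonneg h, max_eq_left h]; ring
  · rw [posSq_of_nonpos h, max_eq_right h, mul_zero]

lemma abs_max_zero_sub_le (a b : ℝ) : |max a 0 - max b 0| ≤ |a - b| := abs_max_sub_max_le_abs a b 0

lemma abs_posSq_sub_le {a b : ℝ} (ha : |a| ≤ 1) (hb : |b| ≤ 1) :
    |posSq a - posSq b| ≤ 2 * |a - b| := by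
  have h1 : posSq a - posSq b = (max a 0 + max b 0) * (max a 0 - max b 0) := by unfold posSq; ring
  have ha' : max a 0 ≤ 1 := max_le (le_trans (le_abs_self a) ha) zero_le_one
  have hb' : max b 0 ≤ 1 := max_le (le_trans (le_abs_self b) hb) zero_le_one
  have ha0 : 0 ≤ max a 0 := le_max_right _ _
  have hb0 : 0 ≤ max b 0 := le_max_right _ _
  rw [h1, abs_mul, abs_of_nonneg (by linarith : 0 ≤ max a 0 + max b 0)]
  exact mul_le_mul (by linarith) (abs_max_zero_sub_le a b) (abs_nonneg _) (by norm_num)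

lemma abs_mul_sub_mul_le {a b c d e : ℝ} (ha : |a| ≤ 1) (hd : |d| ≤ 1) (h1 : |a - c| ≤ e)
    (h2 : |b - d| ≤ e) : |a * b - c * d| ≤ 2 * e := by
  have : a * b - c * d = a * (b - d) + (a - c) * d := by ring
  rw [this]
  refine (abs_add_le _ _).trans ?_
  rw [abs_mul, abs_mul]
  nlinarith [abs_nonneg a, abs_nonneg d, abs_nonneg (a - c), abs_nonneg (b - d)]

namespace Coeffs

variable (C : Coeffs)

lemma continuous_fieldDeriv (x : ℝ × ℝ) : Continuous fun z : ℝ × ℝ => C.fieldDeriv x z.1 z.2 := by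
  have h1 : Continuous fun z : ℝ × ℝ => (C.p z.1)⁻¹ := C.continuous_inv.comp continuous_fst
  have h2 : Continuous fun z : ℝ × ℝ => C.q z.1 := C.hq.comp continuous_fst
  have h3 : Continuous fun z : ℝ × ℝ => C.m z.1 := C.hm.comp continuous_fst
  unfold fieldDeriv
  fun_prop

/-- Since the positive part is Lipschitz, the angular derivative of the field is Lipschitz in angle
and parameters jointly; this controls the error of the linearization. -/
lemma abs_fieldDeriv_sub_le {x y : ℝ × ℝ} {R : ℝ} (hy : ‖y‖ ≤ R) (t ξ θ : ℝ) :
    |C.fieldDeriv x t ξ - C.fieldDeriv y t θ| ≤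
      2 * C.bound R * (|ξ - θ| + ‖x - y‖) := by
  have hM := C.M_pos
  have hR : 0 ≤ R := (norm_nonneg y).trans hy
  set e := |ξ - θ|
  have he : 0 ≤ e := abs_nonneg _
  have hs := Real.abs_sin_sub_sin_le ξ θ
  have hc := Real.abs_cos_sub_cos_le ξ θ
  have hc' : |max (Real.cos ξ) 0 - max (Real.cos θ) 0| ≤ e :=
    (abs_max_zero_sub_le _ _).trans hc
  have hc'' : |max (-Real.cos ξ) 0 - max (-Real.cos θ) 0| ≤ e := by
    refine (abs_max_zero_sub_le _ _).trans ?_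
    rw [neg_sub_neg, abs_sub_comm]; exact hc
  have b1 := abs_mul_sub_mul_le (Real.abs_sin_le_one ξ) (Real.abs_cos_le_one θ) hs hc
  have b2 := abs_mul_sub_mul_le (Real.abs_sin_le_one ξ) (abs_max_cos_le θ) hs hc'
  have b3 := abs_mul_sub_mul_le (Real.abs_sin_le_one ξ) (abs_max_neg_cos_le θ) hs hc''
  set A := Real.sin ξ * max (Real.cos ξ) 0
  set B := Real.sin ξ * max (-Real.cos ξ) 0
  set A' := Real.sin θ * max (Real.cos θ) 0
  set B' := Real.sin θ * max (-Real.cos θ) 0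
  have hA : |A| ≤ 1 := abs_mul_le_one (Real.abs_sin_le_one ξ) (abs_max_cos_le ξ)
  have hB : |B| ≤ 1 := abs_mul_le_one (Real.abs_sin_le_one ξ) (abs_max_neg_cos_le ξ)
  have d1 : |x.1 - y.1| ≤ ‖x - y‖ := norm_fst_le (x - y)
  have d2 : |x.2 - y.2| ≤ ‖x - y‖ := norm_snd_le (x - y)
  have hy1 := abs_fst_le hy
  have hy2 := abs_snd_le hy
  have hn : 0 ≤ ‖x - y‖ := norm_nonneg _
  have aux : ∀ {a b c d : ℝ}, |a - b| ≤ ‖x - y‖ → |b| ≤ R → |c| ≤ 1 → |c - d| ≤ 2 * e →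
      |a * c - b * d| ≤ ‖x - y‖ + 2 * R * e := by
    intro a b c d h1 h2 h3 h4
    have : a * c - b * d = (a - b) * c + b * (c - d) := by ring
    rw [this]
    refine (abs_add_le _ _).trans ?_
    rw [abs_mul, abs_mul]
    have i1 := mul_le_mul h1 h3 (abs_nonneg _) hn
    have i2 := mul_le_mul h2 h4 (abs_nonneg _) hR
    linarith
  have k1 := aux d1 hy1 hA b2
  have k2 := aux d2 hy2 hB b3
  have k3 : |(x.1 * A - y.1 * A') - (x.2 * B - y.2 * B')| ≤ 2 * (‖x - y‖ + 2 * R * e) :=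
    (abs_sub _ _).trans (by linarith)
  have k4 : |C.m t * ((x.1 * A - y.1 * A') - (x.2 * B - y.2 * B'))| ≤
      C.M * (2 * (‖x - y‖ + 2 * R * e)) := by
    rw [abs_mul]; exact mul_le_mul (C.m_le t) k3 (abs_nonneg _) hM.le
  have hP : 0 ≤ (C.p t)⁻¹ + C.q t := by have := C.inv_pos t; have := C.q_nonneg t; positivity
  have k5 : |(Real.sin ξ * Real.cos ξ - Real.sin θ * Real.cos θ) * ((C.p t)⁻¹ + C.q t)| ≤
      2 * e * (2 * C.M) := by
    rw [abs_mul, abs_of_nonneg hP]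
    exact mul_le_mul b1 (by linarith [C.inv_le t, C.q_le t]) hP (by positivity)
  have k6 : C.fieldDeriv x t ξ - C.fieldDeriv y t θ =
      2 * ((Real.sin ξ * Real.cos ξ - Real.sin θ * Real.cos θ) * ((C.p t)⁻¹ + C.q t) -
        C.m t * ((x.1 * A - y.1 * A') - (x.2 * B - y.2 * B'))) := by
    unfold fieldDeriv; ring
  rw [k6, abs_mul, abs_two]
  have k7 := abs_sub ((Real.sin ξ * Real.cos ξ - Real.sin θ * Real.cos θ) * ((C.p t)⁻¹ + C.q t))
    (C.m t * ((x.1 * A - y.1 * A') - (x.2 * B - y.2 * B')))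
  have k8 : 0 ≤ C.M * R * ‖x - y‖ := by positivity
  have k9 : 0 ≤ C.M * ‖x - y‖ := by positivity
  unfold bound
  nlinarith

/-- The angle, extended continuously by constants. -/
noncomputable def extAngle (x : ℝ × ℝ) (t : ℝ) : ℝ := C.angle x (projIcc C.T₁ C.T₂ C.lt.le t)

lemma continuous_extAngle (x : ℝ × ℝ) : Continuous (C.extAngle x) :=
  (continuousOn_iff_continuous_domRestrict.1 (C.continuousOn_angle x)).comp continuous_projIcc

lemma extAngle_of_mem (x : ℝ × ℝ) {t : ℝ} (ht : t ∈ Icc C.T₁ C.T₂) :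
    C.extAngle x t = C.angle x t := by
  rw [extAngle, projIcc_of_mem _ ht]

/-- The logarithm of the Prüfer radius. -/
noncomputable def logRad (x : ℝ × ℝ) (t : ℝ) : ℝ :=
  ∫ s in C.T₁..t, -(1 / 2) * C.fieldDeriv x s (C.extAngle x s)

lemma continuous_logRad_integrand (x : ℝ × ℝ) :
    Continuous fun s => -(1 / 2) * C.fieldDeriv x s (C.extAngle x s) := by
  have h1 : Continuous fun s => (s, C.extAngle x s) :=
    continuous_id.prodMk (C.continuous_extAngle x)
  have h2 := (C.continuous_fieldDeriv x).comp h1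
  simp only [Function.comp_def] at h2
  exact continuous_const.mul h2

lemma hasDerivAt_logRad (x : ℝ × ℝ) {t : ℝ} (ht : t ∈ Icc C.T₁ C.T₂) :
    HasDerivAt (C.logRad x) (-(1 / 2) * C.fieldDeriv x t (C.angle x t)) t := by
  have hc := C.continuous_logRad_integrand x
  have := hc.integral_hasStrictDerivAt C.T₁ t
  rw [C.extAngle_of_mem x ht] at this
  exact this.hasDerivAt

lemma continuous_logRad (x : ℝ × ℝ) : Continuous (C.logRad x) := by
  have hc := C.continuous_logRad_integrand x
  exact continuous_iff_continuousAt.2 fun t =>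
    (hc.integral_hasStrictDerivAt C.T₁ t).hasDerivAt.continuousAt

lemma logRad_left (x : ℝ × ℝ) : C.logRad x C.T₁ = 0 := by simp [logRad]

/-- The sensitivity of the angle to the parameter of the sign `σ`, times the squared radius. -/
noncomputable def sens (σ : ℝ) (x : ℝ × ℝ) (t : ℝ) : ℝ :=
  ∫ s in C.T₁..t, Real.exp (2 * C.logRad x s) * (C.m s * posSq (σ * Real.cos (C.extAngle x s)))

lemma hasDerivAt_sens (σ : ℝ) (x : ℝ × ℝ) {t : ℝ} (ht : t ∈ Icc C.T₁ C.T₂) :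
    HasDerivAt (C.sens σ x)
      (Real.exp (2 * C.logRad x t) * (C.m t * posSq (σ * Real.cos (C.angle x t)))) t := by
  have hc : Continuous fun s => Real.exp (2 * C.logRad x s) *
      (C.m s * posSq (σ * Real.cos (C.extAngle x s))) := by
    have h1 := C.continuous_logRad x
    have h2 := C.hm
    have h3 := C.continuous_extAngle x
    have h4 := continuous_posSq
    fun_prop
  have := hc.integral_hasStrictDerivAt C.T₁ t
  rw [C.extAngle_of_mem x ht] at this
  exact this.hasDerivAt

lemma sens_left (σ : ℝ) (x : ℝ × ℝ) : C.sens σ x C.T₁ = 0 := by simp [sens]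

/-- The derivative of the angle with respect to the parameter of the sign `σ`. -/
noncomputable def angleDeriv (σ : ℝ) (x : ℝ × ℝ) (t : ℝ) : ℝ :=
  Real.exp (-(2 * C.logRad x t)) * C.sens σ x t

lemma angleDeriv_left (σ : ℝ) (x : ℝ × ℝ) : C.angleDeriv σ x C.T₁ = 0 := by
  simp [angleDeriv, sens_left]

/-- This is the variational equation. Since `logRad` has derivative -½ `fieldDeriv`, the squared
radius is its integrating factor, which explains the form of `sens`. -/
lemma hasDerivAt_angleDeriv (σ : ℝ) (x : ℝ × ℝ) {t : ℝ} (ht : t ∈ Icc C.T₁ C.T₂) :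
    HasDerivAt (C.angleDeriv σ x) (C.fieldDeriv x t (C.angle x t) * C.angleDeriv σ x t +
      C.m t * posSq (σ * Real.cos (C.angle x t))) t := by
  have h1 := ((C.hasDerivAt_logRad x ht).const_mul 2).neg.exp
  refine (h1.mul (C.hasDerivAt_sens σ x ht)).congr_deriv ?_
  have h2 : Real.exp (-(2 * C.logRad x t)) * Real.exp (2 * C.logRad x t) = 1 := by
    rw [← Real.exp_add]; simp
  unfold angleDeriv
  linear_combination (C.m t * posSq (σ * Real.cos (C.angle x t))) * h2

/-- The linear map at `x₀` is tested on two moving points `x`, `y`, as strict differentiability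
demands. The remainder solves a linear differential inequality whose source is of order η‖x - y‖,
and Gronwall concludes. -/
lemma abs_angle_linearization_le (x₀ : ℝ × ℝ) : ∃ Q : ℝ, 0 ≤ Q ∧ ∀ x y : ℝ × ℝ, ∀ η : ℝ, η ≤ 1 →
    ‖x - x₀‖ ≤ η → ‖y - x₀‖ ≤ η →
    |C.rot x - C.rot y - (C.angleDeriv 1 x₀ C.T₂ * (x.1 - y.1) +
      C.angleDeriv (-1) x₀ C.T₂ * (x.2 - y.2))| ≤ Q * η * ‖x - y‖ := by
  have hM := C.M_pos
  set R := ‖x₀‖ + 1 with hRdef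
  have hR : 0 ≤ R := by positivity
  have hK := C.one_le_bound hR
  set K := C.bound R
  have hG := C.gconst_pos R
  set G := C.gconst R
  set L := 2 * C.M * G with hL
  have hL0 : 0 ≤ L := by positivity
  refine ⟨(2 * K * (L + 1) * L + 2 * C.M * (2 * L)) * G, by positivity, ?_⟩
  intro x y η hη hx hy
  have hη0 : 0 ≤ η := (norm_nonneg _).trans hx
  have nx : ‖x‖ ≤ R := by
    have := norm_add_le (x - x₀) x₀; rw [sub_add_cancel] at this; linarith
  have ny : ‖y‖ ≤ R := by
    have := norm_add_le (y - x₀) x₀; rw [sub_add_cancel] at this; linarith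
  have n0 : ‖x₀‖ ≤ R := by linarith
  set δ := ‖x - y‖
  have hδ : 0 ≤ δ := norm_nonneg _
  have main := gronwall
    (f := fun t => C.angle x t - C.angle y t - (C.angleDeriv 1 x₀ t * (x.1 - y.1) +
      C.angleDeriv (-1) x₀ t * (x.2 - y.2)))
    (ε := (2 * K * (L + 1) * L + 2 * C.M * (2 * L)) * η * δ) hK (by positivity)
    (fun s hs => ((C.hasDerivAt_angle x hs).sub (C.hasDerivAt_angle y hs)).sub
      (((C.hasDerivAt_angleDeriv 1 x₀ hs).mul_const (x.1 - y.1)).add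
        ((C.hasDerivAt_angleDeriv (-1) x₀ hs).mul_const (x.2 - y.2))))
    (by simp [angle_left, angleDeriv_left]) (fun s hs => ?_) C.right_mem
  · refine main.trans (le_of_eq ?_)
    change _ * G = _
    ring
  have dx : |C.angle x s - C.angle x₀ s| ≤ L * η :=
    (C.abs_angle_sub_le nx hs).trans (mul_le_mul_of_nonneg_left hx hL0)
  have dy : |C.angle y s - C.angle x₀ s| ≤ L * η :=
    (C.abs_angle_sub_le ny hs).trans (mul_le_mul_of_nonneg_left hy hL0)
  have dxy : |C.angle x s - C.angle y s| ≤ L * δ := C.abs_angle_sub_le nx hs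
  set θx := C.angle x s
  set θy := C.angle y s
  set θ₀ := C.angle x₀ s
  set g := C.fieldDeriv x₀ s θ₀
  -- Mean value inequality on the ball of radius Lη about θ₀, which contains both angles; there the
  -- angular derivative differs from `g` by O(η).
  have e1 : |(C.field x s θx - g * θx) - (C.field x s θy - g * θy)| ≤
      2 * K * ((L + 1) * η) * |θx - θy| := by
    have := Convex.norm_image_sub_le_of_norm_hasDerivWithin_le (s := Metric.closedBall θ₀ (L * η))
      (f := fun θ => C.field x s θ - g * θ) (f' := fun θ => C.fieldDeriv x s θ - g * 1)
      (C := 2 * K * ((L + 1) * η)) (x := θy) (y := θx)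
      (fun z _ => ((C.hasDerivAt_field x s z).sub
        ((hasDerivAt_id z).const_mul g)).hasDerivWithinAt)
      (fun z hz => ?_) (convex_closedBall _ _) ?_ ?_
    · simpa [Real.norm_eq_abs] using this
    · rw [Real.norm_eq_abs, mul_one]
      refine (C.abs_fieldDeriv_sub_le n0 s z θ₀).trans ?_
      have : |z - θ₀| ≤ L * η := by simpa [Real.dist_eq] using hz
      refine mul_le_mul_of_nonneg_left ?_ (by positivity)
      linarith
    · simpa [Real.dist_eq] using dy
    · simpa [Real.dist_eq] using dx
  have e1' : 2 * K * ((L + 1) * η) * |θx - θy| ≤ 2 * K * ((L + 1) * η) * (L * δ) :=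
    mul_le_mul_of_nonneg_left dxy (by positivity)
  have hcy : |Real.cos θy - Real.cos θ₀| ≤ L * η := (Real.abs_cos_sub_cos_le _ _).trans dy
  have e2 : |posSq (1 * Real.cos θy) - posSq (1 * Real.cos θ₀)| ≤ 2 * (L * η) := by
    rw [one_mul, one_mul]
    exact (abs_posSq_sub_le (Real.abs_cos_le_one _) (Real.abs_cos_le_one _)).trans (by linarith)
  have e3 : |posSq (-1 * Real.cos θy) - posSq (-1 * Real.cos θ₀)| ≤ 2 * (L * η) := by
    rw [neg_one_mul, neg_one_mul]
    refine (abs_posSq_sub_le (by simpa using Real.abs_cos_le_one θy)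
      (by simpa using Real.abs_cos_le_one θ₀)).trans ?_
    rw [neg_sub_neg, abs_sub_comm]; linarith
  have d1 : |x.1 - y.1| ≤ δ := norm_fst_le (x - y)
  have d2 : |x.2 - y.2| ≤ δ := norm_snd_le (x - y)
  have e4 : |C.m s * ((posSq (1 * Real.cos θy) - posSq (1 * Real.cos θ₀)) * (x.1 - y.1) +
      (posSq (-1 * Real.cos θy) - posSq (-1 * Real.cos θ₀)) * (x.2 - y.2))| ≤
      C.M * (2 * (2 * (L * η) * δ)) := by
    rw [abs_mul]
    refine mul_le_mul (C.m_le s) ((abs_add_le _ _).trans ?_) (abs_nonneg _) hM.le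
    rw [abs_mul, abs_mul]
    have i1 := mul_le_mul e2 d1 (abs_nonneg _) (by positivity)
    have i2 := mul_le_mul e3 d2 (abs_nonneg _) (by positivity)
    linarith
  have hg : |g| ≤ K := C.abs_fieldDeriv_le (abs_fst_le n0) (abs_snd_le n0) s θ₀
  set r := θx - θy - (C.angleDeriv 1 x₀ s * (x.1 - y.1) + C.angleDeriv (-1) x₀ s * (x.2 - y.2))
  have e5 : |g * r| ≤ K * |r| := by
    rw [abs_mul]; exact mul_le_mul_of_nonneg_right hg (abs_nonneg _)
  have e6 := C.field_sub_param x y s θy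
  -- The derivative of the remainder is the nonlinearity in the angle, plus the variation of the
  -- parameter coefficients, plus `g * r`, which is the Gronwall term.
  have e7 : C.field x s θx - C.field y s θy -
      ((g * C.angleDeriv 1 x₀ s + C.m s * posSq (1 * Real.cos θ₀)) * (x.1 - y.1) +
        (g * C.angleDeriv (-1) x₀ s + C.m s * posSq (-1 * Real.cos θ₀)) * (x.2 - y.2)) =
      ((C.field x s θx - g * θx) - (C.field x s θy - g * θy)) +
      C.m s * ((posSq (1 * Real.cos θy) - posSq (1 * Real.cos θ₀)) * (x.1 - y.1) +
      (posSq (-1 * Real.cos θy) - posSq (-1 * Real.cos θ₀)) * (x.2 - y.2)) + g * r := by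
    rw [one_mul, one_mul, neg_one_mul, neg_one_mul]
    linear_combination e6
  rw [e7]
  refine (abs_add_le _ _).trans ?_
  have e8 := abs_add_le ((C.field x s θx - g * θx) - (C.field x s θy - g * θy))
    (C.m s * ((posSq (1 * Real.cos θy) - posSq (1 * Real.cos θ₀)) * (x.1 - y.1) +
      (posSq (-1 * Real.cos θy) - posSq (-1 * Real.cos θ₀)) * (x.2 - y.2)))
  have e9 : (2 * K * (L + 1) * L + 2 * C.M * (2 * L)) * η * δ =
      2 * K * ((L + 1) * η) * (L * δ) + C.M * (2 * (2 * (L * η) * δ)) := by ring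
  rw [e9]
  linarith

lemma hasStrictFDerivAt_rot (x₀ : ℝ × ℝ) :
    HasStrictFDerivAt C.rot (C.angleDeriv 1 x₀ C.T₂ • ContinuousLinearMap.fst ℝ ℝ ℝ +
      C.angleDeriv (-1) x₀ C.T₂ • ContinuousLinearMap.snd ℝ ℝ ℝ) x₀ := by
  obtain ⟨Q, hQ, h⟩ := C.abs_angle_linearization_le x₀
  refine .of_isLittleO (Asymptotics.IsLittleO.of_bound fun c hc => ?_)
  set η := min 1 (c / (Q + 1)) with hη
  have hη0 : 0 < η := lt_min one_pos (by positivity)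
  have hb : ∀ᶠ z : (ℝ × ℝ) × (ℝ × ℝ) in 𝓝 (x₀, x₀),
      z ∈ Metric.ball x₀ η ×ˢ Metric.ball x₀ η :=
    prod_mem_nhds (Metric.ball_mem_nhds _ hη0) (Metric.ball_mem_nhds _ hη0)
  filter_upwards [hb] with z hz
  have h1 := h z.1 z.2 η (min_le_left _ _) (mem_ball_iff_norm.1 hz.1).le
    (mem_ball_iff_norm.1 hz.2).le
  have h2 : Q * η ≤ c := by
    have : η ≤ c / (Q + 1) := min_le_right _ _
    calc Q * η ≤ (Q + 1) * (c / (Q + 1)) := by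
          apply mul_le_mul _ this hη0.le <;> linarith
      _ = c := by field_simp
  refine le_trans ?_ (h1.trans (mul_le_mul_of_nonneg_right h2 (norm_nonneg _)))
  simp [Real.norm_eq_abs]

/-- The solution with `u (T₁) = 1`, `u' (T₁) = 0`. -/
noncomputable def sol (x : ℝ × ℝ) (t : ℝ) : ℝ := Real.exp (C.logRad x t) * Real.cos (C.angle x t)

/-- The flux `p u'` of the solution with `u (T₁) = 1`, `u' (T₁) = 0`. -/
noncomputable def flux (x : ℝ × ℝ) (t : ℝ) : ℝ :=
  -(Real.exp (C.logRad x t) * Real.sin (C.angle x t))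

/-- In polar coordinates the system for (u, p u') gives ρ'/ρ = -½ ∂θ(field), which is the choice
made in `logRad`; with the angle equation this returns the original system. -/
lemma hasDerivAt_sol (x : ℝ × ℝ) {t : ℝ} (ht : t ∈ Icc C.T₁ C.T₂) :
    HasDerivAt (C.sol x) (C.flux x t * (C.p t)⁻¹) t := by
  refine ((C.hasDerivAt_logRad x ht).exp.mul (C.hasDerivAt_angle x ht).cos).congr_deriv ?_
  have h := Real.sin_sq_add_cos_sq (C.angle x t)
  unfold fieldDeriv field flux
  rw [posSq_eq_mul, posSq_eq_mul]
  linear_combination (-(Real.exp (C.logRad x t) * Real.sin (C.angle x t) * (C.p t)⁻¹)) * h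

lemma hasDerivAt_flux (x : ℝ × ℝ) {t : ℝ} (ht : t ∈ Icc C.T₁ C.T₂) :
    HasDerivAt (C.flux x) (C.q t * C.sol x t - C.m t *
      (x.1 * max (C.sol x t) 0 - x.2 * max (-C.sol x t) 0)) t := by
  refine ((C.hasDerivAt_logRad x ht).exp.mul (C.hasDerivAt_angle x ht).sin).neg.congr_deriv ?_
  have h := Real.sin_sq_add_cos_sq (C.angle x t)
  have he := (Real.exp_pos (C.logRad x t)).le
  have m1 : max (C.sol x t) 0 = Real.exp (C.logRad x t) * max (Real.cos (C.angle x t)) 0 := by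
    rw [mul_max_of_nonneg _ _ he, mul_zero]; rfl
  have m2 : max (-C.sol x t) 0 = Real.exp (C.logRad x t) * max (-Real.cos (C.angle x t)) 0 := by
    rw [mul_max_of_nonneg _ _ he, mul_zero, mul_neg]; rfl
  rw [m1, m2]
  unfold fieldDeriv field sol
  rw [posSq_eq_mul, posSq_eq_mul]
  linear_combination (Real.exp (C.logRad x t) * (C.q t * Real.cos (C.angle x t) -
    C.m t * (x.1 * max (Real.cos (C.angle x t)) 0 - x.2 * max (-Real.cos (C.angle x t)) 0))) * h

end Coeffs
end Fucik

/-! ### Comparison theorems and nodal intervals -/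

namespace Fucik

/-- The quotient of two functions vanishing at a point tends to the quotient of derivatives. -/
lemma tendsto_div_of_hasDerivAt {f g : ℝ → ℝ} {f' g' e : ℝ} (hf : HasDerivAt f f' e)
    (hg : HasDerivAt g g' e) (hf0 : f e = 0) (hg0 : g e = 0) (hg' : g' ≠ 0) :
    Tendsto (fun t => f t / g t) (𝓝[≠] e) (𝓝 (f' / g')) := by
  refine (hf.tendsto_slope.div hg.tendsto_slope hg').congr' ?_
  filter_upwards [self_mem_nhdsWithin] with t ht
  have : t - e ≠ 0 := sub_ne_zero.2 ht
  simp only [Pi.div_apply, slope_def_field, hf0, hg0, sub_zero]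
  field_simp

/-- Comparison of two positive solutions of linear equations with an indefinite weight `w`,
by Picone's identity. -/
lemma not_pos_of_param_lt {s z l₁ l₂ : ℝ} {p q w u₁ v₁ u₂ v₂ : ℝ → ℝ} (hsz : s < z)
    (h1 : 0 < l₁) (h12 : l₁ < l₂) (hp : ∀ t, 0 < p t) (hq : ∀ t, 0 ≤ q t)
    (hu₁ : ∀ t ∈ Icc s z, HasDerivAt u₁ (v₁ t * (p t)⁻¹) t)
    (hu₂ : ∀ t ∈ Icc s z, HasDerivAt u₂ (v₂ t * (p t)⁻¹) t)
    (hv₁c : ContinuousOn v₁ (Icc s z)) (hv₂c : ContinuousOn v₂ (Icc s z))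
    (hv₁ : ∀ t ∈ Ioo s z, HasDerivAt v₁ ((q t - l₁ * w t) * u₁ t) t)
    (hv₂ : ∀ t ∈ Ioo s z, HasDerivAt v₂ ((q t - l₂ * w t) * u₂ t) t)
    (pos₁ : ∀ t ∈ Ioo s z, 0 < u₁ t) (pos₂ : ∀ t ∈ Ioo s z, 0 < u₂ t)
    (hbc : ∀ e ∈ ({s, z} : Set ℝ), (u₁ e = 0 ∧ (u₂ e ≠ 0 ∨ v₂ e ≠ 0)) ∨
      (v₁ e = 0 ∧ v₂ e = 0 ∧ u₂ e ≠ 0))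
    (h0 : u₁ s = 0 ∨ u₁ z = 0) : False := by
  -- Picone's function (l₂/l₁) u₁v₁ - v₂u₁²/u₂. The factor l₂/l₁ cancels the weight `w`, whose sign
  -- is unknown, from the derivative. Writing u₁²/u₂ as u₁ · (u₁/u₂) makes the limits at the end
  -- points visible.
  set G : ℝ → ℝ := fun t => -(v₂ t * u₁ t * (u₁ t / u₂ t)) + l₂ / l₁ * (u₁ t * v₁ t)
  have hu₁c : ContinuousOn u₁ (Icc s z) :=
    fun t ht => (hu₁ t ht).continuousAt.continuousWithinAt
  have hlim : ∀ e ∈ ({s, z} : Set ℝ), Tendsto G (𝓝[Ioo s z] e) (𝓝 0) := by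
    intro e he
    have heI : e ∈ Icc s z := by
      rcases he with rfl | rfl
      · exact left_mem_Icc.2 hsz.le
      · exact right_mem_Icc.2 hsz.le
    have heO : e ∉ Ioo s z := by
      rcases he with rfl | rfl
      · exact left_notMem_Ioo
      · exact right_notMem_Ioo
    have t1 : Tendsto u₁ (𝓝[Ioo s z] e) (𝓝 (u₁ e)) :=
      (hu₁ e heI).continuousAt.tendsto.mono_left nhdsWithin_le_nhds
    have t2 : Tendsto u₂ (𝓝[Ioo s z] e) (𝓝 (u₂ e)) :=
      (hu₂ e heI).continuousAt.tendsto.mono_left nhdsWithin_le_nhds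
    have t3 : Tendsto v₁ (𝓝[Ioo s z] e) (𝓝 (v₁ e)) :=
      (hv₁c e heI).tendsto.mono_left (nhdsWithin_mono _ Ioo_subset_Icc_self)
    have t4 : Tendsto v₂ (𝓝[Ioo s z] e) (𝓝 (v₂ e)) :=
      (hv₂c e heI).tendsto.mono_left (nhdsWithin_mono _ Ioo_subset_Icc_self)
    -- If u₂ vanishes at the end point, then so does u₁ while v₂ does not; the quotient u₁/u₂ stays
    -- bounded and the factor u₁ kills the term.
    by_cases h2 : u₂ e = 0
    · rcases hbc e he with ⟨ha, hb⟩ | ⟨-, -, hb⟩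
      · have hv2 : v₂ e ≠ 0 := hb.resolve_left (not_not.2 h2)
        have t5 := (tendsto_div_of_hasDerivAt (hu₁ e heI) (hu₂ e heI) ha h2
          (mul_ne_zero hv2 (inv_ne_zero (hp e).ne'))).mono_left
          (nhdsWithin_mono e (fun t ht => by rintro rfl; exact heO ht) : 𝓝[Ioo s z] e ≤ 𝓝[≠] e)
        have t6 := ((t4.mul t1).mul t5).neg.add ((t1.mul t3).const_mul (l₂ / l₁))
        simpa [ha] using t6
      · exact absurd h2 hb
    · have t6 := ((t4.mul t1).mul (t1.div t2 h2)).neg.add ((t1.mul t3).const_mul (l₂ / l₁))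
      rcases hbc e he with ⟨ha, -⟩ | ⟨ha, hb, -⟩
      · simpa [ha] using t6
      · simpa [ha, hb] using t6
  have hG : ∀ t ∈ Ioo s z, HasDerivAt G ((v₂ t * u₁ t / u₂ t - v₁ t) ^ 2 * (p t)⁻¹ +
      (l₂ / l₁ - 1) * (v₁ t ^ 2 * (p t)⁻¹ + q t * u₁ t ^ 2)) t := by
    intro t ht
    have htI := Ioo_subset_Icc_self ht
    have hne := (pos₂ t ht).ne'
    refine ((((hv₂ t ht).mul (hu₁ t htI)).mul ((hu₁ t htI).div (hu₂ t htI) hne)).neg.add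
      (((hu₁ t htI).mul (hv₁ t ht)).const_mul (l₂ / l₁))).congr_deriv ?_
    simp only [Pi.mul_apply, Pi.div_apply]
    field_simp
    ring
  have hpos : 0 < l₂ / l₁ - 1 := by rw [sub_pos, lt_div_iff₀ h1]; linarith
  have hmono : MonotoneOn G (Ioo s z) := by
    refine monotoneOn_of_deriv_nonneg (convex_Ioo s z)
      (fun t ht => (hG t ht).continuousAt.continuousWithinAt)
      (fun t ht => ?_) (fun t ht => ?_)
    · rw [interior_Ioo] at ht
      exact (hG t ht).differentiableAt.differentiableWithinAt
    · rw [interior_Ioo] at ht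
      rw [(hG t ht).deriv]
      have := inv_pos.2 (hp t)
      have := hq t
      positivity
  -- A monotone function with limit 0 at both ends is zero.
  have hzero : ∀ t ∈ Ioo s z, G t = 0 := by
    intro t ht
    refine le_antisymm ?_ ?_
    · have l2 := hlim z (by simp)
      rw [nhdsWithin_Ioo_eq_nhdsLT hsz] at l2
      refine ge_of_tendsto l2 ?_
      filter_upwards [Ioo_mem_nhdsLT ht.2] with r hr
      exact hmono ht ⟨ht.1.trans hr.1, hr.2⟩ hr.1.le
    · have l2 := hlim s (by simp)
      rw [nhdsWithin_Ioo_eq_nhdsGT hsz] at l2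
      refine le_of_tendsto l2 ?_
      filter_upwards [Ioo_mem_nhdsGT ht.1] with r hr
      exact hmono ⟨hr.1, hr.2.trans ht.2⟩ ht hr.2.le
  -- All terms of G' are nonnegative, so each vanishes, in particular v₁²/p. Then u₁ is constant,
  -- which its zero at an end point contradicts.
  have hv0 : ∀ t ∈ Ioo s z, v₁ t = 0 := by
    intro t ht
    have e1 : G =ᶠ[𝓝 t] fun _ => 0 := by
      filter_upwards [Ioo_mem_nhds ht.1 ht.2] with r hr using hzero r hr
    have e2 := (hG t ht).unique ((hasDerivAt_const t (0 : ℝ)).congr_of_eventuallyEq e1)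
    have hpi := inv_pos.2 (hp t)
    have a1 : 0 ≤ (v₂ t * u₁ t / u₂ t - v₁ t) ^ 2 * (p t)⁻¹ := by positivity
    have a2 : 0 ≤ q t * u₁ t ^ 2 := by have := hq t; positivity
    have a3 : 0 ≤ v₁ t ^ 2 * (p t)⁻¹ := by positivity
    have a4 : v₁ t ^ 2 * (p t)⁻¹ = 0 := by nlinarith
    simpa [(hp t).ne'] using a4
  obtain ⟨c, hc⟩ := exists_between hsz
  have hconst : ∀ t ∈ Icc s z, u₁ t = u₁ s := by
    refine constant_of_has_deriv_right_zero hu₁c fun t ht => ?_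
    rcases eq_or_lt_of_le ht.1 with rfl | h
    · have e1 : v₁ s = 0 := by
        have t3 : Tendsto v₁ (𝓝[Ioo s z] s) (𝓝 (v₁ s)) :=
          (hv₁c s (left_mem_Icc.2 hsz.le)).tendsto.mono_left
            (nhdsWithin_mono _ Ioo_subset_Icc_self)
        have t4 : Tendsto v₁ (𝓝[Ioo s z] s) (𝓝 0) :=
          tendsto_const_nhds.congr' (by
            filter_upwards [self_mem_nhdsWithin] with r hr using (hv0 r hr).symm)
        have : (𝓝[Ioo s z] s).NeBot := by rw [nhdsWithin_Ioo_eq_nhdsGT hsz]; infer_instance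
        exact tendsto_nhds_unique t3 t4
      have := hu₁ s (left_mem_Icc.2 hsz.le)
      rw [e1, zero_mul] at this
      exact this.hasDerivWithinAt
    · have := hu₁ t ⟨ht.1, ht.2.le⟩
      rw [hv0 t ⟨h, ht.2⟩, zero_mul] at this
      exact this.hasDerivWithinAt
  have hcp := pos₁ c hc
  have e1 := hconst c (Ioo_subset_Icc_self hc)
  have e2 := hconst z (right_mem_Icc.2 hsz.le)
  rcases h0 with h | h
  · rw [e1, h] at hcp; exact lt_irrefl _ hcp
  · rw [e1, ← e2, h] at hcp; exact lt_irrefl _ hcp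

/-- A solution cannot stay positive on an interval where `l w` is large. -/
lemma not_pos_of_large {s z l δ M : ℝ} {p q w u v : ℝ → ℝ} (hsz : s < z)
    (hp : ∀ t, 0 < p t) (hpM : ∀ t, p t ≤ M) (hqM : ∀ t, q t ≤ M)
    (hu : ∀ t ∈ Icc s z, HasDerivAt u (v t * (p t)⁻¹) t)
    (hv : ∀ t ∈ Icc s z, HasDerivAt v ((q t - l * w t) * u t) t)
    (pos : ∀ t ∈ Icc s z, 0 < u t) (hw : ∀ t ∈ Icc s z, δ ≤ w t) (hl : 0 ≤ l)
    (hlarge : M + M * (Real.pi / (z - s)) ^ 2 < l * δ) : False := by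
  set ω := Real.pi / (z - s) with hω
  have hd : 0 < z - s := sub_pos.2 hsz
  set φ : ℝ → ℝ := fun t => Real.sin (ω * (t - s)) with hφ
  set ψ : ℝ → ℝ := fun t => Real.cos (ω * (t - s)) with hψ
  have dφ : ∀ t, HasDerivAt φ (ψ t * ω) t := fun t => by
    have := ((hasDerivAt_id t).sub_const s).const_mul ω
    simpa using this.sin
  have dψ : ∀ t, HasDerivAt ψ (-(φ t * ω)) t := fun t => by
    have := ((hasDerivAt_id t).sub_const s).const_mul ω
    simpa using this.cos
  -- The Riccati variable -v/u is tested against the squared half sine wave on [s, z]. Completing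
  -- the square shows that `G` increases strictly, although the sine makes it vanish at both ends.
  set G : ℝ → ℝ := fun t => -(v t / u t) * φ t ^ 2 + M * ω * (φ t * ψ t)
  have hG : ∀ t ∈ Icc s z, HasDerivAt G
      ((l * w t - q t - M * ω ^ 2) * φ t ^ 2 + (M - p t) * (ω * ψ t) ^ 2 +
        (p t)⁻¹ * (-(v t / u t) * φ t + p t * (ω * ψ t)) ^ 2) t := by
    intro t ht
    have hne := (pos t ht).ne'
    have hpne := (hp t).ne'
    refine (((((hv t ht).div (hu t ht) hne).neg.mul ((dφ t).pow 2))).add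
      (((dφ t).mul (dψ t)).const_mul (M * ω))).congr_deriv ?_
    simp only [Pi.div_apply, Pi.neg_apply, Pi.pow_apply]
    push_cast
    field_simp
    ring
  have hmono : StrictMonoOn G (Icc s z) := by
    refine strictMonoOn_of_deriv_pos (convex_Icc s z)
      (fun t ht => (hG t ht).continuousAt.continuousWithinAt) (fun t ht => ?_)
    rw [interior_Icc] at ht
    have htI := Ioo_subset_Icc_self ht
    rw [(hG t htI).deriv]
    have hsin : 0 < φ t := by
      apply Real.sin_pos_of_pos_of_lt_pi
      · have : 0 < t - s := sub_pos.2 ht.1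
        positivity
      · rw [hω, div_mul_eq_mul_div, div_lt_iff₀ hd]
        exact mul_lt_mul_of_pos_left (by linarith [ht.2]) Real.pi_pos
    have a1 : 0 < l * w t - q t - M * ω ^ 2 := by
      have := mul_le_mul_of_nonneg_left (hw t htI) hl
      linarith [hqM t]
    have a2 : 0 ≤ M - p t := sub_nonneg.2 (hpM t)
    have a3 := inv_pos.2 (hp t)
    positivity
  have h := hmono (left_mem_Icc.2 hsz.le) (right_mem_Icc.2 hsz.le) hsz
  have hz : φ z = 0 := by
    rw [hφ]
    simp only [hω]
    rw [div_mul_cancel₀ _ hd.ne', Real.sin_pi]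
  have hs : φ s = 0 := by simp [hφ]
  simp [G, hz, hs] at h

/-- The levels at which the cosine vanishes. -/
noncomputable def level (n : ℕ) : ℝ := n * Real.pi - Real.pi / 2

lemma cos_level (n : ℕ) : Real.cos (level n) = 0 := by
  rw [level, Real.cos_sub_pi_div_two, Real.sin_nat_mul_pi]

lemma level_succ (n : ℕ) : level (n + 1) = level n + Real.pi := by
  unfold level; push_cast; ring

lemma strictMono_level : StrictMono level :=
  strictMono_nat_of_lt_succ fun n => by rw [level_succ]; linarith [Real.pi_pos]

lemma sin_level (n : ℕ) : Real.sin (level n) = -(-1) ^ n := by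
  rw [level, Real.sin_sub_pi_div_two, Real.cos_nat_mul_pi]

lemma cos_pos_of_mem_band {n : ℕ} {θ : ℝ} (h1 : level n < θ) (h2 : θ < level (n + 1)) :
    0 < (-1) ^ n * Real.cos θ := by
  have : 0 < Real.cos (θ - n * Real.pi) := by
    rw [level_succ] at h2
    unfold level at h1 h2
    exact Real.cos_pos_of_mem_Ioo ⟨by linarith, by linarith⟩
  rwa [Real.cos_sub_nat_mul_pi] at this

namespace Coeffs

variable (C : Coeffs)

lemma level_zero_lt_angle (x : ℝ × ℝ) {t : ℝ} (ht : t ∈ Icc C.T₁ C.T₂) :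
    level 0 < C.angle x t := by
  have h0 : level 0 < 0 := by simp [level, Real.pi_pos]
  rcases eq_or_lt_of_le ht.1 with rfl | h
  · rwa [angle_left]
  · exact C.angle_gt_of_le x (cos_level 0) C.left_mem ht h (by rw [angle_left]; exact h0.le)

lemma level_le_angle_mono (x : ℝ × ℝ) (n : ℕ) {s t : ℝ} (hs : s ∈ Icc C.T₁ C.T₂)
    (ht : t ∈ Icc C.T₁ C.T₂) (hst : s ≤ t) (h : level n ≤ C.angle x s) :
    level n ≤ C.angle x t := by
  rcases eq_or_lt_of_le hst with rfl | h'
  · exact h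
  · exact (C.angle_gt_of_le x (cos_level n) hs ht h' h).le

/-- In the band between `level j` and `level (j + 1)` the cosine has sign (-1)^j. Each failure of
that sign shows that the angle has left band j upwards, and it cannot come back, so n + 1 ordered
failures push it past n + 1 bands. -/
lemma level_succ_le_of_alternating (x : ℝ × ℝ) (n : ℕ) (t : ℕ → ℝ)
    (ht : ∀ j ≤ n, t j ∈ Icc C.T₁ C.T₂) (hlt : ∀ j < n, t j < t (j + 1))
    (hsgn : ∀ j ≤ n, (-1) ^ j * Real.cos (C.angle x (t j)) ≤ 0) :
    level (n + 1) ≤ C.angle x (t n) := by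
  induction n with
  | zero =>
    by_contra! h
    exact absurd (cos_pos_of_mem_band (C.level_zero_lt_angle x (ht 0 le_rfl)) h)
      (not_lt.2 (hsgn 0 le_rfl))
  | succ n ih =>
    have h1 := ih (fun j hj => ht j (by omega)) (fun j hj => hlt j (by omega))
      (fun j hj => hsgn j (by omega))
    have h2 := C.angle_gt_of_le x (cos_level (n + 1)) (ht n (by omega)) (ht (n + 1) le_rfl)
      (hlt n (by omega)) h1
    by_contra! h
    exact absurd (cos_pos_of_mem_band h2 h) (not_lt.2 (hsgn (n + 1) le_rfl))

/-- `z` lists `T₁`, the `k` zeros of the solution, and `T₂`. -/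
structure IsNodal (x : ℝ × ℝ) (k : ℕ) (z : ℕ → ℝ) : Prop where
  rot_eq : C.rot x = k * Real.pi
  left : z 0 = C.T₁
  right : z (k + 1) = C.T₂
  lt : ∀ n ≤ k, z n < z (n + 1)
  angle_eq : ∀ n, 1 ≤ n → n ≤ k → C.angle x (z n) = level n
  band : ∀ n ≤ k, ∀ t ∈ Ioo (z n) (z (n + 1)),
    level n < C.angle x t ∧ C.angle x t < level (n + 1)

/-- The value kπ lies between `level k` and `level (k + 1)`. Levels 1 to k are attained by the
intermediate value theorem; one-way crossing orders these points and confines the angle to its band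
between them. -/
lemma exists_isNodal {x : ℝ × ℝ} {k : ℕ} (h : C.rot x = k * Real.pi) :
    ∃ z, C.IsNodal x k z := by
  have hpi := Real.pi_pos
  have h0 : level 0 < 0 := by simp [level, Real.pi_pos]
  have hk : C.rot x < level (k + 1) := by rw [h, level_succ, level]; linarith
  have hex : ∀ n, ∃ t, 1 ≤ n → n ≤ k → t ∈ Ioo C.T₁ C.T₂ ∧ C.angle x t = level n := by
    intro n
    by_cases hn : 1 ≤ n ∧ n ≤ k
    · have h1 : C.angle x C.T₁ < level n := by
        rw [angle_left, level]
        have : (1 : ℝ) ≤ n := by exact_mod_cast hn.1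
        nlinarith
      have h2 : level n < C.angle x C.T₂ := by
        change _ < C.rot x
        rw [h, level]
        have : (n : ℝ) ≤ k := by exact_mod_cast hn.2
        nlinarith
      obtain ⟨t, ht, he⟩ := intermediate_value_Ioo C.lt.le (C.continuousOn_angle x) ⟨h1, h2⟩
      exact ⟨t, fun _ _ => ⟨ht, he⟩⟩
    · exact ⟨0, fun h1 h2 => absurd ⟨h1, h2⟩ hn⟩
  choose y hy using hex
  set z : ℕ → ℝ := fun n => if n = 0 then C.T₁ else if n ≤ k then y n else C.T₂
  have z0 : z 0 = C.T₁ := rfl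
  have zk : z (k + 1) = C.T₂ := by simp [z]
  have zn : ∀ n, 1 ≤ n → n ≤ k → z n = y n := fun n h1 h2 => by
    simp [z, h2, Nat.one_le_iff_ne_zero.1 h1]
  have zmem : ∀ n ≤ k, z n ∈ Ico C.T₁ C.T₂ := by
    intro n hn
    rcases Nat.eq_zero_or_pos n with rfl | h1
    · exact ⟨le_rfl, C.lt⟩
    · rw [zn n h1 hn]; exact Ioo_subset_Ico_self (hy n h1 hn).1
  have zang : ∀ n, 1 ≤ n → n ≤ k → C.angle x (z n) = level n := fun n h1 h2 => by
    rw [zn n h1 h2]; exact (hy n h1 h2).2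
  have zmem' : ∀ n ≤ k + 1, z n ∈ Icc C.T₁ C.T₂ := by
    intro n hn
    rcases Nat.lt_or_ge k n with h1 | h1
    · obtain rfl : n = k + 1 := by omega
      rw [zk]; exact C.right_mem
    · exact Ico_subset_Icc_self (zmem n h1)
  have zlow : ∀ n ≤ k, level n ≤ C.angle x (z n) := by
    intro n hn
    rcases Nat.eq_zero_or_pos n with rfl | h1
    · exact (C.level_zero_lt_angle x (zmem' 0 (by omega))).le
    · exact (zang n h1 hn).ge
  have zup : ∀ n ≤ k, C.angle x (z n) < level (n + 1) := by
    intro n hn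
    rcases Nat.eq_zero_or_pos n with rfl | h1
    · rw [z0, angle_left]; simp [level]; linarith
    · rw [zang n h1 hn]; exact strictMono_level (Nat.lt_succ_self n)
  have zup' : ∀ n ≤ k, C.angle x (z (n + 1)) ≤ level (n + 1) := by
    intro n hn
    rcases Nat.lt_or_ge n k with h1 | h1
    · exact (zang (n + 1) (by omega) h1).le
    · obtain rfl : n = k := le_antisymm hn h1
      rw [zk]; exact hk.le
  refine ⟨z, h, z0, zk, fun n hn => ?_, zang, fun n hn t ht => ⟨?_, ?_⟩⟩
  · rcases Nat.lt_or_ge n k with h1 | h1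
    · by_contra! hle
      have := C.level_le_angle_mono x (n + 1) (zmem' (n + 1) (by omega)) (zmem' n (by omega)) hle
        (zang (n + 1) (by omega) h1).ge
      linarith [zup n hn]
    · obtain rfl : n = k := le_antisymm hn h1
      rw [zk]; exact (zmem n hn).2
  · exact C.angle_gt_of_le x (cos_level n) (zmem' n (by omega))
      ⟨(zmem' n (by omega)).1.trans ht.1.le, ht.2.le.trans (zmem' (n + 1) (by omega)).2⟩ ht.1
      (zlow n hn)
  · by_contra! hle
    have := C.angle_gt_of_le x (cos_level (n + 1))
      ⟨(zmem' n (by omega)).1.trans ht.1.le, ht.2.le.trans (zmem' (n + 1) (by omega)).2⟩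
      (zmem' (n + 1) (by omega)) ht.2 hle
    linarith [zup' n hn]

lemma sol_left (x : ℝ × ℝ) : C.sol x C.T₁ = 1 := by simp [sol, logRad_left, angle_left]

lemma flux_left (x : ℝ × ℝ) : C.flux x C.T₁ = 0 := by simp [flux, angle_left]

lemma flux_right {x : ℝ × ℝ} {k : ℕ} (h : C.rot x = k * Real.pi) : C.flux x C.T₂ = 0 := by
  have : C.angle x C.T₂ = k * Real.pi := h
  simp [flux, this, Real.sin_nat_mul_pi]

lemma sol_right {x : ℝ × ℝ} {k : ℕ} (h : C.rot x = k * Real.pi) :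
    0 < (-1) ^ k * C.sol x C.T₂ := by
  have : C.angle x C.T₂ = k * Real.pi := h
  rw [sol, this, Real.cos_nat_mul_pi]
  have h1 : (-1 : ℝ) ^ k * (-1) ^ k = 1 := by rw [← mul_pow]; simp
  nlinarith [Real.exp_pos (C.logRad x C.T₂)]

lemma sol_ne_zero_or_flux_ne_zero (x : ℝ × ℝ) (t : ℝ) : C.sol x t ≠ 0 ∨ C.flux x t ≠ 0 := by
  by_contra! h
  have he := (Real.exp_pos (C.logRad x t)).ne'
  have h1 : Real.cos (C.angle x t) = 0 := by simpa [sol, he] using h.1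
  have h2 : Real.sin (C.angle x t) = 0 := by simpa [flux, he] using h.2
  have := Real.sin_sq_add_cos_sq (C.angle x t)
  rw [h1, h2] at this
  norm_num at this

lemma continuousOn_sol (x : ℝ × ℝ) : ContinuousOn (C.sol x) (Icc C.T₁ C.T₂) :=
  fun _ ht => (C.hasDerivAt_sol x ht).continuousAt.continuousWithinAt

lemma continuousOn_flux (x : ℝ × ℝ) : ContinuousOn (C.flux x) (Icc C.T₁ C.T₂) :=
  fun _ ht => (C.hasDerivAt_flux x ht).continuousAt.continuousWithinAt

lemma hasDerivAt_flux_of_nonneg (x : ℝ × ℝ) {t : ℝ} (ht : t ∈ Icc C.T₁ C.T₂)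
    (h : 0 ≤ C.sol x t) : HasDerivAt (C.flux x) ((C.q t - x.1 * C.m t) * C.sol x t) t := by
  refine (C.hasDerivAt_flux x ht).congr_deriv ?_
  rw [max_eq_left h, max_eq_right (by linarith)]; ring

lemma hasDerivAt_flux_of_nonpos (x : ℝ × ℝ) {t : ℝ} (ht : t ∈ Icc C.T₁ C.T₂)
    (h : C.sol x t ≤ 0) : HasDerivAt (C.flux x) ((C.q t - x.2 * C.m t) * C.sol x t) t := by
  refine (C.hasDerivAt_flux x ht).congr_deriv ?_
  rw [max_eq_right h, max_eq_left (by linarith)]; ring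

lemma pos_sol_iff (x : ℝ × ℝ) (c t : ℝ) :
    0 < c * C.sol x t ↔ 0 < c * Real.cos (C.angle x t) := by
  have h : c * C.sol x t = Real.exp (C.logRad x t) * (c * Real.cos (C.angle x t)) := by
    unfold sol; ring
  rw [h, mul_pos_iff_of_pos_left (Real.exp_pos _)]

namespace IsNodal

variable {C} {x : ℝ × ℝ} {k : ℕ} {z : ℕ → ℝ} (hz : C.IsNodal x k z)
include hz

lemma mem {n : ℕ} (hn : n ≤ k + 1) : z n ∈ Icc C.T₁ C.T₂ := by
  have hm : ∀ i j, i ≤ j → j ≤ k + 1 → z i ≤ z j := by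
    intro i j hij
    induction j, hij using Nat.le_induction with
    | base => exact fun _ => le_rfl
    | succ j hj ih => exact fun h => (ih (by omega)).trans (hz.lt j (by omega)).le
  exact ⟨hz.left ▸ hm 0 n (by omega) hn, hz.right ▸ hm n (k + 1) hn le_rfl⟩

lemma subset {n : ℕ} (hn : n ≤ k) : Icc (z n) (z (n + 1)) ⊆ Icc C.T₁ C.T₂ :=
  Icc_subset_Icc (hz.mem (by omega)).1 (hz.mem (by omega)).2

lemma sol_pos {n : ℕ} (hn : n ≤ k) {t : ℝ} (ht : t ∈ Ioo (z n) (z (n + 1))) :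
    0 < (-1) ^ n * C.sol x t := by
  rw [pos_sol_iff]
  exact cos_pos_of_mem_band (hz.band n hn t ht).1 (hz.band n hn t ht).2

lemma sol_eq_zero {n : ℕ} (h1 : 1 ≤ n) (hn : n ≤ k) : C.sol x (z n) = 0 := by
  rw [sol, hz.angle_eq n h1 hn, cos_level, mul_zero]

lemma sol_end (hk : 1 ≤ k) {n : ℕ} (hn : n ≤ k) : C.sol x (z n) = 0 ∨ C.sol x (z (n + 1)) = 0 := by
  rcases Nat.eq_zero_or_pos n with rfl | h
  · exact Or.inr (hz.sol_eq_zero le_rfl hk)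
  · exact Or.inl (hz.sol_eq_zero h hn)

lemma flux_zero {n : ℕ} (h1 : 1 ≤ n) (hn : n ≤ k) : 0 < (-1) ^ n * C.flux x (z n) := by
  rw [flux, hz.angle_eq n h1 hn, sin_level]
  have h1 : (-1 : ℝ) ^ n * (-1) ^ n = 1 := by rw [← mul_pow]; simp
  nlinarith [Real.exp_pos (C.logRad x (z n))]

/-- In each nodal interval the weight has somewhere the sign that lets the solution bend. -/
lemma exists_weight_pos (hk : 1 ≤ k) {n : ℕ} (hn : n ≤ k) :
    ∃ t ∈ Ioo (z n) (z (n + 1)), 0 < (if Even n then x.1 else x.2) * C.m t := by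
  have hc : ContinuousOn (C.flux x) (Icc (z n) (z (n + 1))) :=
    (C.continuousOn_flux x).mono (hz.subset hn)
  obtain ⟨t, ht, he⟩ := exists_hasDerivAt_eq_slope (C.flux x) _ (hz.lt n hn) hc
    fun t ht => C.hasDerivAt_flux x (hz.subset hn (Ioo_subset_Icc_self ht))
  refine ⟨t, ht, ?_⟩
  have hd := sub_pos.2 (hz.lt n hn)
  -- The signed flux is positive at a left zero, negative at a right zero, and zero at T₁ and T₂. As
  -- k ≥ 1, at least one end is a zero, so the drop is strict; since q ≥ 0, only the weight term can
  -- produce it.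
  have hdiff : (-1) ^ n * (C.flux x (z (n + 1)) - C.flux x (z n)) < 0 := by
    have a1 : n = 0 ∨ 1 ≤ n := by omega
    have a2 : n = k ∨ n + 1 ≤ k := by omega
    have b1 : 1 ≤ n → 0 < (-1) ^ n * C.flux x (z n) := fun h => hz.flux_zero h hn
    have b2 : n + 1 ≤ k → (-1) ^ n * C.flux x (z (n + 1)) < 0 := fun h => by
      have := hz.flux_zero (by omega) h
      rw [pow_succ] at this; linarith
    have b3 : n = 0 → C.flux x (z n) = 0 := by rintro rfl; rw [hz.left, flux_left]
    have b4 : n = k → C.flux x (z (n + 1)) = 0 := by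
      rintro rfl; rw [hz.right, C.flux_right hz.rot_eq]
    rcases a1 with h | h <;> rcases a2 with h' | h'
    · omega
    · have := b2 h'; rw [b3 h]; linarith
    · have := b1 h; rw [b4 h']; linarith
    · have := b1 h; have := b2 h'; linarith
  have hneg : (-1) ^ n * (C.q t * C.sol x t - C.m t *
      (x.1 * max (C.sol x t) 0 - x.2 * max (-C.sol x t) 0)) < 0 := by
    rw [he, ← mul_div_assoc]; exact div_neg_of_neg_of_pos hdiff hd
  have hs := hz.sol_pos hn ht
  have hq := C.q_nonneg t
  split_ifs with hev
  · rw [hev.neg_one_pow, one_mul] at hs hneg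
    rw [max_eq_left hs.le, max_eq_right (by linarith)] at hneg
    by_contra! hle
    nlinarith
  · rw [Nat.not_even_iff_odd] at hev
    rw [hev.neg_one_pow, neg_one_mul] at hs hneg
    rw [max_eq_right (by linarith), max_eq_left (by linarith)] at hneg
    by_contra! hle
    nlinarith

end IsNodal

/-- Strictly larger parameters of both signs cannot give the same rotation. -/
lemma rot_ne_of_lt {x y : ℝ × ℝ} {k : ℕ} (hk : 1 ≤ k) (hx1 : 0 < x.1) (hx2 : x.2 < 0)
    (h1 : x.1 < y.1) (h2 : y.2 < x.2) (hx : C.rot x = k * Real.pi) :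
    C.rot y ≠ k * Real.pi := by
  intro hy
  obtain ⟨z, hz⟩ := C.exists_isNodal hx
  -- By Picone, the solution for `y` cannot keep the sign (-1)^n throughout the n-th nodal interval
  -- of the solution for `x`. These k + 1 failures push its angle past kπ + π/2.
  have key : ∀ n, ∃ t, n ≤ k → t ∈ Ioo (z n) (z (n + 1)) ∧
      (-1) ^ n * Real.cos (C.angle y t) ≤ 0 := by
    intro n
    by_cases hn : n ≤ k
    swap
    · exact ⟨0, fun h => absurd h hn⟩
    by_contra! hcon
    have hpos : ∀ t ∈ Ioo (z n) (z (n + 1)), 0 < (-1) ^ n * C.sol y t := fun t ht => by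
      rw [pos_sol_iff]; exact ((hcon t).2 ht)
    have hbc : ∀ e ∈ ({z n, z (n + 1)} : Set ℝ),
        (C.sol x e = 0 ∧ (C.sol y e ≠ 0 ∨ C.flux y e ≠ 0)) ∨
        (C.flux x e = 0 ∧ C.flux y e = 0 ∧ C.sol y e ≠ 0) := by
      have aux : ∀ j ≤ k + 1, (C.sol x (z j) = 0 ∧ (C.sol y (z j) ≠ 0 ∨ C.flux y (z j) ≠ 0)) ∨
        (C.flux x (z j) = 0 ∧ C.flux y (z j) = 0 ∧ C.sol y (z j) ≠ 0) := by
        intro j hj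
        rcases Nat.eq_zero_or_pos j with rfl | h
        · right
          rw [hz.left, flux_left, flux_left, sol_left]
          exact ⟨rfl, rfl, one_ne_zero⟩
        · rcases Nat.lt_or_ge k j with h' | h'
          · obtain rfl : j = k + 1 := by omega
            right
            rw [hz.right, C.flux_right hx, C.flux_right hy]
            refine ⟨rfl, rfl, fun h => ?_⟩
            have := C.sol_right hy
            rw [h, mul_zero] at this
            exact lt_irrefl _ this
          · exact Or.inl ⟨hz.sol_eq_zero h h', C.sol_ne_zero_or_flux_ne_zero y _⟩
      rintro e (rfl | rfl)
      · exact aux n (by omega)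
      · exact aux (n + 1) (by omega)
    have hsub := hz.subset hn
    have hsubo : ∀ t ∈ Ioo (z n) (z (n + 1)), t ∈ Icc C.T₁ C.T₂ :=
      fun t ht => hsub (Ioo_subset_Icc_self ht)
    rcases Nat.even_or_odd n with hev | hod
    · have p1 : ∀ t ∈ Ioo (z n) (z (n + 1)), 0 < C.sol x t := fun t ht => by
        simpa [hev.neg_one_pow] using hz.sol_pos hn ht
      have p2 : ∀ t ∈ Ioo (z n) (z (n + 1)), 0 < C.sol y t := fun t ht => by
        simpa [hev.neg_one_pow] using hpos t ht
      exact not_pos_of_param_lt (hz.lt n hn) hx1 h1 C.p_pos C.q_nonneg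
        (fun t ht => C.hasDerivAt_sol x (hsub ht)) (fun t ht => C.hasDerivAt_sol y (hsub ht))
        ((C.continuousOn_flux x).mono hsub) ((C.continuousOn_flux y).mono hsub)
        (fun t ht => C.hasDerivAt_flux_of_nonneg x (hsubo t ht) (p1 t ht).le)
        (fun t ht => C.hasDerivAt_flux_of_nonneg y (hsubo t ht) (p2 t ht).le)
        p1 p2 hbc (hz.sol_end hk hn)
    · have p1 : ∀ t ∈ Ioo (z n) (z (n + 1)), 0 < -C.sol x t := fun t ht => by
        simpa [hod.neg_one_pow] using hz.sol_pos hn ht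
      have p2 : ∀ t ∈ Ioo (z n) (z (n + 1)), 0 < -C.sol y t := fun t ht => by
        simpa [hod.neg_one_pow] using hpos t ht
      -- On a negative hump, -u is positive and solves the linear equation with weight -m and
      -- positive parameter -b.
      refine not_pos_of_param_lt (w := fun t => -C.m t) (u₁ := fun t => -C.sol x t)
        (v₁ := fun t => -C.flux x t) (u₂ := fun t => -C.sol y t) (v₂ := fun t => -C.flux y t)
        (hz.lt n hn) (neg_pos.2 hx2) (neg_lt_neg h2) C.p_pos C.q_nonneg
        (fun t ht => (C.hasDerivAt_sol x (hsub ht)).neg.congr_deriv (by ring))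
        (fun t ht => (C.hasDerivAt_sol y (hsub ht)).neg.congr_deriv (by ring))
        ((C.continuousOn_flux x).mono hsub).neg ((C.continuousOn_flux y).mono hsub).neg
        (fun t ht => (C.hasDerivAt_flux_of_nonpos x (hsubo t ht)
          (by linarith [p1 t ht])).neg.congr_deriv (by ring))
        (fun t ht => (C.hasDerivAt_flux_of_nonpos y (hsubo t ht)
          (by linarith [p2 t ht])).neg.congr_deriv (by ring))
        p1 p2 ?_ ?_
      · simpa only [neg_eq_zero, ne_eq] using hbc
      · simpa only [neg_eq_zero] using hz.sol_end hk hn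
  choose t ht using key
  have htI : ∀ j ≤ k, t j ∈ Icc C.T₁ C.T₂ := fun j hj =>
    hz.subset hj (Ioo_subset_Icc_self (ht j hj).1)
  have h3 := C.level_succ_le_of_alternating y k t htI
    (fun j hj => ((ht j (by omega)).1.2).trans (ht (j + 1) (by omega)).1.1)
    (fun j hj => (ht j hj).2)
  have h4 := C.level_le_angle_mono y (k + 1) (htI k le_rfl) C.right_mem (htI k le_rfl).2 h3
  change _ ≤ C.rot y at h4
  rw [hy, level_succ, level] at h4
  linarith [Real.pi_pos]

end Coeffs
end Fucik

/-! ### Existence of points with given rotation; nonzero partial derivatives -/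

namespace Fucik

/-- There are `k + 1` points in `S` at which `m` has alternating signs, beginning with `+`. -/
def Alternates (m : ℝ → ℝ) (S : Set ℝ) (k : ℕ) : Prop :=
  ∃ t : ℕ → ℝ, (∀ j < k, t j < t (j + 1)) ∧ ∀ j ≤ k, t j ∈ S ∧ 0 < (-1) ^ j * m (t j)

lemma exists_Icc_le {m : ℝ → ℝ} {a b t r : ℝ} (hab : a < b) (hm : ContinuousAt m t)
    (ht : t ∈ Icc a b) (hpos : 0 < m t) (hr : 0 < r) :
    ∃ s z, s < z ∧ Icc s z ⊆ Icc a b ∩ Metric.ball t r ∧ ∀ y ∈ Icc s z, m t / 2 ≤ m y := by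
  obtain ⟨e, he, hball⟩ := Metric.eventually_nhds_iff.1
    (hm.eventually (lt_mem_nhds (half_lt_self hpos)))
  set d := min e r / 2
  have hd : 0 < d := by have : 0 < min e r := lt_min he hr; positivity
  have hde : d < e := by have := min_le_left e r; have : 0 < min e r := lt_min he hr; grind
  have hdr : d < r := by have := min_le_right e r; have : 0 < min e r := lt_min he hr; grind
  refine ⟨max a (t - d), min b (t + d), ?_, fun y hy => ⟨⟨?_, ?_⟩, ?_⟩, fun y hy => ?_⟩
  · obtain ⟨h1, h2⟩ := ht
    simp only [lt_min_iff, max_lt_iff]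
    refine ⟨⟨hab, by linarith⟩, by linarith, by linarith⟩
  · exact (le_max_left _ _).trans hy.1
  · exact hy.2.trans (min_le_left _ _)
  · have h1 := (le_max_right a _).trans hy.1
    have h2 := hy.2.trans (min_le_right b _)
    rw [Metric.mem_ball, Real.dist_eq, abs_lt]; constructor <;> linarith
  · have h1 := (le_max_right a _).trans hy.1
    have h2 := hy.2.trans (min_le_right b _)
    exact (hball (by rw [Real.dist_eq, abs_lt]; constructor <;> linarith)).le

namespace Coeffs

variable (C : Coeffs)

/-- One point is taken in each nodal interval. As k ≥ 1 there are humps of both signs, so neither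
parameter can vanish. -/
lemma alternates_of_rot_eq {x : ℝ × ℝ} {k : ℕ} (hk : 1 ≤ k) (h1 : 0 ≤ x.1) (h2 : x.2 ≤ 0)
    (hx : C.rot x = k * Real.pi) :
    0 < x.1 ∧ x.2 < 0 ∧ Alternates C.m (Icc C.T₁ C.T₂) k := by
  obtain ⟨z, hz⟩ := C.exists_isNodal hx
  have key : ∀ n, ∃ t, n ≤ k → t ∈ Ioo (z n) (z (n + 1)) ∧
      0 < (if Even n then x.1 else x.2) * C.m t := by
    intro n
    by_cases hn : n ≤ k
    · obtain ⟨t, ht⟩ := hz.exists_weight_pos hk hn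
      exact ⟨t, fun _ => ht⟩
    · exact ⟨0, fun h => absurd h hn⟩
  choose t ht using key
  have a0 := (ht 0 (by omega)).2
  have a1 := (ht 1 hk).2
  simp only [Even.zero, if_true, Nat.not_even_one, if_false] at a0 a1
  have p1 : 0 < x.1 := lt_of_le_of_ne h1 fun h => by rw [← h] at a0; simp at a0
  have p2 : x.2 < 0 := lt_of_le_of_ne h2 fun h => by rw [h] at a1; simp at a1
  refine ⟨p1, p2, t, fun j hj => ((ht j (by omega)).1.2).trans (ht (j + 1) (by omega)).1.1,
    fun j hj => ⟨hz.subset hj (Ioo_subset_Icc_self (ht j hj).1), ?_⟩⟩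
  have h := (ht j hj).2
  split_ifs at h with hev
  · rw [hev.neg_one_pow, one_mul]; exact (mul_pos_iff_of_pos_left p1).1 h
  · rw [(Nat.not_even_iff_odd.1 hev).neg_one_pow, neg_one_mul]
    by_contra! hle
    nlinarith

/-- For zero parameters, u · p u' starts at 0 and has derivative p u'² + q u² ≥ 0. Reaching the
angle π/4 would make this product negative. -/
lemma rot_zero_lt : C.rot 0 < Real.pi := by
  have hd : ∀ t ∈ Icc C.T₁ C.T₂, HasDerivAt (fun t => C.sol 0 t * C.flux 0 t)
      (C.flux 0 t ^ 2 * (C.p t)⁻¹ + C.q t * C.sol 0 t ^ 2) t := fun t ht => by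
    refine ((C.hasDerivAt_sol 0 ht).mul (C.hasDerivAt_flux 0 ht)).congr_deriv ?_
    simp only [Prod.fst_zero, Prod.snd_zero]
    ring
  have hmono : MonotoneOn (fun t => C.sol 0 t * C.flux 0 t) (Icc C.T₁ C.T₂) := by
    refine monotoneOn_of_deriv_nonneg (convex_Icc _ _)
      (fun t ht => (hd t ht).continuousAt.continuousWithinAt) (fun t ht => ?_) (fun t ht => ?_)
    · exact (hd t (interior_subset ht)).differentiableAt.differentiableWithinAt
    · rw [(hd t (interior_subset ht)).deriv]
      have := C.inv_pos t
      have := C.q_nonneg t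
      positivity
  by_contra! hle
  have hpi := Real.pi_pos
  obtain ⟨t, ht, he⟩ := intermediate_value_Icc C.lt.le (C.continuousOn_angle 0)
    (show Real.pi / 4 ∈ Icc (C.angle 0 C.T₁) (C.angle 0 C.T₂) by
      rw [angle_left]; change C.rot 0 ≥ _ at hle
      exact ⟨by positivity, by change _ ≤ C.rot 0; linarith⟩)
  have h1 := hmono C.left_mem ht ht.1
  simp only [flux_left, mul_zero] at h1
  have h2 : 0 < Real.cos (Real.pi / 4) * Real.sin (Real.pi / 4) := by
    rw [Real.cos_pi_div_four, Real.sin_pi_div_four]; positivity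
  have h3 := Real.exp_pos (C.logRad 0 t)
  simp only [sol, flux, he] at h1
  nlinarith [mul_pos h3 h3]

/-- With parameters (l, -l), (-1)^n u sees the weight l (-1)^n m wherever it is positive, whatever
the parity of n; a large weight on a small interval about `t` forbids it to stay positive. -/
lemma eventually_exists_sign (n : ℕ) {t r : ℝ} (ht : t ∈ Icc C.T₁ C.T₂)
    (hpos : 0 < (-1) ^ n * C.m t) (hr : 0 < r) :
    ∀ᶠ l : ℝ in atTop, ∃ y ∈ Icc C.T₁ C.T₂ ∩ Metric.ball t r,
      (-1) ^ n * Real.cos (C.angle (l, -l) y) ≤ 0 := by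
  have hc : Continuous fun y => (-1) ^ n * C.m y := C.hm.const_mul _
  obtain ⟨s, z, hsz, hsub, hw⟩ := exists_Icc_le C.lt hc.continuousAt ht hpos hr
  have h1 : Tendsto (fun l : ℝ => l * ((-1) ^ n * C.m t / 2)) atTop atTop :=
    tendsto_id.atTop_mul_const (by positivity)
  filter_upwards [h1.eventually_gt_atTop (C.M + C.M * (Real.pi / (z - s)) ^ 2),
    eventually_ge_atTop 0] with l hl hl0
  by_contra! hcon
  have hI : ∀ y ∈ Icc s z, y ∈ Icc C.T₁ C.T₂ := fun y hy => (hsub hy).1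
  have hp : ∀ y ∈ Icc s z, 0 < (-1) ^ n * C.sol (l, -l) y := fun y hy => by
    rw [pos_sol_iff]; exact hcon y (hsub hy)
  refine not_pos_of_large (u := fun y => (-1) ^ n * C.sol (l, -l) y)
    (v := fun y => (-1) ^ n * C.flux (l, -l) y) hsz C.p_pos C.p_le C.q_le
    (fun y hy => ((C.hasDerivAt_sol _ (hI y hy)).const_mul _).congr_deriv (by ring))
    (fun y hy => ?_) hp hw hl0 hl
  have h := hp y hy
  rcases Nat.even_or_odd n with hev | hod
  · rw [hev.neg_one_pow, one_mul] at h
    refine ((C.hasDerivAt_flux_of_nonneg _ (hI y hy) h.le).const_mul _).congr_deriv ?_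
    rw [hev.neg_one_pow]; ring
  · rw [hod.neg_one_pow] at h
    refine ((C.hasDerivAt_flux_of_nonpos _ (hI y hy) (by linarith)).const_mul _).congr_deriv ?_
    rw [hod.neg_one_pow]; ring

lemma exists_rot_eq {k : ℕ} (hk : 1 ≤ k) (h : Alternates C.m (Icc C.T₁ C.T₂) k) :
    ∃ l : ℝ, 0 ≤ l ∧ C.rot (l, -l) = k * Real.pi := by
  obtain ⟨t, hlt, ht⟩ := h
  -- The radius is small enough that points picked from the balls about the `t j` stay in order.
  have hr : ∀ᶠ r in 𝓝[>] (0 : ℝ), ∀ j ∈ Finset.range k, t j + r < t (j + 1) - r := by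
    rw [Filter.eventually_all_finset]
    intro j hj
    have h1 := hlt j (Finset.mem_range.1 hj)
    have hc1 : Continuous fun r : ℝ => t j + r := by fun_prop
    have hc2 : Continuous fun r : ℝ => t (j + 1) - r := by fun_prop
    exact (hc1.continuousAt.eventually_lt hc2.continuousAt (by simpa using h1)).filter_mono
      nhdsWithin_le_nhds
  obtain ⟨r, hr, hr0⟩ := (hr.and self_mem_nhdsWithin).exists
  have hl : ∀ᶠ l : ℝ in atTop, ∀ j ∈ Finset.range (k + 1),
      ∃ y ∈ Icc C.T₁ C.T₂ ∩ Metric.ball (t j) r,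
        (-1) ^ j * Real.cos (C.angle (l, -l) y) ≤ 0 := by
    rw [Filter.eventually_all_finset]
    intro j hj
    have hj' := ht j (Nat.lt_succ_iff.1 (Finset.mem_range.1 hj))
    exact C.eventually_exists_sign j hj'.1 hj'.2 hr0
  obtain ⟨l, hl, hl0⟩ := (hl.and (eventually_ge_atTop 0)).exists
  have hl' : ∀ j, ∃ y, j ≤ k → y ∈ Icc C.T₁ C.T₂ ∩ Metric.ball (t j) r ∧
      (-1) ^ j * Real.cos (C.angle (l, -l) y) ≤ 0 := by
    intro j
    by_cases hj : j ≤ k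
    · obtain ⟨y, hy⟩ := hl j (Finset.mem_range.2 (by omega))
      exact ⟨y, fun _ => hy⟩
    · exact ⟨0, fun h => absurd h hj⟩
  choose y hy using hl'
  have h3 := C.level_succ_le_of_alternating (l, -l) k y (fun j hj => (hy j hj).1.1)
    (fun j hj => ?_) (fun j hj => (hy j hj).2)
  · have h4 := C.level_le_angle_mono _ (k + 1) (hy k le_rfl).1.1 C.right_mem
      (hy k le_rfl).1.1.2 h3
    change _ ≤ C.rot _ at h4
    rw [level_succ, level] at h4
    have hpi := Real.pi_pos
    have hk' : (1 : ℝ) ≤ k := by exact_mod_cast hk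
    have h0 := C.rot_zero_lt
    -- Along the diagonal, `rot` starts below π ≤ kπ and has passed kπ + π/2 at `l`.
    have hc : Continuous fun l : ℝ => C.rot (l, -l) := C.continuous_rot.comp (by fun_prop)
    obtain ⟨l', hl', he⟩ := intermediate_value_Icc hl0 hc.continuousOn
      (show k * Real.pi ∈ Icc (C.rot (0, -0)) (C.rot (l, -l)) from
        ⟨by rw [neg_zero]; change C.rot 0 ≤ _; nlinarith, by linarith⟩)
    exact ⟨l', hl'.1, he⟩
  · have a1 := (hy j hj.le).1.2
    have a2 := (hy (j + 1) hj).1.2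
    rw [Metric.mem_ball, Real.dist_eq, abs_lt] at a1 a2
    have a3 := hr j (Finset.mem_range.2 hj)
    linarith

lemma exp_mul_posSq (σ : ℝ) (x : ℝ × ℝ) (t : ℝ) :
    Real.exp (2 * C.logRad x t) * posSq (σ * Real.cos (C.angle x t)) =
      posSq (σ * C.sol x t) := by
  have h : σ * C.sol x t = Real.exp (C.logRad x t) * (σ * Real.cos (C.angle x t)) := by
    unfold sol; ring
  rw [h, posSq_mul (Real.exp_pos _).le, two_mul, Real.exp_add]; ring

/-- The derivative of the rotation with respect to each parameter does not vanish. -/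
lemma angleDeriv_ne_zero {x : ℝ × ℝ} {k : ℕ} {σ κ : ℝ} (hk : 1 ≤ k)
    (hσ : (σ = 1 ∧ κ = x.1) ∨ (σ = -1 ∧ κ = x.2)) (hx : C.rot x = k * Real.pi) :
    C.angleDeriv σ x C.T₂ ≠ 0 := by
  obtain ⟨z, hz⟩ := C.exists_isNodal hx
  have hσ2 : σ * σ = 1 := by rcases hσ with ⟨rfl, -⟩ | ⟨rfl, -⟩ <;> norm_num
  -- `G` is continuous; its derivative is p u'² + q u² on humps of sign σ, where the weight terms
  -- cancel, and 0 on the other humps. The boundary term vanishes at T₁ and T₂, so κ · `sens` at T₂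
  -- is the energy of the humps of sign σ.
  set G : ℝ → ℝ := fun t => κ * C.sens σ x t + σ * (max (σ * C.sol x t) 0 * C.flux x t) with hGdef
  have hGc : ContinuousOn G (Icc C.T₁ C.T₂) := by
    have h1 : ContinuousOn (C.sens σ x) (Icc C.T₁ C.T₂) :=
      fun t ht => (C.hasDerivAt_sens σ x ht).continuousAt.continuousWithinAt
    have h2 := C.continuousOn_sol x
    have h3 := C.continuousOn_flux x
    exact (h1.const_smul κ).add
      ((((h2.const_smul σ).sup continuousOn_const).mul h3).const_smul σ)
  have hGneg : ∀ t ∈ Icc C.T₁ C.T₂, σ * C.sol x t < 0 → HasDerivAt G 0 t := by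
    intro t ht hneg
    have h1 := (C.hasDerivAt_sens σ x ht).const_mul κ
    have e0 : Real.exp (2 * C.logRad x t) *
        (C.m t * posSq (σ * Real.cos (C.angle x t))) = C.m t * posSq (σ * C.sol x t) := by
      rw [← C.exp_mul_posSq]; ring
    rw [e0, posSq_of_nonpos hneg.le, mul_zero, mul_zero] at h1
    refine h1.congr_of_eventuallyEq ?_
    filter_upwards [((C.hasDerivAt_sol x ht).continuousAt.const_mul σ).eventually
      (gt_mem_nhds hneg)] with s hs
    simp [G, max_eq_right (le_of_lt hs)]
  have hGpos : ∀ t ∈ Icc C.T₁ C.T₂, 0 < σ * C.sol x t →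
      HasDerivAt G (C.flux x t ^ 2 * (C.p t)⁻¹ + C.q t * C.sol x t ^ 2) t := by
    intro t ht hpos
    have hf : HasDerivAt (C.flux x) ((C.q t - κ * C.m t) * C.sol x t) t := by
      rcases hσ with ⟨rfl, rfl⟩ | ⟨rfl, rfl⟩
      · exact C.hasDerivAt_flux_of_nonneg x ht (by linarith)
      · exact C.hasDerivAt_flux_of_nonpos x ht (by linarith)
    have h1 := ((C.hasDerivAt_sens σ x ht).const_mul κ).add ((C.hasDerivAt_sol x ht).mul hf)
    have e0 : Real.exp (2 * C.logRad x t) *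
        (C.m t * posSq (σ * Real.cos (C.angle x t))) = C.m t * C.sol x t ^ 2 := by
      have := C.exp_mul_posSq σ x t
      rw [posSq_of_nonneg hpos.le] at this
      linear_combination C.m t * this + C.m t * C.sol x t ^ 2 * hσ2
    rw [e0] at h1
    refine (h1.congr_of_eventuallyEq ?_).congr_deriv (by ring)
    filter_upwards [((C.hasDerivAt_sol x ht).continuousAt.const_mul σ).eventually
      (lt_mem_nhds hpos)] with s hs
    simp only [G, max_eq_left (le_of_lt hs), Pi.add_apply, Pi.mul_apply]
    linear_combination (C.sol x s * C.flux x s) * hσ2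
  have hsgn : ∀ n ≤ k, (∀ t ∈ Ioo (z n) (z (n + 1)), 0 < σ * C.sol x t) ∨
      (∀ t ∈ Ioo (z n) (z (n + 1)), σ * C.sol x t < 0) := by
    intro n hn
    rcases hσ with ⟨rfl, -⟩ | ⟨rfl, -⟩ <;> rcases Nat.even_or_odd n with h | h
    · left; intro t ht; have := hz.sol_pos hn ht; rw [h.neg_one_pow] at this; linarith
    · right; intro t ht; have := hz.sol_pos hn ht; rw [h.neg_one_pow] at this; linarith
    · right; intro t ht; have := hz.sol_pos hn ht; rw [h.neg_one_pow] at this; linarith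
    · left; intro t ht; have := hz.sol_pos hn ht; rw [h.neg_one_pow] at this; linarith
  have hmono : ∀ n ≤ k, MonotoneOn G (Icc (z n) (z (n + 1))) := by
    intro n hn
    have hI : ∀ t ∈ interior (Icc (z n) (z (n + 1))), t ∈ Ioo (z n) (z (n + 1)) ∧
        t ∈ Icc C.T₁ C.T₂ := fun t ht => by
      have := interior_subset ht
      rw [interior_Icc] at ht
      exact ⟨ht, hz.subset hn this⟩
    have hd : ∀ t ∈ interior (Icc (z n) (z (n + 1))), ∃ d, 0 ≤ d ∧ HasDerivAt G d t := by
      intro t ht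
      obtain ⟨h1, h2⟩ := hI t ht
      rcases hsgn n hn with h | h
      · refine ⟨_, ?_, hGpos t h2 (h t h1)⟩
        have := C.inv_pos t
        have := C.q_nonneg t
        positivity
      · exact ⟨0, le_rfl, hGneg t h2 (h t h1)⟩
    refine monotoneOn_of_deriv_nonneg (convex_Icc _ _) (hGc.mono (hz.subset hn))
      (fun t ht => ?_) (fun t ht => ?_)
    · obtain ⟨d, -, h⟩ := hd t ht
      exact h.differentiableAt.differentiableWithinAt
    · obtain ⟨d, h0, h⟩ := hd t ht
      rw [h.deriv]; exact h0
  have hle : ∀ i j, i ≤ j → j ≤ k + 1 → G (z i) ≤ G (z j) := by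
    intro i j hij
    induction j, hij using Nat.le_induction with
    | base => exact fun _ => le_rfl
    | succ j hj ih =>
      intro h
      have hlt := hz.lt j (by omega)
      exact (ih (by omega)).trans (hmono j (by omega) (left_mem_Icc.2 hlt.le)
        (right_mem_Icc.2 hlt.le) hlt.le)
  have hstrict : ∀ n ≤ k, (∀ t ∈ Ioo (z n) (z (n + 1)), 0 < σ * C.sol x t) →
      G (z n) < G (z (n + 1)) := by
    intro n hn hpos
    have hlt := hz.lt n hn
    refine lt_of_le_of_ne (hle n (n + 1) (by omega) (by omega)) fun heq => ?_
    -- Without strict growth the flux would vanish on the hump, so u would be constant there, but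
    -- one end of the hump is a zero.
    have hconst : ∀ t ∈ Icc (z n) (z (n + 1)), G t = G (z n) := fun t ht =>
      le_antisymm (heq ▸ hmono n hn ht (right_mem_Icc.2 hlt.le) ht.2)
        (hmono n hn (left_mem_Icc.2 hlt.le) ht ht.1)
    have hflux : ∀ t ∈ Ioo (z n) (z (n + 1)), C.flux x t = 0 := by
      intro t ht
      have hI := hz.subset hn (Ioo_subset_Icc_self ht)
      have e1 : G =ᶠ[𝓝 t] fun _ => G (z n) := by
        filter_upwards [Ioo_mem_nhds ht.1 ht.2] with r hr
          using hconst r (Ioo_subset_Icc_self hr)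
      have e2 := (hGpos t hI (hpos t ht)).unique
        ((hasDerivAt_const t (G (z n))).congr_of_eventuallyEq e1)
      have hpi := C.inv_pos t
      have a2 : 0 ≤ C.q t * C.sol x t ^ 2 := by have := C.q_nonneg t; positivity
      have a3 : 0 ≤ C.flux x t ^ 2 * (C.p t)⁻¹ := by positivity
      have a4 : C.flux x t ^ 2 * (C.p t)⁻¹ = 0 := by linarith
      simpa [(C.p_pos t).ne'] using a4
    have hcs : ContinuousOn (C.sol x) (Icc (z n) (z (n + 1))) :=
      (C.continuousOn_sol x).mono (hz.subset hn)
    obtain ⟨c, hc⟩ := exists_between hlt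
    have key : ∀ e ∈ ({z n, z (n + 1)} : Set ℝ), C.sol x e = C.sol x c := by
      have hmon : ∀ s t, s ∈ Icc (z n) (z (n + 1)) → t ∈ Icc (z n) (z (n + 1)) → s < t →
          C.sol x s = C.sol x t := by
        intro s t hs ht hst
        obtain ⟨r, hr, he⟩ := exists_hasDerivAt_eq_slope (C.sol x) _ hst
          (hcs.mono (Icc_subset_Icc hs.1 ht.2)) fun r hr => C.hasDerivAt_sol x
            (hz.subset hn ⟨hs.1.trans hr.1.le, hr.2.le.trans ht.2⟩)
        rw [hflux r ⟨hs.1.trans_lt hr.1, hr.2.trans_le ht.2⟩, zero_mul, eq_comm,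
          div_eq_zero_iff] at he
        rcases he with he | he <;> linarith
      rintro e (rfl | rfl)
      · exact hmon _ _ (left_mem_Icc.2 hlt.le) (Ioo_subset_Icc_self hc) hc.1
      · exact (hmon _ _ (Ioo_subset_Icc_self hc) (right_mem_Icc.2 hlt.le) hc.2).symm
    have hcpos := hpos c hc
    rcases hz.sol_end hk hn with h | h
    · rw [← key (z n) (by simp), h, mul_zero] at hcpos; exact lt_irrefl _ hcpos
    · rw [← key (z (n + 1)) (by simp), h, mul_zero] at hcpos; exact lt_irrefl _ hcpos
  have hG1 : G (z 0) = 0 := by simp [G, hz.left, sens_left, flux_left]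
  have hG2 : G (z (k + 1)) = κ * C.sens σ x C.T₂ := by simp [G, hz.right, C.flux_right hx]
  -- Hump 0 is positive; hump 1, which exists because k ≥ 1, is negative.
  have hex : ∃ n ≤ k, ∀ t ∈ Ioo (z n) (z (n + 1)), 0 < σ * C.sol x t := by
    rcases hσ with ⟨rfl, -⟩ | ⟨rfl, -⟩
    · exact ⟨0, by omega, fun t ht => by simpa using hz.sol_pos (n := 0) (by omega) ht⟩
    · exact ⟨1, hk, fun t ht => by simpa using hz.sol_pos (n := 1) hk ht⟩
  obtain ⟨n, hn, hpos⟩ := hex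
  have h1 := hle 0 n (by omega) (by omega)
  have h2 := hstrict n hn hpos
  have h3 := hle (n + 1) (k + 1) (by omega) le_rfl
  intro h0
  have h4 : C.sens σ x C.T₂ = 0 := by
    simpa [angleDeriv, (Real.exp_pos _).ne'] using h0
  rw [hG2, h4, mul_zero] at h3
  linarith

end Coeffs
end Fucik

/-! ### Decreasing curves in the plane and the implicit function theorem -/

namespace Fucik

/-- Strict differentiability at `a` makes f - f'(a)·id Lipschitz with small constant near `a`, which
bounds f'(b) - f'(a) for nearby b. Continuity of the derivative thus needs no formula for it. -/
lemma contDiffOn_one_of_hasStrictDerivAt {f : ℝ → ℝ} {s : Set ℝ} (hs : IsOpen s)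
    (h : ∀ a ∈ s, ∃ f', HasStrictDerivAt f f' a) : ContDiffOn ℝ 1 f s := by
  have hd : ∀ a ∈ s, HasStrictDerivAt f (deriv f a) a := fun a ha => by
    obtain ⟨f', hf'⟩ := h a ha
    rwa [hf'.hasDerivAt.deriv]
  rw [show (1 : WithTop ℕ∞) = 0 + 1 by simp, contDiffOn_succ_iff_deriv_of_isOpen hs]
  refine ⟨fun a ha => (hd a ha).hasDerivAt.differentiableAt.differentiableWithinAt,
    by simp, contDiffOn_zero.2 fun a ha => ContinuousAt.continuousWithinAt ?_⟩
  rw [ContinuousAt, Metric.tendsto_nhds]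
  intro ε hε
  have h1 := (hd a ha).isLittleO.bound (half_pos hε)
  rw [nhds_prod_eq] at h1
  obtain ⟨u, hu, h2⟩ := eventually_prod_self_iff'.1 h1
  filter_upwards [eventually_mem_nhds_iff.2 hu, hs.mem_nhds ha] with b hb hbs
  have h3 := (hd b hbs).hasDerivAt.sub ((hasDerivAt_id b).mul_const (deriv f a))
  have h4 := h3.hasFDerivAt.le_of_lip' (half_pos hε).le (by
    filter_upwards [hb] with c hc
    refine le_trans (le_of_eq (congrArg _ ?_)) (h2 c hc b (mem_of_mem_nhds hb))
    simp
    ring)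
  rw [Real.dist_eq]
  rw [ContinuousLinearMap.norm_toSpanSingleton, one_mul, Real.norm_eq_abs] at h4
  linarith

/-- Closed sets in the open quadrant which are locally graphs in both directions and contain no
two points one of which is strictly larger in both coordinates. -/
structure IsCurve (E : Set (ℝ × ℝ)) : Prop where
  closed : IsClosed E
  pos : ∀ x ∈ E, 0 < x.1 ∧ 0 < x.2
  incomparable : ∀ x ∈ E, ∀ y ∈ E, x.1 < y.1 → ¬ x.2 < y.2
  local_fst : ∀ x ∈ E, ∃ φ : ℝ → ℝ, ∃ φ' : ℝ, HasStrictDerivAt φ φ' x.1 ∧ φ x.1 = x.2 ∧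
    ∀ᶠ a in 𝓝 x.1, (a, φ a) ∈ E
  local_snd : ∀ x ∈ E, ∃ φ : ℝ → ℝ, ∃ φ' : ℝ, HasStrictDerivAt φ φ' x.2 ∧ φ x.2 = x.1 ∧
    ∀ᶠ b in 𝓝 x.2, (φ b, b) ∈ E

namespace IsCurve

variable {E : Set (ℝ × ℝ)} (hE : IsCurve E)
include hE

lemma swap : IsCurve (Prod.swap ⁻¹' E) where
  closed := hE.closed.preimage continuous_swap
  pos _ hx := (hE.pos _ hx).symm
  incomparable _ hx _ hy h1 h2 := hE.incomparable _ hx _ hy h2 h1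
  local_fst _ hx := hE.local_snd _ hx
  local_snd _ hx := hE.local_fst _ hx

/-- If b < c lay over the same `a`, following the local graph through (a, c) slightly to the right
would give a point of `E` strictly above and to the right of (a, b). -/
lemma snd_unique {a b c : ℝ} (hb : (a, b) ∈ E) (hc : (a, c) ∈ E) : b = c := by
  have key : ∀ {b c : ℝ}, (a, b) ∈ E → (a, c) ∈ E → ¬ b < c := by
    intro b c hb hc hlt
    obtain ⟨φ, φ', hφ, he, hev⟩ := hE.local_fst _ hc
    have h1 : ∀ᶠ r in 𝓝 a, b < φ r := by
      refine hφ.hasDerivAt.continuousAt.eventually (lt_mem_nhds ?_)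
      change b < φ (a, c).1
      rw [he]; exact hlt
    have h2 := (hev.and h1).filter_mono (nhdsWithin_le_nhds (s := Ioi a))
    obtain ⟨r, ⟨h3, h4⟩, h5⟩ := (h2.and self_mem_nhdsWithin).exists
    exact hE.incomparable _ hb _ h3 h5 h4
  exact le_antisymm (not_lt.1 (key hc hb)) (not_lt.1 (key hb hc))

lemma snd_lt {x y : ℝ × ℝ} (hx : x ∈ E) (hy : y ∈ E) (h : x.1 < y.1) : y.2 < x.2 := by
  refine lt_of_le_of_ne (not_lt.1 (hE.incomparable x hx y hy h)) fun he => ?_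
  have h1 : (x.2, x.1) ∈ Prod.swap ⁻¹' E := hx
  have h2 : (x.2, y.1) ∈ Prod.swap ⁻¹' E := by rw [← he]; exact hy
  exact h.ne (hE.swap.snd_unique h1 h2)

/-- Continuation to the right: the second coordinate stays in [0, x.2], so compactness makes the
projection closed over [x.1, a], and local graphs extend it past each of its points. -/
lemma mem_image_fst_of_lt {x : ℝ × ℝ} (hx : x ∈ E) {a : ℝ} (ha : x.1 < a) :
    a ∈ Prod.fst '' E := by
  refine IsClosed.mem_of_ge_of_forall_exists_gt (a := x.1) (b := a) ?_ ⟨x, hx, rfl⟩ ha.le ?_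
  · have hK : IsCompact (E ∩ Icc x.1 a ×ˢ Icc 0 x.2) :=
      (isCompact_Icc.prod isCompact_Icc).inter_left hE.closed
    convert (hK.image continuous_fst).isClosed using 1
    ext r
    constructor
    · rintro ⟨⟨y, hy, rfl⟩, hr⟩
      refine ⟨y, ⟨hy, hr, (hE.pos y hy).2.le, ?_⟩, rfl⟩
      rcases eq_or_lt_of_le hr.1 with h | h
      · have : (x.1, y.2) ∈ E := by rw [h]; exact hy
        exact (hE.snd_unique this hx).le
      · exact (hE.snd_lt hx hy h).le
    · rintro ⟨y, ⟨hy, hr, -⟩, rfl⟩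
      exact ⟨⟨y, hy, rfl⟩, hr⟩
  · rintro r ⟨⟨y, hy, rfl⟩, hr⟩
    obtain ⟨φ, φ', -, -, hev⟩ := hE.local_fst _ hy
    have h2 := hev.filter_mono (nhdsWithin_le_nhds (s := Ioi y.1))
    obtain ⟨s, h3, h4⟩ := (h2.and (Ioc_mem_nhdsGT hr.2)).exists
    exact ⟨s, ⟨_, h3, rfl⟩, h4⟩

lemma exists_image_fst_eq (hne : E.Nonempty) : ∃ α, 0 ≤ α ∧ Prod.fst '' E = Ioi α := by
  have hbdd : BddBelow (Prod.fst '' E) := ⟨0, by rintro _ ⟨x, hx, rfl⟩; exact (hE.pos x hx).1.le⟩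
  refine ⟨sInf (Prod.fst '' E), Real.sInf_nonneg ?_, ?_⟩
  · rintro _ ⟨x, hx, rfl⟩; exact (hE.pos x hx).1.le
  · ext a
    constructor
    · rintro ⟨x, hx, rfl⟩
      -- The local graph also reaches to the left, so the infimum is not attained.
      obtain ⟨φ, φ', -, -, hev⟩ := hE.local_fst _ hx
      have h2 := hev.filter_mono (nhdsWithin_le_nhds (s := Iio x.1))
      obtain ⟨s, h3, h4⟩ := (h2.and self_mem_nhdsWithin).exists
      exact lt_of_le_of_lt (csInf_le hbdd ⟨_, h3, rfl⟩) h4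
    · intro ha
      obtain ⟨_, ⟨x, hx, rfl⟩, hlt⟩ := exists_lt_of_csInf_lt (hne.image _) (mem_Ioi.1 ha)
      exact hE.mem_image_fst_of_lt hx hlt

lemma contDiffOn_of_graph {f : ℝ → ℝ} {α : ℝ} (hf : ∀ a ∈ Ioi α, (a, f a) ∈ E) :
    ContDiffOn ℝ 1 f (Ioi α) := by
  refine contDiffOn_one_of_hasStrictDerivAt isOpen_Ioi fun a ha => ?_
  obtain ⟨φ, φ', hφ, -, hev⟩ := hE.local_fst _ (hf a ha)
  refine ⟨φ', hφ.congr_of_eventuallyEq ?_⟩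
  filter_upwards [hev, Ioi_mem_nhds ha] with r h1 h2
  exact hE.snd_unique h1 (hf r h2)

/-- A curve is the graph of a decreasing diffeomorphism. -/
theorem exists_graph (hne : E.Nonempty) : ∃ α β : ℝ, 0 ≤ α ∧ 0 ≤ β ∧ ∃ f g : ℝ → ℝ,
    ContDiffOn ℝ 1 f (Ioi α) ∧ ContDiffOn ℝ 1 g (Ioi β) ∧ MapsTo f (Ioi α) (Ioi β) ∧
    MapsTo g (Ioi β) (Ioi α) ∧ InvOn g f (Ioi α) (Ioi β) ∧ StrictAntiOn f (Ioi α) ∧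
    E = (fun a => (a, f a)) '' Ioi α := by
  obtain ⟨α, hα, hA⟩ := hE.exists_image_fst_eq hne
  obtain ⟨β, hβ, hB⟩ := hE.swap.exists_image_fst_eq
    (hne.preimage Prod.swap_surjective)
  have hf : ∀ a, ∃ b, a ∈ Ioi α → (a, b) ∈ E := by
    intro a
    by_cases ha : a ∈ Ioi α
    · rw [← hA] at ha
      obtain ⟨x, hx, rfl⟩ := ha
      exact ⟨x.2, fun _ => hx⟩
    · exact ⟨0, fun h => absurd h ha⟩
  have hg : ∀ b, ∃ a, b ∈ Ioi β → (a, b) ∈ E := by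
    intro b
    by_cases hb : b ∈ Ioi β
    · rw [← hB] at hb
      obtain ⟨x, hx, rfl⟩ := hb
      exact ⟨x.2, fun _ => hx⟩
    · exact ⟨0, fun h => absurd h hb⟩
  choose f hf using hf
  choose g hg using hg
  have hfm : MapsTo f (Ioi α) (Ioi β) := fun a ha => by
    rw [← hB]; exact ⟨(f a, a), hf a ha, rfl⟩
  have hgm : MapsTo g (Ioi β) (Ioi α) := fun b hb => by
    rw [← hA]; exact ⟨(g b, b), hg b hb, rfl⟩
  refine ⟨α, β, hα, hβ, f, g, hE.contDiffOn_of_graph hf, hE.swap.contDiffOn_of_graph hg,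
    hfm, hgm, ⟨fun a ha => ?_, fun b hb => ?_⟩, fun a ha b hb hab => ?_, ?_⟩
  · have h1 : (f a, a) ∈ Prod.swap ⁻¹' E := hf a ha
    exact (hE.swap.snd_unique h1 (hg _ (hfm ha))).symm
  · exact (hE.snd_unique (hg b hb) (hf _ (hgm hb))).symm
  · exact hE.snd_lt (hf a ha) (hf b hb) hab
  · ext x
    constructor
    · intro hx
      have ha : x.1 ∈ Ioi α := by rw [← hA]; exact ⟨x, hx, rfl⟩
      exact ⟨x.1, ha, Prod.ext rfl (hE.snd_unique (hf _ ha) hx)⟩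
    · rintro ⟨a, ha, rfl⟩; exact hf a ha

end IsCurve

/-- The implicit function theorem for a plane level set. -/
lemma exists_local_graph {R : ℝ × ℝ → ℝ} {x : ℝ × ℝ} {A B : ℝ} (hB : B ≠ 0)
    (hR : HasStrictFDerivAt R
      (A • ContinuousLinearMap.fst ℝ ℝ ℝ + B • ContinuousLinearMap.snd ℝ ℝ ℝ) x) :
    ∃ φ : ℝ → ℝ, ∃ φ' : ℝ, HasStrictDerivAt φ φ' x.1 ∧ φ x.1 = x.2 ∧
      ∀ᶠ a in 𝓝 x.1, R (a, φ a) = R x := by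
  have hinv : ((A • ContinuousLinearMap.fst ℝ ℝ ℝ + B • ContinuousLinearMap.snd ℝ ℝ ℝ) ∘L
      ContinuousLinearMap.inr ℝ ℝ ℝ).IsInvertible := by
    refine ⟨ContinuousLinearEquiv.unitsEquivAut ℝ (Units.mk0 B hB), ?_⟩
    ext
    simp
  refine ⟨hR.implicitFunctionOfProdDomain hinv, _,
    (hR.hasStrictFDerivAt_implicitFunctionOfProdDomain hinv).hasStrictDerivAt, ?_,
    hR.eventually_apply_implicitFunctionOfProdDomain hinv⟩
  exact (hR.eventually_apply_eq_iff_implicitFunctionOfProdDomain hinv).self_of_nhds.1 rfl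

end Fucik

/-! ### Level sets of the rotation as hyperbolic-like curves -/

namespace Fucik

namespace Coeffs

variable (C : Coeffs)

/-- The parameters `(a, β)` in the closed first quadrant for which `(a, -β)` has rotation `kπ`. -/
def curve (k : ℕ) : Set (ℝ × ℝ) := {x | 0 ≤ x.1 ∧ 0 ≤ x.2 ∧ C.rot (x.1, -x.2) = k * Real.pi}

lemma isCurve {k : ℕ} (hk : 1 ≤ k) : IsCurve (C.curve k) := by
  have hc : Continuous fun x : ℝ × ℝ => C.rot (x.1, -x.2) := C.continuous_rot.comp (by fun_prop)
  have hpos : ∀ x ∈ C.curve k, 0 < x.1 ∧ 0 < x.2 := fun x hx => by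
    obtain ⟨h1, h2, -⟩ := C.alternates_of_rot_eq hk (x := (x.1, -x.2)) hx.1
      (neg_nonpos.2 hx.2.1) hx.2.2
    exact ⟨h1, neg_lt_zero.1 h2⟩
  have hd : ∀ x : ℝ × ℝ, HasStrictFDerivAt (fun x : ℝ × ℝ => C.rot (x.1, -x.2))
      (C.angleDeriv 1 (x.1, -x.2) C.T₂ • ContinuousLinearMap.fst ℝ ℝ ℝ +
        (-C.angleDeriv (-1) (x.1, -x.2) C.T₂) • ContinuousLinearMap.snd ℝ ℝ ℝ) x := by
    intro x
    have h1 : HasStrictFDerivAt (fun x : ℝ × ℝ => (x.1, -x.2))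
        ((ContinuousLinearMap.fst ℝ ℝ ℝ).prod (-ContinuousLinearMap.snd ℝ ℝ ℝ)) x :=
      hasStrictFDerivAt_fst.prodMk hasStrictFDerivAt_snd.neg
    refine ((C.hasStrictFDerivAt_rot (x.1, -x.2)).comp x h1).congr_fderiv ?_
    ext <;> simp
  refine ⟨?_, hpos, fun x hx y hy h1 h2 => ?_, fun x hx => ?_, fun x hx => ?_⟩
  · exact (isClosed_le continuous_const continuous_fst).inter
      ((isClosed_le continuous_const continuous_snd).inter (isClosed_eq hc continuous_const))
  · exact C.rot_ne_of_lt hk (x := (x.1, -x.2)) (y := (y.1, -y.2)) (hpos x hx).1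
      (neg_neg_of_pos (hpos x hx).2) h1 (neg_lt_neg h2) hx.2.2 hy.2.2
  · obtain ⟨φ, φ', hφ, he, hev⟩ := exists_local_graph
      (neg_ne_zero.2 (C.angleDeriv_ne_zero hk (Or.inr ⟨rfl, rfl⟩) hx.2.2)) (hd x)
    refine ⟨φ, φ', hφ, he, ?_⟩
    have h1 : ∀ᶠ a in 𝓝 x.1, 0 < φ a := hφ.hasDerivAt.continuousAt.eventually
      (lt_mem_nhds (by rw [he]; exact (hpos x hx).2))
    filter_upwards [hev, h1, lt_mem_nhds (hpos x hx).1] with a h2 h3 h4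
    exact ⟨h4.le, h3.le, h2.trans hx.2.2⟩
  -- The graph over the second coordinate is the implicit function for the swapped map; here the
  -- derivative in `a` has to be nonzero.
  · have h1 : HasStrictFDerivAt (Prod.swap : ℝ × ℝ → ℝ × ℝ)
        ((ContinuousLinearMap.snd ℝ ℝ ℝ).prod (ContinuousLinearMap.fst ℝ ℝ ℝ)) x.swap :=
      hasStrictFDerivAt_snd.prodMk hasStrictFDerivAt_fst
    have h2 : HasStrictFDerivAt (fun y : ℝ × ℝ => C.rot (y.swap.1, -y.swap.2))
        ((-C.angleDeriv (-1) (x.1, -x.2) C.T₂) • ContinuousLinearMap.fst ℝ ℝ ℝ +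
        C.angleDeriv 1 (x.1, -x.2) C.T₂ • ContinuousLinearMap.snd ℝ ℝ ℝ) x.swap := by
      refine ((hd x).comp x.swap h1).congr_fderiv ?_
      ext <;> simp
    obtain ⟨φ, φ', hφ, he, hev⟩ := exists_local_graph
      (C.angleDeriv_ne_zero hk (Or.inl ⟨rfl, rfl⟩) hx.2.2) h2
    refine ⟨φ, φ', hφ, he, ?_⟩
    have h1 : ∀ᶠ a in 𝓝 x.2, 0 < φ a := hφ.hasDerivAt.continuousAt.eventually
      (lt_mem_nhds (by change 0 < φ x.swap.1; rw [he]; exact (hpos x hx).1))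
    filter_upwards [hev, h1, lt_mem_nhds (hpos x hx).2] with a h2 h3 h4
    exact ⟨h3.le, h4.le, h2.trans hx.2.2⟩

lemma curve_nonempty_iff {k : ℕ} (hk : 1 ≤ k) :
    (C.curve k).Nonempty ↔ Alternates C.m (Icc C.T₁ C.T₂) k := by
  constructor
  · rintro ⟨x, hx⟩
    exact (C.alternates_of_rot_eq hk (x := (x.1, -x.2)) hx.1 (neg_nonpos.2 hx.2.1) hx.2.2).2.2
  · intro h
    obtain ⟨l, hl, he⟩ := C.exists_rot_eq hk h
    exact ⟨(l, l), hl, hl, he⟩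

lemma neg_field (x : ℝ × ℝ) (t θ : ℝ) : C.neg.field (-x) t θ = C.field x t θ := by
  simp only [field, neg, Prod.fst_neg, Prod.snd_neg]; ring

/-- Negating weight and parameters leaves the field unchanged. The two angles are chosen
independently, so their equality is uniqueness for the angle equation: Gronwall with ε = 0. -/
lemma neg_rot (x : ℝ × ℝ) : C.neg.rot (-x) = C.rot x := by
  have h := gronwall (f := fun t => C.neg.angle (-x) t - C.angle x t) (ε := 0)
    (C.one_le_bound (norm_nonneg x)) le_rfl
    (fun s hs => (C.neg.hasDerivAt_angle (-x) (t := s) hs).sub (C.hasDerivAt_angle x hs))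
    (by
      change C.neg.angle (-x) C.neg.T₁ - C.angle x C.T₁ = 0
      rw [angle_left, angle_left, sub_zero]) (fun s _ => ?_) C.right_mem
  · rw [zero_mul] at h
    exact sub_eq_zero.1 (abs_nonpos_iff.1 h)
  · rw [neg_field, add_zero]
    exact C.abs_field_sub_le (abs_fst_le le_rfl) (abs_snd_le le_rfl) s _ _

end Coeffs

namespace IsCurve

variable {E : Set (ℝ × ℝ)} (hE : IsCurve E)
include hE

lemma isHyperbolicLikePosNeg (hne : E.Nonempty) :
    IsHyperbolicLikePosNeg {x | (x.1, -x.2) ∈ E} := by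
  obtain ⟨α, β, hα, hβ, f, g, hf, hg, hfm, hgm, hinv, hanti, heq⟩ := hE.exists_graph hne
  have hm : MapsTo (fun b : ℝ => -b) (Iio (-β)) (Ioi β) := fun b hb => lt_neg.1 (mem_Iio.1 hb)
  refine ⟨α, -β, hα, neg_nonpos.2 hβ, fun a => -f a, fun b => g (-b), hf.neg,
    hg.comp contDiff_neg.contDiffOn hm, fun a ha => mem_Iio.2 (neg_lt_neg (hfm ha)), fun b hb => hgm (hm hb),
    ⟨fun a ha => ?_, fun b hb => ?_⟩, fun a ha b hb hab => neg_lt_neg (hanti ha hb hab), ?_⟩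
  · change g (- -f a) = a
    rw [neg_neg]; exact hinv.1 ha
  · change -f (g (-b)) = b
    rw [hinv.2 (hm hb), neg_neg]
  · ext x
    rw [heq]
    constructor
    · rintro ⟨a, ha, h⟩
      rw [Prod.mk.injEq] at h
      exact ⟨a, ha, Prod.ext h.1 (by rw [neg_eq_iff_eq_neg]; exact h.2)⟩
    · rintro ⟨a, ha, rfl⟩
      exact ⟨a, ha, by simp⟩

lemma isHyperbolicLikeNegPos (hne : E.Nonempty) :
    IsHyperbolicLikeNegPos {x | (-x.1, x.2) ∈ E} := by
  obtain ⟨α, β, hα, hβ, f, g, hf, hg, hfm, hgm, hinv, hanti, heq⟩ := hE.exists_graph hne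
  have hm : MapsTo (fun b : ℝ => -b) (Iio (-α)) (Ioi α) := fun b hb => lt_neg.1 (mem_Iio.1 hb)
  refine ⟨-α, β, neg_nonpos.2 hα, hβ, fun a => f (-a), fun b => -g b,
    hf.comp contDiff_neg.contDiffOn hm, hg.neg, fun a ha => hfm (hm ha),
    fun b hb => mem_Iio.2 (neg_lt_neg (hgm hb)),
    ⟨fun a ha => ?_, fun b hb => ?_⟩, fun a ha b hb hab => hanti (hm hb) (hm ha) (neg_lt_neg hab),
    ?_⟩
  · change -g (f (-a)) = a
    rw [hinv.1 (hm ha), neg_neg]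
  · change f (- -g b) = b
    rw [neg_neg]; exact hinv.2 hb
  · ext x
    rw [heq]
    constructor
    · rintro ⟨a, ha, h⟩
      rw [Prod.mk.injEq] at h
      refine ⟨-a, mem_Iio.2 (neg_lt_neg ha), Prod.ext (by rw [neg_eq_iff_eq_neg]; exact h.1) ?_⟩
      simpa using h.2
    · rintro ⟨a, ha, rfl⟩
      exact ⟨-a, hm ha, rfl⟩

end IsCurve
end Fucik

/-! ### Alternations of sign and the number of changes of sign -/

namespace Fucik

variable {m : ℝ → ℝ} {S S' : Set ℝ} {k : ℕ}

lemma Alternates.congr {m' : ℝ → ℝ} (h : ∀ t ∈ S, m t = m' t) :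
    Alternates m S k ↔ Alternates m' S k := by
  constructor <;> rintro ⟨t, hlt, ht⟩ <;> refine ⟨t, hlt, fun j hj => ⟨(ht j hj).1, ?_⟩⟩
  · rw [← h _ (ht j hj).1]; exact (ht j hj).2
  · rw [h _ (ht j hj).1]; exact (ht j hj).2

lemma Alternates.mono (h : Alternates m S k) (hS : S ⊆ S') : Alternates m S' k := by
  obtain ⟨t, hlt, ht⟩ := h
  exact ⟨t, hlt, fun j hj => ⟨hS (ht j hj).1, (ht j hj).2⟩⟩

lemma Alternates.init (h : Alternates m S (k + 1)) : Alternates m S k := by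
  obtain ⟨t, hlt, ht⟩ := h
  exact ⟨t, fun j hj => hlt j (by omega), fun j hj => ht j (by omega)⟩

lemma Alternates.tail (h : Alternates m S (k + 1)) : Alternates (fun t => -m t) S k := by
  obtain ⟨t, hlt, ht⟩ := h
  refine ⟨fun j => t (j + 1), fun j hj => hlt (j + 1) (by omega), fun j hj => ?_⟩
  have := ht (j + 1) (by omega)
  refine ⟨this.1, ?_⟩
  have h2 := this.2
  rw [pow_succ] at h2
  linarith

lemma alternates_cons {t : ℕ → ℝ} {x : ℝ} (hlt : ∀ j < k, t j < t (j + 1))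
    (ht : ∀ j ≤ k, t j ∈ S ∧ 0 < (-1) ^ j * -m (t j)) (hx : x ∈ S) (hxt : x < t 0)
    (hmx : 0 < m x) : Alternates m S (k + 1) := by
  refine ⟨fun j => Nat.casesOn j x t, fun j hj => ?_, fun j hj => ?_⟩
  · cases j with
    | zero => exact hxt
    | succ j => exact hlt j (by omega)
  · cases j with
    | zero => exact ⟨hx, by simpa using hmx⟩
    | succ j =>
      have := ht j (by omega)
      refine ⟨this.1, ?_⟩
      have h2 := this.2
      rw [pow_succ]
      change 0 < (-1) ^ j * -1 * m (t j)
      linarith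

lemma Alternates.cons (h : Alternates (fun t => -m t) S k)
    (hx : ∀ y ∈ S, ∃ x ∈ S, x < y ∧ 0 < m x) : Alternates m S (k + 1) := by
  obtain ⟨t, hlt, ht⟩ := h
  obtain ⟨x, hxS, hxt, hmx⟩ := hx _ (ht 0 (by omega)).1
  exact alternates_cons hlt ht hxS hxt hmx

lemma Alternates.snoc (h : Alternates m S k) (hS : S ⊆ S')
    (hx : ∀ y ∈ S, ∃ x ∈ S', y < x ∧ 0 < (-1) ^ (k + 1) * m x) : Alternates m S' (k + 1) := by
  obtain ⟨t, hlt, ht⟩ := h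
  obtain ⟨x, hxS, hxt, hmx⟩ := hx _ (ht k le_rfl).1
  refine ⟨fun j => if j ≤ k then t j else x, fun j hj => ?_, fun j hj => ?_⟩
  · rcases Nat.lt_or_ge j k with h | h
    · simp only [h.le, if_true, Nat.succ_le_of_lt h]; exact hlt j h
    · obtain rfl : j = k := by omega
      simpa using hxt
  · rcases Nat.lt_or_ge k j with h | h
    · obtain rfl : j = k + 1 := by omega
      simp only [Nat.not_succ_le_self, if_false]
      exact ⟨hxS, hmx⟩
    · simp only [h, if_true]
      exact ⟨hS (ht j h).1, (ht j h).2⟩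

/-- There are `k` alternations of sign, with any first sign. -/
def HasAlternation (m : ℝ → ℝ) (S : Set ℝ) (k : ℕ) : Prop :=
  Alternates m S k ∨ Alternates (fun t => -m t) S k

/-- Dropping the last point keeps the first sign, dropping the first point reverses it. -/
lemma HasAlternation.both (h : HasAlternation m S (k + 1)) :
    Alternates m S k ∧ Alternates (fun t => -m t) S k := by
  rcases h with h | h
  · exact ⟨h.init, h.tail⟩
  · exact ⟨by simpa using h.tail, h.init⟩

/-- The two first points carry opposite signs; the earlier one can be put in front of the other
sequence. -/
lemma hasAlternation_succ_of_both (h1 : Alternates m S k)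
    (h2 : Alternates (fun t => -m t) S k) : HasAlternation m S (k + 1) := by
  obtain ⟨t, hlt, ht⟩ := h1
  obtain ⟨s, hls, hs⟩ := h2
  have ht0 := ht 0 (by omega)
  have hs0 := hs 0 (by omega)
  rw [pow_zero, one_mul] at ht0 hs0
  rcases lt_trichotomy (t 0) (s 0) with h | h | h
  · exact Or.inl (alternates_cons hls hs ht0.1 h ht0.2)
  · rw [h] at ht0; linarith [ht0.2, hs0.2]
  · exact Or.inr (alternates_cons hlt (by simpa using ht) hs0.1 h hs0.2)

lemma hasAlternation_one {x y : ℝ} (hx : x ∈ S) (hy : y ∈ S) (hxy : x ≠ y)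
    (hm : m x * m y < 0) : HasAlternation m S 1 := by
  have key : ∀ {w : ℝ → ℝ} {a b : ℝ}, a ∈ S → b ∈ S → a < b → 0 < w a → w b < 0 →
      Alternates w S 1 := by
    intro w a b ha hb hab h1 h2
    refine ⟨fun j => if j = 0 then a else b, fun j hj => ?_, fun j hj => ?_⟩
    · obtain rfl : j = 0 := by omega
      simpa using hab
    · interval_cases j
      · exact ⟨ha, by simpa using h1⟩
      · exact ⟨hb, by simpa using h2⟩
  rcases mul_neg_iff.1 hm with ⟨h1, h2⟩ | ⟨h1, h2⟩ <;> rcases lt_or_gt_of_ne hxy with h | h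
  · exact Or.inl (key hx hy h h1 h2)
  · exact Or.inr (key hy hx h (by linarith) (by linarith))
  · exact Or.inr (key hx hy h (by linarith) (by linarith))
  · exact Or.inl (key hy hx h h2 h1)

/-- Of two later points with opposite signs, one has the sign needed next, so parity need not be
tracked. -/
lemma HasAlternation.snoc (h : HasAlternation m S k) (hS : S ⊆ S') {x y : ℝ} (hx : x ∈ S')
    (hy : y ∈ S') (hSx : ∀ z ∈ S, z < x) (hxy : x < y) (hm : m x * m y < 0) :
    HasAlternation m S' (k + 1) := by
  have key : ∀ w : ℝ → ℝ, w x * w y < 0 → Alternates w S k → Alternates w S' (k + 1) := by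
    intro w hw hA
    refine hA.snoc hS fun z hz => ?_
    by_cases h1 : 0 < (-1) ^ (k + 1) * w x
    · exact ⟨x, hx, hSx z hz, h1⟩
    · refine ⟨y, hy, (hSx z hz).trans hxy, ?_⟩
      rcases Nat.even_or_odd (k + 1) with he | ho
      · rw [he.neg_one_pow] at h1 ⊢
        rcases mul_neg_iff.1 hw with ⟨h2, h3⟩ | ⟨h2, h3⟩ <;> linarith
      · rw [ho.neg_one_pow] at h1 ⊢
        rcases mul_neg_iff.1 hw with ⟨h2, h3⟩ | ⟨h2, h3⟩ <;> linarith
  rcases h with h | h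
  · exact Or.inl (key m hm h)
  · exact Or.inr (key _ (by linarith) h)

variable {T₁ T₂ s : ℝ}

lemma alternates_of_accumulation_left {S : Set ℝ} (hne : S.Nonempty)
    (h : ∀ x ∈ S, ∃ y ∈ S, x < y ∧ 0 < m y)
    (h' : ∀ x ∈ S, ∃ y ∈ S, x < y ∧ m y < 0) (k : ℕ) : Alternates m S k := by
  induction k with
  | zero =>
    obtain ⟨x, hx⟩ := hne
    obtain ⟨y, hy, -, hm⟩ := h x hx
    exact ⟨fun _ => y, fun j hj => absurd hj (Nat.not_lt_zero j),
      fun j hj => ⟨hy, by obtain rfl : j = 0 := by omega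
                          simpa using hm⟩⟩
  | succ k ih =>
    refine ih.snoc subset_rfl fun x hx => ?_
    rcases Nat.even_or_odd (k + 1) with he | ho
    · rw [he.neg_one_pow]
      obtain ⟨y, hy, h1, h2⟩ := h x hx
      exact ⟨y, hy, h1, by linarith⟩
    · rw [ho.neg_one_pow]
      obtain ⟨y, hy, h1, h2⟩ := h' x hx
      exact ⟨y, hy, h1, by linarith⟩

/-- Here new points are available only to the left, so the list grows at its front; this reverses
the first sign, whence the induction over all `m`. -/
lemma alternates_of_accumulation_right {S : Set ℝ} (hne : S.Nonempty)
    (h : ∀ x ∈ S, ∃ y ∈ S, y < x ∧ 0 < m y)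
    (h' : ∀ x ∈ S, ∃ y ∈ S, y < x ∧ m y < 0) (k : ℕ) : Alternates m S k := by
  induction k generalizing m with
  | zero =>
    obtain ⟨x, hx⟩ := hne
    obtain ⟨y, hy, -, hm⟩ := h x hx
    exact ⟨fun _ => y, fun j hj => absurd hj (Nat.not_lt_zero j),
      fun j hj => ⟨hy, by obtain rfl : j = 0 := by omega
                          simpa using hm⟩⟩
  | succ k ih =>
    exact (ih (m := fun t => -m t) (by simpa using h') (by simpa using h)).cons h

lemma IsMultipleChange.alternates (hs : IsMultipleChange m T₁ T₂ s) (k : ℕ) :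
    Alternates m (Icc T₁ T₂) k := by
  obtain ⟨hsI, ⟨hlt, h⟩ | ⟨hlt, h⟩⟩ := hs
  · refine (alternates_of_accumulation_left (S := Icc T₁ T₂ ∩ Iio s)
      ⟨T₁, ⟨le_rfl, hlt.le.trans hsI.2⟩, hlt⟩ (fun x hx => ?_) (fun x hx => ?_) k).mono
      inter_subset_left
    · obtain ⟨⟨y, hy, hm⟩, -⟩ := h (s - x) (sub_pos.2 hx.2)
      exact ⟨y, ⟨hy.2, hy.1.2⟩, by linarith [hy.1.1], hm⟩
    · obtain ⟨-, ⟨y, hy, hm⟩⟩ := h (s - x) (sub_pos.2 hx.2)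
      exact ⟨y, ⟨hy.2, hy.1.2⟩, by linarith [hy.1.1], hm⟩
  · refine (alternates_of_accumulation_right (S := Icc T₁ T₂ ∩ Ioi s)
      ⟨T₂, ⟨hsI.1.trans hlt.le, le_rfl⟩, hlt⟩ (fun x hx => ?_) (fun x hx => ?_) k).mono
      inter_subset_left
    · obtain ⟨⟨y, hy, hm⟩, -⟩ := h (x - s) (sub_pos.2 hx.2)
      exact ⟨y, ⟨hy.2, hy.1.1⟩, by linarith [hy.1.2], hm⟩
    · obtain ⟨-, ⟨y, hy, hm⟩⟩ := h (x - s) (sub_pos.2 hx.2)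
      exact ⟨y, ⟨hy.2, hy.1.1⟩, by linarith [hy.1.2], hm⟩

/-- Near a simple change of sign there are points of opposite sign on both sides, arbitrarily
close to the interval on which the weight vanishes. -/
lemma IsSimpleChange.exists_opposite (hs : IsSimpleChange m T₁ T₂ s) :
    s ∈ Ioo T₁ T₂ ∧ ∃ s', T₁ < s' ∧ s' ≤ s ∧ (∀ t ∈ Icc s' s, m t = 0) ∧
      ∀ᶠ ε in 𝓝[>] (0 : ℝ), ∃ x ∈ Ioo (s' - ε) s', ∃ y ∈ Ioo s (s + ε), m x * m y < 0 := by
  obtain ⟨hsI, s', ε₀, h1, h2, h3, h4, h5⟩ := hs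
  refine ⟨hsI, s', h1, h2, h4, ?_⟩
  filter_upwards [Ioo_mem_nhdsGT h3] with ε hε
  rcases h5 with h5 | h5 <;>
    obtain ⟨⟨a1, x, hx, hx0⟩, ⟨a2, y, hy, hy0⟩⟩ := h5 ε hε.1 hε.2 <;>
    refine ⟨x, hx, y, hy, ?_⟩
  · exact mul_neg_of_neg_of_pos (lt_of_le_of_ne (a1 x hx) hx0) (lt_of_le_of_ne (a2 y hy) hy0.symm)
  · exact mul_neg_of_pos_of_neg (lt_of_le_of_ne (a1 x hx) hx0.symm) (lt_of_le_of_ne (a2 y hy) hy0)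

/-- Induction on the largest change `a`, with zero interval [s', a]. Just to the right of every
simple change m takes nonzero values, so no smaller change lies in that interval; the points of
opposite sign near s' and `a` then extend the alternation. The empty set is separate because even 0
alternations require a point where m ≠ 0. -/
lemma hasAlternation_of_finset (F : Finset ℝ) (hF : ∀ x ∈ F, IsSimpleChange m T₁ T₂ x) :
    F = ∅ ∨ ∀ r, (∀ x ∈ F, x < r) → HasAlternation m (Icc T₁ T₂ ∩ Iio r) F.card := by
  induction F using Finset.induction_on_max with
  | empty => exact Or.inl rfl
  | insert a F ha ih =>
    right
    intro r hr
    obtain ⟨haI, s', h1, h2, h3, h4⟩ := (hF a (Finset.mem_insert_self a F)).exists_opposite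
    have har := hr a (Finset.mem_insert_self a F)
    have hFs' : ∀ x ∈ F, x < s' := by
      intro x hx
      by_contra! hle
      obtain ⟨-, _, -, -, -, h5⟩ := (hF x (Finset.mem_insert_of_mem hx)).exists_opposite
      obtain ⟨ε, ⟨_, -, y, hy, hm⟩, hε⟩ :=
        (h5.and (Ioo_mem_nhdsGT (sub_pos.2 (ha x hx)))).exists
      have : m y = 0 := h3 y ⟨hle.trans hy.1.le, by linarith [hy.2, hε.2]⟩
      rw [this, mul_zero] at hm
      exact lt_irrefl _ hm
    have h5 : ∀ᶠ ε in 𝓝[>] (0 : ℝ), ∀ x ∈ F, x < s' - ε := by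
      rw [Filter.eventually_all_finset]
      intro x hx
      filter_upwards [Ioo_mem_nhdsGT (sub_pos.2 (hFs' x hx))] with ε hε
      linarith [hε.2]
    obtain ⟨ε, ⟨⟨⟨⟨x, hx, y, hy, hm⟩, h6⟩, h7⟩, h8⟩, h9⟩ := ((((h4.and h5).and
      (Ioo_mem_nhdsGT (sub_pos.2 h1))).and (Ioo_mem_nhdsGT (sub_pos.2 haI.2))).and
      (Ioo_mem_nhdsGT (sub_pos.2 har))).exists
    have hxI : x ∈ Icc T₁ T₂ ∩ Iio r :=
      ⟨⟨by linarith [hx.1, h7.2], by linarith [hx.2, haI.2]⟩, by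
        have := hx.2; simp only [mem_Iio]; linarith⟩
    have hyI : y ∈ Icc T₁ T₂ ∩ Iio r :=
      ⟨⟨by linarith [hy.1, haI.1], by linarith [hy.2, h8.2]⟩, by
        have := hy.2; have := h9.2; simp only [mem_Iio]; linarith⟩
    have hxy : x < y := by linarith [hx.2, hy.1]
    rw [Finset.card_insert_of_notMem fun h => lt_irrefl _ (ha a h)]
    rcases ih fun x hx => hF x (Finset.mem_insert_of_mem hx) with rfl | ih
    · exact hasAlternation_one hxI hyI hxy.ne hm
    · refine (ih (s' - ε) h6).snoc ?_ hxI hyI (fun z hz => ?_) hxy hm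
      · rintro z ⟨hz, hz'⟩
        refine ⟨hz, ?_⟩
        have := hx.1; have := hxI.2
        simp only [mem_Iio] at *
        linarith
      · exact lt_trans hz.2 hx.1

/-- The change is placed at the infimum `s` of the points after `t` where m < 0, and its zero
interval starts at the supremum `s'` of the points of [t, s] where m ≠ 0; s' = s is possible. -/
lemma exists_isSimpleChange_of_pos_of_neg {t t' : ℝ} (hm : ContinuousOn m (Icc T₁ T₂))
    (hmult : ¬ ∃ s, IsMultipleChange m T₁ T₂ s) (ht : t ∈ Icc T₁ T₂) (ht' : t' ∈ Icc T₁ T₂)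
    (hlt : t < t') (hpos : 0 < m t) (hneg : m t' < 0) :
    ∃ s ∈ Ioo t t', IsSimpleChange m T₁ T₂ s := by
  have hsub : Icc t t' ⊆ Icc T₁ T₂ := Icc_subset_Icc ht.1 ht'.2
  set A := {x ∈ Icc t t' | m x < 0}
  have hAne : A.Nonempty := ⟨t', right_mem_Icc.2 hlt.le, hneg⟩
  have hAb : BddBelow A := ⟨t, fun x hx => hx.1.1⟩
  set s := sInf A
  have hsI : s ∈ Icc t t' := ⟨le_csInf hAne fun x hx => hx.1.1,
    csInf_le hAb ⟨right_mem_Icc.2 hlt.le, hneg⟩⟩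
  have hA0 : ∀ x ∈ Ico t s, 0 ≤ m x := by
    intro x hx
    by_contra! h
    exact absurd (csInf_le hAb ⟨⟨hx.1, hx.2.le.trans hsI.2⟩, h⟩) (not_le.2 hx.2)
  have hms : m s ≤ 0 := by
    have hcl : s ∈ closure A := csInf_mem_closure hAne hAb
    have hc : ContinuousWithinAt m A s := (hm s (hsub hsI)).mono fun x hx => hsub hx.1
    have := hc.mem_closure_image hcl
    have h2 : m '' A ⊆ Iic 0 := by rintro _ ⟨x, hx, rfl⟩; exact hx.2.le
    exact closure_minimal h2 isClosed_Iic this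
  have hts : t < s := lt_of_le_of_ne hsI.1 fun h => by rw [← h] at hms; linarith
  have hms0 : m s = 0 := by
    refine le_antisymm hms ?_
    have hc : ContinuousWithinAt m (Ico t s) s :=
      (hm s (hsub hsI)).mono fun x hx => hsub ⟨hx.1, hx.2.le.trans hsI.2⟩
    have hcl : s ∈ closure (Ico t s) := by rw [closure_Ico hts.ne]; exact right_mem_Icc.2 hts.le
    have h2 : m '' Ico t s ⊆ Ici 0 := by rintro _ ⟨x, hx, rfl⟩; exact hA0 x hx
    exact closure_minimal h2 isClosed_Ici (hc.mem_closure_image hcl)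
  have hst' : s < t' := lt_of_le_of_ne hsI.2 fun h => by rw [h] at hms0; linarith
  have hright : ∀ ε > 0, ∃ x ∈ Ioo s (s + ε), x ∈ Icc T₁ T₂ ∧ m x < 0 := by
    intro ε hε
    obtain ⟨x, hx, hxs⟩ := exists_lt_of_csInf_lt hAne (show sInf A < s + ε by linarith)
    refine ⟨x, ⟨lt_of_le_of_ne (csInf_le hAb hx) fun h => ?_, hxs⟩, hsub hx.1, hx.2⟩
    have := hx.2
    rw [← h, hms0] at this
    exact lt_irrefl _ this
  -- Negative values accumulate at `s` from the right; if positive ones did too, `s` would be a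
  -- multiple point.
  obtain ⟨ε₁, hε₁, hno⟩ : ∃ ε > 0, ∀ x ∈ Ioo s (s + ε) ∩ Icc T₁ T₂, m x ≤ 0 := by
    by_contra! hcon
    refine hmult ⟨s, hsub hsI, Or.inr ⟨hst'.trans_le ht'.2, fun ε hε => ⟨hcon ε hε, ?_⟩⟩⟩
    obtain ⟨x, hx, hxI, hmx⟩ := hright ε hε
    exact ⟨x, ⟨hx, hxI⟩, hmx⟩
  set B := {x ∈ Icc t s | m x ≠ 0}
  have hBne : B.Nonempty := ⟨t, left_mem_Icc.2 hts.le, hpos.ne'⟩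
  have hBb : BddAbove B := ⟨s, fun x hx => hx.1.2⟩
  set s' := sSup B
  have hs'I : s' ∈ Icc t s := ⟨le_csSup hBb ⟨left_mem_Icc.2 hts.le, hpos.ne'⟩,
    csSup_le hBne fun x hx => hx.1.2⟩
  have hB0 : ∀ x ∈ Ioc s' s, m x = 0 := by
    intro x hx
    by_contra h
    exact absurd (le_csSup hBb ⟨⟨hs'I.1.trans hx.1.le, hx.2⟩, h⟩) (not_le.2 hx.1)
  have hms' : m s' = 0 := by
    rcases eq_or_lt_of_le hs'I.2 with h | h
    · rw [h, hms0]
    · have hc : ContinuousWithinAt m (Ioc s' s) s' :=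
        (hm s' (hsub ⟨hs'I.1, hs'I.2.trans hsI.2⟩)).mono
          fun x hx => hsub ⟨hs'I.1.trans hx.1.le, hx.2.trans hsI.2⟩
      have hcl : s' ∈ closure (Ioc s' s) := by rw [closure_Ioc h.ne]; exact left_mem_Icc.2 h.le
      have h2 : m '' Ioc s' s ⊆ {0} := by rintro _ ⟨x, hx, rfl⟩; exact hB0 x hx
      exact closure_minimal h2 isClosed_singleton (hc.mem_closure_image hcl)
  have hts' : t < s' := lt_of_le_of_ne hs'I.1 fun h => by rw [← h] at hms'; linarith
  -- The bound for ε keeps the left interval inside [t, s], where m ≥ 0, and the right one inside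
  -- both the range of `hno` and [T₁, T₂].
  refine ⟨s, ⟨hts, hst'⟩, ⟨ht.1.trans_lt hts, hst'.trans_le ht'.2⟩, s',
    min (s' - t) (min ε₁ (T₂ - s)), ht.1.trans_lt hts', hs'I.2,
    lt_min (sub_pos.2 hts') (lt_min hε₁ (sub_pos.2 (hst'.trans_le ht'.2))), ?_, Or.inr ?_⟩
  · intro x hx
    rcases eq_or_lt_of_le hx.1 with rfl | h
    · exact hms'
    · exact hB0 x ⟨h, hx.2⟩
  · intro ε hε0 hε
    obtain ⟨hε1, hε2⟩ := lt_min_iff.1 hε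
    obtain ⟨hε2, hε3⟩ := lt_min_iff.1 hε2
    refine ⟨⟨fun x hx => hA0 x ⟨by linarith [hx.1], hx.2.trans_le hs'I.2⟩, ?_⟩,
      ⟨fun x hx => hno x ⟨⟨hx.1, by linarith [hx.2]⟩, ?_⟩, ?_⟩⟩
    · obtain ⟨x, hx, hxs⟩ := exists_lt_of_lt_csSup hBne (show s' - ε < sSup B by linarith)
      refine ⟨x, ⟨hxs, lt_of_le_of_ne (le_csSup hBb hx) fun h => ?_⟩, hx.2⟩
      have := hx.2
      rw [h] at this
      exact this hms'
    · exact ⟨by linarith [hx.1, ht.1], by linarith [hx.2]⟩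
    · obtain ⟨x, hx, -, hmx⟩ := hright ε hε0
      exact ⟨x, hx, hmx.ne⟩

lemma isSimpleChange_neg : IsSimpleChange (fun t => -m t) T₁ T₂ s ↔ IsSimpleChange m T₁ T₂ s := by
  simp only [IsSimpleChange, NonposNotZeroOn, NonnegNotZeroOn, neg_eq_zero, Left.neg_nonpos_iff,
    Left.nonneg_neg_iff, ne_eq]
  refine and_congr_right fun _ => exists_congr fun s' => exists_congr fun ε₀ => ?_
  rw [or_comm]

lemma isMultipleChange_neg :
    IsMultipleChange (fun t => -m t) T₁ T₂ s ↔ IsMultipleChange m T₁ T₂ s := by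
  have h : ∀ S, BothSignsOn (fun t => -m t) S ↔ BothSignsOn m S := fun S => by
    simp only [BothSignsOn, Left.neg_pos_iff, Left.neg_neg_iff]
    exact and_comm
  simp only [IsMultipleChange, h]

lemma exists_isSimpleChange {t t' : ℝ} (hm : ContinuousOn m (Icc T₁ T₂))
    (hmult : ¬ ∃ s, IsMultipleChange m T₁ T₂ s) (ht : t ∈ Icc T₁ T₂) (ht' : t' ∈ Icc T₁ T₂)
    (hlt : t < t') (hopp : m t * m t' < 0) : ∃ s ∈ Ioo t t', IsSimpleChange m T₁ T₂ s := by
  rcases mul_neg_iff.1 hopp with ⟨h1, h2⟩ | ⟨h1, h2⟩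
  · exact exists_isSimpleChange_of_pos_of_neg hm hmult ht ht' hlt h1 h2
  · obtain ⟨s, hs, hsc⟩ := exists_isSimpleChange_of_pos_of_neg (m := fun t => -m t) hm.neg
      (by simpa only [isMultipleChange_neg] using hmult) ht ht' hlt
      (neg_pos.2 h1) (neg_neg_of_pos h2)
    exact ⟨s, hs, isSimpleChange_neg.1 hsc⟩

lemma Alternates.le_encard (hm : ContinuousOn m (Icc T₁ T₂))
    (hmult : ¬ ∃ s, IsMultipleChange m T₁ T₂ s) (h : Alternates m (Icc T₁ T₂) k) :
    (k : ℕ∞) ≤ {s | IsSimpleChange m T₁ T₂ s}.encard := by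
  obtain ⟨t, hlt, ht⟩ := h
  have hex : ∀ j, ∃ s, j < k → s ∈ Ioo (t j) (t (j + 1)) ∧ IsSimpleChange m T₁ T₂ s := by
    intro j
    by_cases hj : j < k
    · have h1 := ht j hj.le
      have h2 := ht (j + 1) hj
      have hopp : m (t j) * m (t (j + 1)) < 0 := by
        have h3 : (-1 : ℝ) ^ j * (-1) ^ j = 1 := by rw [← mul_pow]; simp
        have h4 := mul_pos h1.2 h2.2
        rw [pow_succ] at h4
        nlinarith
      obtain ⟨s, hs, hsc⟩ := exists_isSimpleChange hm hmult h1.1 h2.1 (hlt j hj) hopp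
      exact ⟨s, fun _ => ⟨hs, hsc⟩⟩
    · exact ⟨0, fun h => absurd h hj⟩
  choose s hs using hex
  have hle : ∀ i j, i ≤ j → j ≤ k → t i ≤ t j := by
    intro i j hij
    induction j, hij using Nat.le_induction with
    | base => exact fun _ => le_rfl
    | succ j hj ih => exact fun h => (ih (by omega)).trans (hlt j (by omega)).le
  have hmono : ∀ i j, i < j → j < k → s i < s j := fun i j hij hj =>
    ((hs i (by omega)).1.2.trans_le (hle (i + 1) j hij hj.le)).trans (hs j hj).1.1
  have hinj : InjOn s (Finset.range k) := by
    intro i hi j hj hij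
    rw [Finset.mem_coe, Finset.mem_range] at hi hj
    rcases lt_trichotomy i j with h | h | h
    · exact absurd hij (hmono i j h hj).ne
    · exact h
    · exact absurd hij.symm (hmono j i h hi).ne
  calc (k : ℕ∞) = (s '' (Finset.range k : Set ℕ)).encard := by
        rw [hinj.encard_image, encard_coe_eq_coe_finsetCard, Finset.card_range]
    _ ≤ _ := encard_le_encard (by
        rintro _ ⟨j, hj, rfl⟩
        exact (hs j (Finset.mem_range.1 hj)).2)

/-- The number of sign changes is the maximal number of alternations. -/
theorem hasAlternation_iff (hm : ContinuousOn m (Icc T₁ T₂)) (hk : 1 ≤ k) :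
    HasAlternation m (Icc T₁ T₂) k ↔ (k : ℕ∞) ≤ numSignChanges m T₁ T₂ := by
  unfold numSignChanges
  split_ifs with hmult
  · obtain ⟨s, hs⟩ := hmult
    exact ⟨fun _ => le_top, fun _ => Or.inl (hs.alternates k)⟩
  · constructor
    · rintro (h | h)
      · exact h.le_encard hm hmult
      · have := h.le_encard (m := fun t => -m t) hm.neg (by simpa only [isMultipleChange_neg] using hmult)
        simpa only [isSimpleChange_neg] using this
    · intro h
      obtain ⟨F, hF, hcard⟩ := exists_subset_encard_eq h
      have hfin : F.Finite := finite_of_encard_eq_coe hcard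
      lift F to Finset ℝ using hfin
      rw [encard_coe_eq_coe_finsetCard, Nat.cast_inj] at hcard
      rcases hasAlternation_of_finset F fun x hx => hF hx with rfl | h2
      · simp at hcard; omega
      · rw [hcard] at h2
        have := h2 (T₂ + 1) fun x hx => by
          have : IsSimpleChange m T₁ T₂ x := hF hx
          linarith [this.1.2]
        rcases this with h | h
        · exact Or.inl (h.mono inter_subset_left)
        · exact Or.inr (h.mono inter_subset_left)

end Fucik

/-! ### Classical solutions expressed through the rotation -/

namespace Fucik

lemma isSolution_of_hasDerivAt {p q m : ℝ → ℝ} {T₁ T₂ a b : ℝ} {u v : ℝ → ℝ} (hT : T₁ < T₂)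
    (hpc : Continuous p) (hp : ∀ t, 0 < p t)
    (hu : ∀ t ∈ Icc T₁ T₂, HasDerivAt u (v t * (p t)⁻¹) t)
    (hv : ∀ t ∈ Icc T₁ T₂,
      HasDerivAt v (q t * u t - m t * (a * max (u t) 0 - b * max (-u t) 0)) t)
    (h1 : v T₁ = 0) (h2 : v T₂ = 0) : IsSolution p q m T₁ T₂ a b u := by
  have hud := uniqueDiffOn_Icc hT
  have hd : ∀ t ∈ Icc T₁ T₂, derivWithin u (Icc T₁ T₂) t = v t * (p t)⁻¹ := fun t ht =>
    (hu t ht).hasDerivWithinAt.derivWithin (hud t ht)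
  have hvc : ContinuousOn v (Icc T₁ T₂) := fun t ht => (hv t ht).continuousAt.continuousWithinAt
  refine ⟨?_, fun t ht => ?_, ?_, ?_⟩
  · rw [show (1 : WithTop ℕ∞) = 0 + 1 by simp, contDiffOn_succ_iff_derivWithin hud]
    refine ⟨fun t ht => (hu t ht).differentiableAt.differentiableWithinAt, by simp,
      contDiffOn_zero.2 ?_⟩
    exact (hvc.mul (hpc.continuousOn.inv₀ fun t _ => (hp t).ne')).congr hd
  · refine (hv t (Ioo_subset_Icc_self ht)).congr_of_eventuallyEq ?_
    filter_upwards [Ioo_mem_nhds ht.1 ht.2] with s hs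
    rw [hd s (Ioo_subset_Icc_self hs)]
    have := (hp s).ne'
    field_simp
  · rw [hd _ (left_mem_Icc.2 hT.le), h1, zero_mul]
  · rw [hd _ (right_mem_Icc.2 hT.le), h2, zero_mul]

lemma IsSolution.congr {p q m p' q' m' : ℝ → ℝ} {T₁ T₂ a b : ℝ} {u : ℝ → ℝ}
    (hp : EqOn p p' (Icc T₁ T₂)) (hq : EqOn q q' (Icc T₁ T₂)) (hm : EqOn m m' (Icc T₁ T₂))
    (h : IsSolution p q m T₁ T₂ a b u) : IsSolution p' q' m' T₁ T₂ a b u := by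
  refine ⟨h.contDiffOn, fun t ht => ?_, h.left, h.right⟩
  have htI := Ioo_subset_Icc_self ht
  rw [← hq htI, ← hm htI]
  refine (h.eqn t ht).congr_of_eventuallyEq ?_
  filter_upwards [Ioo_mem_nhds ht.1 ht.2] with s hs
  rw [hp (Ioo_subset_Icc_self hs)]

lemma piece_congr {p q m p' q' m' : ℝ → ℝ} {T₁ T₂ : ℝ}
    (hp : EqOn p p' (Icc T₁ T₂)) (hq : EqOn q q' (Icc T₁ T₂)) (hm : EqOn m m' (Icc T₁ T₂))
    (k : ℕ) (s : Bool) : piece p q m T₁ T₂ k s = piece p' q' m' T₁ T₂ k s := by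
  cases s <;>
  · ext x
    constructor <;> rintro ⟨u, hu, h⟩
    · exact ⟨u, hu.congr hp hq hm, h⟩
    · exact ⟨u, hu.congr hp.symm hq.symm hm.symm, h⟩

/-- Composing with the projection onto the interval extends the coefficients by constants; by
`piece_congr` the spectrum does not notice. -/
lemma exists_coeffs {T₁ T₂ : ℝ} (hT : T₁ < T₂) {p q m : ℝ → ℝ}
    (hpc : ContinuousOn p (Icc T₁ T₂)) (hqc : ContinuousOn q (Icc T₁ T₂))
    (hmc : ContinuousOn m (Icc T₁ T₂))
    (hp : ∀ t ∈ Icc T₁ T₂, 0 < p t) (hq : ∀ t ∈ Icc T₁ T₂, 0 ≤ q t) :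
    ∃ C : Coeffs, C.T₁ = T₁ ∧ C.T₂ = T₂ ∧ EqOn p C.p (Icc T₁ T₂) ∧ EqOn q C.q (Icc T₁ T₂) ∧
      EqOn m C.m (Icc T₁ T₂) := by
  obtain ⟨M₁, h1⟩ := isCompact_Icc.exists_bound_of_continuousOn hpc
  obtain ⟨M₂, h2⟩ := isCompact_Icc.exists_bound_of_continuousOn hqc
  obtain ⟨M₃, h3⟩ := isCompact_Icc.exists_bound_of_continuousOn hmc
  obtain ⟨M₄, h4⟩ := isCompact_Icc.exists_bound_of_continuousOn
    (hpc.inv₀ fun t ht => (hp t ht).ne')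
  set M := max 1 (max (max M₁ M₂) (max M₃ M₄))
  have e1 : M₁ ≤ M := ((le_max_left _ _).trans (le_max_left _ _)).trans (le_max_right _ _)
  have e2 : M₂ ≤ M := ((le_max_right _ _).trans (le_max_left _ _)).trans (le_max_right _ _)
  have e3 : M₃ ≤ M := ((le_max_left _ _).trans (le_max_right _ _)).trans (le_max_right _ _)
  have e4 : M₄ ≤ M := ((le_max_right _ _).trans (le_max_right _ _)).trans (le_max_right _ _)
  set π : ℝ → ℝ := fun t => projIcc T₁ T₂ hT.le t
  have hπ : ∀ t, π t ∈ Icc T₁ T₂ := fun t => (projIcc T₁ T₂ hT.le t).2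
  have hπc : Continuous π := continuous_subtype_val.comp continuous_projIcc
  have hext : ∀ {f : ℝ → ℝ}, ContinuousOn f (Icc T₁ T₂) → Continuous fun t => f (π t) :=
    fun hf => hf.comp_continuous hπc hπ
  have heq : ∀ f : ℝ → ℝ, EqOn f (fun t => f (π t)) (Icc T₁ T₂) := fun f t ht => by
    change f t = f (projIcc T₁ T₂ hT.le t)
    rw [projIcc_of_mem _ ht]
  exact ⟨{ T₁ := T₁, T₂ := T₂, M := M
           p := fun t => p (π t), q := fun t => q (π t), m := fun t => m (π t)
           lt := hT, hp := hext hpc, hq := hext hqc, hm := hext hmc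
           p_pos := fun t => hp _ (hπ t)
           q_nonneg := fun t => hq _ (hπ t)
           one_le := le_max_left _ _
           p_le := fun t => ((le_abs_self _).trans (h1 _ (hπ t))).trans e1
           inv_le := fun t => ((le_abs_self _).trans (h4 _ (hπ t))).trans e4
           q_le := fun t => ((le_abs_self _).trans (h2 _ (hπ t))).trans e2
           m_le := fun t => (h3 _ (hπ t)).trans e3 }, rfl, rfl, heq p, heq q, heq m⟩

namespace Coeffs

variable (C : Coeffs)

/-- Uniqueness for the initial value problem. -/
lemma eqOn_of_initial {a b : ℝ} {u₁ v₁ u₂ v₂ : ℝ → ℝ}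
    (hu₁ : ContinuousOn u₁ (Icc C.T₁ C.T₂)) (hv₁ : ContinuousOn v₁ (Icc C.T₁ C.T₂))
    (hu₂ : ContinuousOn u₂ (Icc C.T₁ C.T₂)) (hv₂ : ContinuousOn v₂ (Icc C.T₁ C.T₂))
    (du₁ : ∀ t ∈ Ioo C.T₁ C.T₂, HasDerivAt u₁ (v₁ t * (C.p t)⁻¹) t)
    (du₂ : ∀ t ∈ Ioo C.T₁ C.T₂, HasDerivAt u₂ (v₂ t * (C.p t)⁻¹) t)
    (dv₁ : ∀ t ∈ Ioo C.T₁ C.T₂, HasDerivAt v₁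
      (C.q t * u₁ t - C.m t * (a * max (u₁ t) 0 - b * max (-u₁ t) 0)) t)
    (dv₂ : ∀ t ∈ Ioo C.T₁ C.T₂, HasDerivAt v₂
      (C.q t * u₂ t - C.m t * (a * max (u₂ t) 0 - b * max (-u₂ t) 0)) t)
    (hu0 : u₁ C.T₁ = u₂ C.T₁) (hv0 : v₁ C.T₁ = v₂ C.T₁) :
    EqOn u₁ u₂ (Icc C.T₁ C.T₂) ∧ EqOn v₁ v₂ (Icc C.T₁ C.T₂) := by
  have hM := C.M_pos
  -- 2M bounds 1/p + q and M(|a| + |b|) is a Lipschitz constant of the nonlinear term; with this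
  -- rate, e^(-Kt) times the squared distance of the two solutions is nonincreasing.
  set K := C.M * (2 + |a| + |b|) with hK
  set D : ℝ → ℝ := fun t => (u₁ t - u₂ t) ^ 2 + (v₁ t - v₂ t) ^ 2
  set F : ℝ → ℝ := fun t => Real.exp (-K * t) * D t
  have hFc : ContinuousOn F (Icc C.T₁ C.T₂) := by
    have : Continuous fun t => Real.exp (-K * t) := by fun_prop
    exact this.continuousOn.mul (((hu₁.sub hu₂).pow 2).add ((hv₁.sub hv₂).pow 2))
  have hFd : ∀ t ∈ Ioo C.T₁ C.T₂, ∃ d, d ≤ 0 ∧ HasDerivAt F d t := by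
    intro t ht
    have h1 := ((du₁ t ht).sub (du₂ t ht)).pow 2
    have h2 := ((dv₁ t ht).sub (dv₂ t ht)).pow 2
    have h3 : HasDerivAt (fun t => Real.exp (-K * t)) (Real.exp (-K * t) * (-K * 1)) t :=
      ((hasDerivAt_id t).const_mul (-K)).exp
    refine ⟨_, ?_, h3.mul (h1.add h2)⟩
    simp only [Pi.sub_apply]
    set x := u₁ t - u₂ t with hx
    set y := v₁ t - v₂ t with hy
    set P := (C.p t)⁻¹
    set N := (a * max (u₁ t) 0 - b * max (-u₁ t) 0) - (a * max (u₂ t) 0 - b * max (-u₂ t) 0)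
      with hN
    have hNle : |N| ≤ (|a| + |b|) * |x| := by
      have e1 : |max (u₁ t) 0 - max (u₂ t) 0| ≤ |x| := abs_max_zero_sub_le _ _
      have e2 : |max (-u₁ t) 0 - max (-u₂ t) 0| ≤ |x| := by
        refine (abs_max_zero_sub_le _ _).trans ?_
        rw [neg_sub_neg, abs_sub_comm]
      have e3 : N = a * (max (u₁ t) 0 - max (u₂ t) 0) - b * (max (-u₁ t) 0 - max (-u₂ t) 0) := by
        rw [hN]; ring
      rw [e3, add_mul]
      refine (abs_sub _ _).trans (add_le_add ?_ ?_)
      · rw [abs_mul]; exact mul_le_mul_of_nonneg_left e1 (abs_nonneg _)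
      · rw [abs_mul]; exact mul_le_mul_of_nonneg_left e2 (abs_nonneg _)
    have hW : |P + C.q t| ≤ 2 * C.M := by
      rw [abs_of_nonneg (add_nonneg (C.inv_pos t).le (C.q_nonneg t))]
      linarith [C.inv_le t, C.q_le t]
    have hmN : |C.m t * N| ≤ C.M * ((|a| + |b|) * |x|) := by
      rw [abs_mul]; exact mul_le_mul (C.m_le t) hNle (abs_nonneg _) hM.le
    have hxy : |x| * |y| * 2 ≤ x ^ 2 + y ^ 2 := by
      nlinarith [sq_nonneg (|x| - |y|), sq_abs x, sq_abs y]
    have hle : (P + C.q t) * x * y - C.m t * N * y ≤ K * (|x| * |y|) := by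
      have f1 : (P + C.q t) * x * y ≤ 2 * C.M * (|x| * |y|) := by
        refine (le_abs_self _).trans ?_
        rw [mul_assoc, abs_mul, abs_mul]
        exact mul_le_mul_of_nonneg_right hW (by positivity)
      have f2 : -(C.m t * N * y) ≤ C.M * ((|a| + |b|) * |x|) * |y| := by
        refine (neg_le_abs _).trans ?_
        rw [abs_mul]
        exact mul_le_mul_of_nonneg_right hmN (abs_nonneg _)
      rw [hK]; linarith
    have hfin : 2 * ((P + C.q t) * x * y - C.m t * N * y) - K * (x ^ 2 + y ^ 2) ≤ 0 := by
      have : 0 ≤ K := by positivity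
      nlinarith
    have hexp := (Real.exp_pos (-K * t)).le
    have := mul_nonpos_of_nonneg_of_nonpos hexp hfin
    refine le_of_eq_of_le ?_ this
    rw [hx, hy, hN]
    push_cast
    ring
  have hanti : AntitoneOn F (Icc C.T₁ C.T₂) := by
    refine antitoneOn_of_deriv_nonpos (convex_Icc _ _) hFc (fun t ht => ?_) (fun t ht => ?_)
    · rw [interior_Icc] at ht
      obtain ⟨d, -, h⟩ := hFd t ht
      exact h.differentiableAt.differentiableWithinAt
    · rw [interior_Icc] at ht
      obtain ⟨d, h0, h⟩ := hFd t ht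
      rw [h.deriv]; exact h0
  have hD : ∀ t ∈ Icc C.T₁ C.T₂, D t = 0 := by
    intro t ht
    have h1 := hanti C.left_mem ht ht.1
    have h2 : F C.T₁ = 0 := by simp [F, D, hu0, hv0]
    rw [h2] at h1
    have h3 := Real.exp_pos (-K * t)
    have h4 : 0 ≤ D t := by positivity
    by_contra hne
    have : 0 < F t := mul_pos h3 (lt_of_le_of_ne h4 (Ne.symm hne))
    linarith
  constructor <;> intro t ht <;> have h := hD t ht <;> simp only [D] at h <;>
    nlinarith [sq_nonneg (u₁ t - u₂ t), sq_nonneg (v₁ t - v₂ t)]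

variable {a b : ℝ} {u : ℝ → ℝ}

/-- A solution is a multiple of one of the two normalized solutions. -/
lemma exists_eqOn_sol (hu : IsSolution C.p C.q C.m C.T₁ C.T₂ a b u) :
    ∃ c : ℝ, ∃ x : ℝ × ℝ, ((0 ≤ c ∧ x = (a, b)) ∨ (c ≤ 0 ∧ x = (b, a))) ∧
      EqOn u (fun t => c * C.sol x t) (Icc C.T₁ C.T₂) ∧ c * C.flux x C.T₂ = 0 := by
  have hT := C.lt
  have hud := uniqueDiffOn_Icc hT
  set v : ℝ → ℝ := fun t => C.p t * derivWithin u (Icc C.T₁ C.T₂) t with hv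
  have huc := hu.contDiffOn.continuousOn
  have hvc : ContinuousOn v (Icc C.T₁ C.T₂) :=
    C.hp.continuousOn.mul (hu.contDiffOn.continuousOn_derivWithin hud le_rfl)
  have hdu : ∀ t ∈ Ioo C.T₁ C.T₂, HasDerivAt u (v t * (C.p t)⁻¹) t := by
    intro t ht
    have h1 := ((hu.contDiffOn.differentiableOn one_ne_zero t
      (Ioo_subset_Icc_self ht)).hasDerivWithinAt).hasDerivAt (Icc_mem_nhds ht.1 ht.2)
    refine h1.congr_deriv ?_
    have := (C.p_pos t).ne'
    simp only [hv]
    field_simp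
  have hend : ∀ {c : ℝ} {x : ℝ × ℝ},
      EqOn v (fun t => c * C.flux x t) (Icc C.T₁ C.T₂) → c * C.flux x C.T₂ = 0 := by
    intro c x h
    have h1 : v C.T₂ = c * C.flux x C.T₂ := h C.right_mem
    rw [← h1]
    simp [hv, hu.right]
  have hvl : v C.T₁ = 0 := by simp [hv, hu.left]
  set c := u C.T₁
  rcases le_total 0 c with hc | hc
  · obtain ⟨e1, e2⟩ := C.eqOn_of_initial (a := a) (b := b) (u₁ := u) (v₁ := v)
      (u₂ := fun t => c * C.sol (a, b) t) (v₂ := fun t => c * C.flux (a, b) t) huc hvc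
      ((C.continuousOn_sol _).const_smul c) ((C.continuousOn_flux _).const_smul c) hdu
      (fun t ht => ((C.hasDerivAt_sol _ (Ioo_subset_Icc_self ht)).const_mul c).congr_deriv
        (by ring)) hu.eqn
      (fun t ht => ((C.hasDerivAt_flux _ (Ioo_subset_Icc_self ht)).const_mul c).congr_deriv (by
        have m1 : max (c * C.sol (a, b) t) 0 = c * max (C.sol (a, b) t) 0 := by
          rw [mul_max_of_nonneg _ _ hc, mul_zero]
        have m2 : max (-(c * C.sol (a, b) t)) 0 = c * max (-C.sol (a, b) t) 0 := by
          rw [mul_max_of_nonneg _ _ hc, mul_zero, mul_neg]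
        rw [m1, m2]; ring))
      (by rw [sol_left, mul_one]) (by rw [flux_left, mul_zero]; exact hvl)
    exact ⟨c, (a, b), Or.inl ⟨hc, rfl⟩, e1, hend e2⟩
  -- A negative factor exchanges positive and negative parts, hence the two parameters.
  · obtain ⟨e1, e2⟩ := C.eqOn_of_initial (a := a) (b := b) (u₁ := u) (v₁ := v)
      (u₂ := fun t => c * C.sol (b, a) t) (v₂ := fun t => c * C.flux (b, a) t) huc hvc
      ((C.continuousOn_sol _).const_smul c) ((C.continuousOn_flux _).const_smul c) hdu
      (fun t ht => ((C.hasDerivAt_sol _ (Ioo_subset_Icc_self ht)).const_mul c).congr_deriv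
        (by ring)) hu.eqn
      (fun t ht => ((C.hasDerivAt_flux _ (Ioo_subset_Icc_self ht)).const_mul c).congr_deriv (by
        have m1 : max (c * C.sol (b, a) t) 0 = -c * max (-C.sol (b, a) t) 0 := by
          rw [mul_max_of_nonneg _ _ (neg_nonneg.2 hc), mul_zero, neg_mul_neg]
        have m2 : max (-(c * C.sol (b, a) t)) 0 = -c * max (C.sol (b, a) t) 0 := by
          rw [mul_max_of_nonneg _ _ (neg_nonneg.2 hc), mul_zero, neg_mul]
        rw [m1, m2]; ring))
      (by rw [sol_left, mul_one]) (by rw [flux_left, mul_zero]; exact hvl)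
    exact ⟨c, (b, a), Or.inr ⟨hc, rfl⟩, e1, hend e2⟩

lemma isSolution_sol {x : ℝ × ℝ} (h : C.flux x C.T₂ = 0) :
    IsSolution C.p C.q C.m C.T₁ C.T₂ x.1 x.2 (C.sol x) :=
  isSolution_of_hasDerivAt C.lt C.hp C.p_pos (fun _ ht => C.hasDerivAt_sol x ht)
    (fun _ ht => C.hasDerivAt_flux x ht) (C.flux_left x) h

lemma isSolution_neg_sol {x : ℝ × ℝ} (h : C.flux x C.T₂ = 0) :
    IsSolution C.p C.q C.m C.T₁ C.T₂ x.2 x.1 (fun t => -C.sol x t) :=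
  isSolution_of_hasDerivAt (v := fun t => -C.flux x t) C.lt C.hp C.p_pos
    (fun t ht => (C.hasDerivAt_sol x ht).neg.congr_deriv (by ring))
    (fun t ht => (C.hasDerivAt_flux x ht).neg.congr_deriv (by rw [neg_neg]; ring))
    (by rw [flux_left, neg_zero]) (by rw [h, neg_zero])

lemma encard_zeros {x : ℝ × ℝ} {k : ℕ} (hx : C.rot x = k * Real.pi) :
    {t ∈ Ioo C.T₁ C.T₂ | C.sol x t = 0}.encard = k := by
  obtain ⟨z, hz⟩ := C.exists_isNodal hx
  have hmono : ∀ i j, i < j → j ≤ k + 1 → z i < z j := by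
    intro i j hij
    induction j, hij using Nat.le_induction with
    | base => exact fun h => hz.lt i (by omega)
    | succ j hj ih => exact fun h => (ih (by omega)).trans (hz.lt j (by omega))
  have hinj : InjOn z (Finset.Icc 1 k) := by
    intro i hi j hj hij
    simp only [Finset.coe_Icc, mem_Icc] at hi hj
    rcases lt_trichotomy i j with h | h | h
    · exact absurd hij (hmono i j h (by omega)).ne
    · exact h
    · exact absurd hij.symm (hmono j i h (by omega)).ne
  have hfind : ∀ n ≤ k + 1, ∀ t ∈ Ico C.T₁ (z n), C.sol x t = 0 → ∃ i ∈ Finset.Icc 1 k, z i = t := by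
    intro n
    induction n with
    | zero => intro _ t ht; rw [hz.left] at ht; exact absurd ht.2 (not_lt.2 ht.1)
    | succ n ih =>
      intro hn t ht h0
      rcases lt_trichotomy t (z n) with h | h | h
      · exact ih (by omega) t ⟨ht.1, h⟩ h0
      · rcases Nat.eq_zero_or_pos n with rfl | hpos
        · rw [h, hz.left, sol_left] at h0; exact absurd h0 one_ne_zero
        · exact ⟨n, Finset.mem_Icc.2 ⟨hpos, by omega⟩, h.symm⟩
      · have := hz.sol_pos (n := n) (by omega) ⟨h, ht.2⟩
        rw [h0, mul_zero] at this
        exact absurd this (lt_irrefl _)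
  have heq : {t ∈ Ioo C.T₁ C.T₂ | C.sol x t = 0} = z '' (Finset.Icc 1 k : Finset ℕ) := by
    ext t
    constructor
    · rintro ⟨ht, h0⟩
      obtain ⟨i, hi, he⟩ := hfind (k + 1) le_rfl t ⟨ht.1.le, by rw [hz.right]; exact ht.2⟩ h0
      exact ⟨i, hi, he⟩
    · rintro ⟨i, hi, rfl⟩
      have hi' := Finset.mem_Icc.1 (Finset.mem_coe.1 hi)
      have h1 := hmono 0 i (by omega) (by omega)
      have h2 := hmono i (k + 1) (by omega) le_rfl
      rw [hz.left] at h1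
      rw [hz.right] at h2
      exact ⟨⟨h1, h2⟩, hz.sol_eq_zero hi'.1 hi'.2⟩
  rw [heq, hinj.encard_image, encard_coe_eq_coe_finsetCard, Nat.card_Icc, Nat.add_sub_cancel]

/-- The sine of the rotation vanishes, and negative multiples of π are excluded because the angle
stays above `level 0` = -π/2. -/
lemma exists_rot_eq_of_flux_eq_zero {x : ℝ × ℝ} (h : C.flux x C.T₂ = 0) :
    ∃ j : ℕ, C.rot x = j * Real.pi := by
  have h1 : Real.sin (C.rot x) = 0 := by
    have := (Real.exp_pos (C.logRad x C.T₂)).ne'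
    simpa [flux, this, rot] using h
  obtain ⟨n, hn⟩ := Real.sin_eq_zero_iff.1 h1
  have h2 : level 0 < C.rot x := C.level_zero_lt_angle x C.right_mem
  have hpi := Real.pi_pos
  have h3 : 0 ≤ n := by
    by_contra! hneg
    have : (n : ℝ) ≤ -1 := by exact_mod_cast Int.le_sub_one_of_lt hneg
    rw [← hn] at h2
    simp [level] at h2
    nlinarith
  obtain ⟨j, rfl⟩ := Int.eq_ofNat_of_zero_le h3
  exact ⟨j, by rw [← hn]; simp⟩

/-- The rotation and the sign at the right end of a solution with `k` zeros. -/
lemma rot_of_isSolution {k : ℕ} (hu : IsSolution C.p C.q C.m C.T₁ C.T₂ a b u)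
    (hk : {t ∈ Ioo C.T₁ C.T₂ | u t = 0}.encard = k) (hne : u C.T₂ ≠ 0) :
    (C.rot (a, b) = k * Real.pi ∧ 0 < (-1) ^ k * u C.T₂) ∨
      (C.rot (b, a) = k * Real.pi ∧ (-1) ^ k * u C.T₂ < 0) := by
  obtain ⟨c, x, hcx, heq, hf⟩ := C.exists_eqOn_sol hu
  have hc : c ≠ 0 := by
    rintro rfl
    exact hne (by rw [heq C.right_mem]; simp)
  obtain ⟨j, hj⟩ := C.exists_rot_eq_of_flux_eq_zero ((mul_eq_zero.1 hf).resolve_left hc)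
  have hset : {t ∈ Ioo C.T₁ C.T₂ | u t = 0} = {t ∈ Ioo C.T₁ C.T₂ | C.sol x t = 0} := by
    ext t
    refine and_congr_right fun ht => ?_
    rw [heq (Ioo_subset_Icc_self ht)]
    simp [hc]
  rw [hset, C.encard_zeros hj, Nat.cast_inj] at hk
  subst hk
  have hs := C.sol_right hj
  rw [heq C.right_mem]
  rcases hcx with ⟨h, rfl⟩ | ⟨h, rfl⟩
  · have : 0 < c := lt_of_le_of_ne h hc.symm
    exact Or.inl ⟨hj, by nlinarith [mul_pos this hs]⟩
  · have : c < 0 := lt_of_le_of_ne h hc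
    exact Or.inr ⟨hj, by nlinarith [mul_neg_of_neg_of_pos this hs]⟩

/-- The pieces of the spectrum in terms of the rotation. -/
lemma piece_eq (k : ℕ) (s : Bool) : piece C.p C.q C.m C.T₁ C.T₂ k s =
    {x | C.rot (if (Even k ↔ s = true) then x else x.swap) = k * Real.pi} := by
  ext x
  -- The sign at T₂ is (-1)^k times the sign at T₁, so `Even k ↔ s = true` says that the solution
  -- starts positive; otherwise it is a negative multiple of `sol` at the swapped parameters.
  have hfwd : ∀ {y : ℝ × ℝ}, C.rot y = k * Real.pi →
      IsSolution C.p C.q C.m C.T₁ C.T₂ y.1 y.2 (C.sol y) ∧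
      IsSolution C.p C.q C.m C.T₁ C.T₂ y.2 y.1 (fun t => -C.sol y t) ∧
      {t ∈ Ioo C.T₁ C.T₂ | C.sol y t = 0}.encard = k ∧
      {t ∈ Ioo C.T₁ C.T₂ | -C.sol y t = 0}.encard = k ∧ 0 < (-1) ^ k * C.sol y C.T₂ := by
    intro y hy
    have h := C.flux_right hy
    exact ⟨C.isSolution_sol h, C.isSolution_neg_sol h, C.encard_zeros hy,
      by simpa using C.encard_zeros hy, C.sol_right hy⟩
  cases s with
  | true =>
    simp only [piece, iff_true, mem_ofPred_eq]
    constructor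
    · rintro ⟨u, hu, hk, hpos⟩
      rcases Nat.even_or_odd k with h | h
      · rcases C.rot_of_isSolution hu hk hpos.ne' with ⟨h1, -⟩ | ⟨-, h2⟩
        · simpa [h] using h1
        · rw [h.neg_one_pow] at h2; linarith
      · rcases C.rot_of_isSolution hu hk hpos.ne' with ⟨-, h2⟩ | ⟨h1, -⟩
        · rw [h.neg_one_pow] at h2; linarith
        · rw [if_neg (Nat.not_even_iff_odd.2 h)]; exact h1
    · intro h
      split_ifs at h with he
      · obtain ⟨h1, -, h3, -, h5⟩ := hfwd h
        rw [he.neg_one_pow, one_mul] at h5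
        exact ⟨_, h1, h3, h5⟩
      · obtain ⟨-, h2, -, h4, h5⟩ := hfwd h
        rw [(Nat.not_even_iff_odd.1 he).neg_one_pow, neg_one_mul] at h5
        exact ⟨_, h2, h4, h5⟩
  | false =>
    simp only [piece, Bool.false_eq_true, iff_false, mem_ofPred_eq]
    constructor
    · rintro ⟨u, hu, hk, hneg⟩
      rcases Nat.even_or_odd k with h | h
      · rcases C.rot_of_isSolution hu hk hneg.ne with ⟨-, h2⟩ | ⟨h1, -⟩
        · rw [h.neg_one_pow] at h2; linarith
        · rw [if_neg (not_not.2 h)]; exact h1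
      · rcases C.rot_of_isSolution hu hk hneg.ne with ⟨h1, -⟩ | ⟨-, h2⟩
        · rw [if_pos (Nat.not_even_iff_odd.2 h)]; exact h1
        · rw [h.neg_one_pow] at h2; linarith
    · intro h
      rcases Nat.even_or_odd k with he | he
      · rw [if_neg (not_not.2 he)] at h
        obtain ⟨-, h2, -, h4, h5⟩ := hfwd h
        rw [he.neg_one_pow, one_mul] at h5
        exact ⟨_, h2, h4, neg_neg_of_pos h5⟩
      · rw [if_pos (Nat.not_even_iff_odd.2 he)] at h
        obtain ⟨h1, -, h3, -, h5⟩ := hfwd h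
        rw [he.neg_one_pow, neg_one_mul, neg_pos] at h5
        exact ⟨_, h1, h3, h5⟩

/-- The curve carrying the piece with label `(k, s)` in the quadrant `ℝ₊ × ℝ₋`. -/
def labelCurve (k : ℕ) (s : Bool) : Set (ℝ × ℝ) :=
  {x | (Even k ↔ s = true) ∧ x ∈ C.curve k ∨ ¬(Even k ↔ s = true) ∧ x.swap ∈ C.neg.curve k}

lemma labelCurve_of_iff {k : ℕ} {s : Bool} (h : Even k ↔ s = true) :
    C.labelCurve k s = C.curve k := by
  ext x; simp [labelCurve, h]

lemma labelCurve_of_not_iff {k : ℕ} {s : Bool} (h : ¬(Even k ↔ s = true)) :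
    C.labelCurve k s = Prod.swap ⁻¹' C.neg.curve k := by
  ext x
  simp only [labelCurve, mem_ofPred_eq, h, false_and, false_or, not_false_eq_true, true_and,
    mem_preimage]

lemma isCurve_labelCurve {k : ℕ} (hk : 1 ≤ k) (s : Bool) : IsCurve (C.labelCurve k s) := by
  by_cases h : Even k ↔ s = true
  · rw [labelCurve_of_iff C h]; exact C.isCurve hk
  · rw [labelCurve_of_not_iff C h]; exact (C.neg.isCurve hk).swap

lemma labelCurve_nonempty_iff {k : ℕ} (hk : 1 ≤ k) (s : Bool) : (C.labelCurve k s).Nonempty ↔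
    if Even k ↔ s = true then Alternates C.m (Icc C.T₁ C.T₂) k
    else Alternates (fun t => -C.m t) (Icc C.T₁ C.T₂) k := by
  split_ifs with h
  · rw [labelCurve_of_iff C h]; exact C.curve_nonempty_iff hk
  · rw [labelCurve_of_not_iff C h]
    refine Iff.trans ?_ (C.neg.curve_nonempty_iff hk)
    constructor
    · rintro ⟨x, hx⟩; exact ⟨_, hx⟩
    · rintro ⟨x, hx⟩; exact ⟨x.swap, hx⟩

lemma neg_rot_mk (a b : ℝ) : C.neg.rot (a, b) = C.rot (-a, -b) := by
  rw [← C.neg_rot (-a, -b)]; simp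

/-- For solutions starting negative, the swap moves (a, b) to the opposite quadrant; passing to the
weight -m brings it back, at the cost of a reflection across the diagonal. -/
lemma piece_inter_posNeg (k : ℕ) (s : Bool) : piece C.p C.q C.m C.T₁ C.T₂ k s ∩ posNeg =
    {x | (x.1, -x.2) ∈ C.labelCurve k s} := by
  rw [C.piece_eq]
  ext ⟨a, b⟩
  by_cases h : Even k ↔ s = true
  · rw [labelCurve_of_iff C h]
    simp only [h, if_true, posNeg, curve, mem_inter_iff, mem_ofPred_eq, mem_prod, mem_Ici, mem_Iic,
      neg_neg, Left.nonneg_neg_iff]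
    tauto
  · rw [labelCurve_of_not_iff C h]
    simp only [h, if_false, posNeg, curve, mem_inter_iff, mem_ofPred_eq, mem_prod, mem_Ici, mem_Iic,
      mem_preimage, Prod.swap_prod_mk, neg_rot_mk, neg_neg, Left.nonneg_neg_iff]
    tauto

lemma piece_inter_negPos (k : ℕ) (s : Bool) : piece C.p C.q C.m C.T₁ C.T₂ k s ∩ negPos =
    {x | (-x.1, x.2) ∈ C.neg.labelCurve k s} := by
  rw [C.piece_eq]
  have hnn : ∀ x, C.neg.neg.rot x = C.rot x := fun x => by
    rw [neg_rot_mk, neg_rot_mk]; simp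
  ext ⟨a, b⟩
  by_cases h : Even k ↔ s = true
  · rw [labelCurve_of_iff _ h]
    simp only [h, if_true, negPos, curve, mem_inter_iff, mem_ofPred_eq, mem_prod, mem_Ici, mem_Iic,
      neg_rot_mk, neg_neg, Left.nonneg_neg_iff]
    tauto
  · rw [labelCurve_of_not_iff _ h]
    simp only [h, if_false, negPos, curve, mem_inter_iff, mem_ofPred_eq, mem_prod, mem_Ici, mem_Iic,
      mem_preimage, Prod.swap_prod_mk, hnn, neg_neg, Left.nonneg_neg_iff]
    tauto

end Coeffs

/-! ### Counting the labels and conclusion -/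

lemma iUnion_piece_inter (p q m : ℝ → ℝ) (T₁ T₂ : ℝ) (Q : Set (ℝ × ℝ)) :
    sigmaStar p q m T₁ T₂ ∩ Q =
      ⋃ i ∈ curveIndices p q m T₁ T₂ Q, piece p q m T₁ T₂ i.1 i.2 ∩ Q := by
  ext x
  simp only [sigmaStar, curveIndices, mem_inter_iff, mem_iUnion, mem_union, exists_prop,
    mem_ofPred_eq, Prod.exists, Bool.exists_bool]
  constructor
  · rintro ⟨⟨k, hk, h | h⟩, hQ⟩
    · exact ⟨k, Or.inr ⟨⟨hk, x, h, hQ⟩, h, hQ⟩⟩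
    · exact ⟨k, Or.inl ⟨⟨hk, x, h, hQ⟩, h, hQ⟩⟩
  · rintro ⟨k, ⟨⟨hk, -⟩, h, hQ⟩ | ⟨⟨hk, -⟩, h, hQ⟩⟩
    · exact ⟨⟨k, hk, Or.inr h⟩, hQ⟩
    · exact ⟨⟨k, hk, Or.inl h⟩, hQ⟩

/-- Each k < N contributes both labels, k = N exactly one (A and B together would give N + 1 ≤ N),
and larger k none. -/
lemma encard_labels {A B : ℕ → Prop} {N : ℕ∞} (hN : 1 ≤ N)
    (hlt : ∀ k, 1 ≤ k → ((k + 1 : ℕ) : ℕ∞) ≤ N → A k ∧ B k)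
    (hle : ∀ k, 1 ≤ k → (A k ∨ B k ↔ (k : ℕ∞) ≤ N))
    (heq : ∀ k, 1 ≤ k → A k → B k → ((k + 1 : ℕ) : ℕ∞) ≤ N) :
    {i : ℕ × Bool | 1 ≤ i.1 ∧
      ((Even i.1 ↔ i.2 = true) ∧ A i.1 ∨ ¬(Even i.1 ↔ i.2 = true) ∧ B i.1)}.encard =
      2 * N - 1 := by
  induction N using ENat.recTopCoe with
  | top =>
    rw [ENat.mul_top (by norm_num), ENat.top_sub_one, encard_eq_top_iff]
    refine infinite_of_injective_forall_mem (f := fun k : ℕ => (k + 1, true))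
      (fun a b h => by simpa using h) fun k => ⟨by simp, ?_⟩
    have := hlt (k + 1) (by omega) le_top
    tauto
  | coe n =>
    have hn : 1 ≤ n := by exact_mod_cast hN
    simp only [Nat.cast_le] at hlt hle heq
    have hnot : ¬(A n ∧ B n) := fun h => by have := heq n hn h.1 h.2; omega
    have hor : A n ∨ B n := (hle n hn).2 le_rfl
    -- The end sign of the only label with k = n, determined by which of A, B holds and by the
    -- parity of n.
    obtain ⟨s₀, hs₀⟩ : ∃ s₀ : Bool, ∀ s : Bool,
        ((Even n ↔ s = true) ∧ A n ∨ ¬(Even n ↔ s = true) ∧ B n) ↔ s = s₀ := by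
      by_cases hA : A n <;> by_cases he : Even n
      · have hB : ¬B n := fun h => hnot ⟨hA, h⟩
        exact ⟨true, fun s => by simp [hA, hB, he]⟩
      · have hB : ¬B n := fun h => hnot ⟨hA, h⟩
        exact ⟨false, fun s => by simp [hA, hB, he]⟩
      · have hB : B n := hor.resolve_left hA
        exact ⟨false, fun s => by simp [hA, hB, he]⟩
      · have hB : B n := hor.resolve_left hA
        exact ⟨true, fun s => by simp [hA, hB, he]⟩
    have hset : {i : ℕ × Bool | 1 ≤ i.1 ∧
        ((Even i.1 ↔ i.2 = true) ∧ A i.1 ∨ ¬(Even i.1 ↔ i.2 = true) ∧ B i.1)} =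
        (insert (n, s₀) (Finset.Icc 1 (n - 1) ×ˢ (Finset.univ : Finset Bool)) :
          Finset (ℕ × Bool)) := by
      ext ⟨k, s⟩
      simp only [mem_ofPred_eq, Finset.coe_insert, mem_insert_iff, Finset.mem_coe,
        Finset.mem_product, Finset.mem_Icc, Finset.mem_univ, and_true, Prod.mk.injEq]
      rcases lt_trichotomy k n with h | rfl | h
      · constructor
        · rintro ⟨h1, -⟩; exact Or.inr ⟨h1, by omega⟩
        · rintro (⟨rfl, -⟩ | ⟨h1, -⟩)
          · omega
          · have := hlt k h1 (by omega)
            tauto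
      · rw [hs₀ s]
        constructor
        · rintro ⟨-, h1⟩; exact Or.inl ⟨rfl, h1⟩
        · rintro (⟨-, h1⟩ | ⟨h1, h2⟩)
          · exact ⟨hn, h1⟩
          · omega
      · constructor
        · rintro ⟨h1, h2⟩
          have : k ≤ n := (hle k h1).1 (by tauto)
          omega
        · rintro (⟨rfl, -⟩ | ⟨h1, h2⟩) <;> omega
    rw [hset, encard_coe_eq_coe_finsetCard, Finset.card_insert_of_notMem (by simp; omega),
      Finset.card_product, Nat.card_Icc, Finset.card_univ, Fintype.card_bool]
    rw [show (n - 1 + 1 - 1) * 2 + 1 = 2 * n - 1 by omega]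
    push_cast
    rfl

namespace Coeffs

variable (C : Coeffs)

lemma encard_labelCurve {N : ℕ∞} (hN : 1 ≤ N)
    (h : ∀ k, 1 ≤ k → (HasAlternation C.m (Icc C.T₁ C.T₂) k ↔ (k : ℕ∞) ≤ N)) :
    {i : ℕ × Bool | 1 ≤ i.1 ∧ (C.labelCurve i.1 i.2).Nonempty}.encard = 2 * N - 1 := by
  rw [← encard_labels (A := Alternates C.m (Icc C.T₁ C.T₂))
    (B := Alternates (fun t => -C.m t) (Icc C.T₁ C.T₂)) hN
    (fun k hk hkN => ((h (k + 1) (by omega)).2 hkN).both) h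
    (fun k hk h1 h2 => (h (k + 1) (by omega)).1 (hasAlternation_succ_of_both h1 h2))]
  congr 1
  ext ⟨k, s⟩
  refine and_congr_right fun hk => ?_
  rw [C.labelCurve_nonempty_iff hk s]
  split_ifs with h1 <;> simp [h1]

/-- The structure of the spectrum in `ℝ₊ × ℝ₋`. -/
theorem posNeg_structure {N : ℕ∞} (hN : 1 ≤ N)
    (h : ∀ k, 1 ≤ k → (HasAlternation C.m (Icc C.T₁ C.T₂) k ↔ (k : ℕ∞) ≤ N)) :
    (∀ i ∈ curveIndices C.p C.q C.m C.T₁ C.T₂ posNeg,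
      IsHyperbolicLikePosNeg (piece C.p C.q C.m C.T₁ C.T₂ i.1 i.2 ∩ posNeg)) ∧
    (curveIndices C.p C.q C.m C.T₁ C.T₂ posNeg).encard = 2 * N - 1 := by
  have hne : ∀ k s, (piece C.p C.q C.m C.T₁ C.T₂ k s ∩ posNeg).Nonempty ↔
      (C.labelCurve k s).Nonempty := by
    intro k s
    rw [C.piece_inter_posNeg]
    constructor
    · rintro ⟨x, hx⟩; exact ⟨_, hx⟩
    · rintro ⟨x, hx⟩
      exact ⟨(x.1, -x.2), by rw [mem_ofPred_eq, neg_neg]; exact hx⟩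
  constructor
  · rintro ⟨k, s⟩ ⟨hk, hi⟩
    rw [hne] at hi
    rw [C.piece_inter_posNeg]
    exact (C.isCurve_labelCurve hk s).isHyperbolicLikePosNeg hi
  · rw [← C.encard_labelCurve hN h]
    simp only [curveIndices, hne]

/-- The structure of the spectrum in `ℝ₋ × ℝ₊`. -/
theorem negPos_structure {N : ℕ∞} (hN : 1 ≤ N)
    (h : ∀ k, 1 ≤ k → (HasAlternation C.m (Icc C.T₁ C.T₂) k ↔ (k : ℕ∞) ≤ N)) :
    (∀ i ∈ curveIndices C.p C.q C.m C.T₁ C.T₂ negPos,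
      IsHyperbolicLikeNegPos (piece C.p C.q C.m C.T₁ C.T₂ i.1 i.2 ∩ negPos)) ∧
    (curveIndices C.p C.q C.m C.T₁ C.T₂ negPos).encard = 2 * N - 1 := by
  have hne : ∀ k s, (piece C.p C.q C.m C.T₁ C.T₂ k s ∩ negPos).Nonempty ↔
      (C.neg.labelCurve k s).Nonempty := by
    intro k s
    rw [C.piece_inter_negPos]
    constructor
    · rintro ⟨x, hx⟩; exact ⟨_, hx⟩
    · rintro ⟨x, hx⟩
      exact ⟨(-x.1, x.2), by rw [mem_ofPred_eq, neg_neg]; exact hx⟩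
  -- Alternation with free first sign does not distinguish m from -m, so both quadrants have the
  -- same N.
  have h' : ∀ k, 1 ≤ k → (HasAlternation C.neg.m (Icc C.neg.T₁ C.neg.T₂) k ↔ (k : ℕ∞) ≤ N) := by
    intro k hk
    rw [← h k hk]
    simp only [HasAlternation, neg, neg_neg]
    exact or_comm
  constructor
  · rintro ⟨k, s⟩ ⟨hk, hi⟩
    rw [hne] at hi
    rw [C.piece_inter_negPos]
    exact (C.neg.isCurve_labelCurve hk s).isHyperbolicLikeNegPos hi
  · rw [← C.neg.encard_labelCurve hN h']
    simp only [curveIndices, hne]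

end Coeffs

end Fucik

theorem theorem6 (T₁ T₂ : ℝ) (hT : T₁ < T₂) (p q m : ℝ → ℝ)
    (hpc : ContinuousOn p (Set.Icc T₁ T₂)) (hqc : ContinuousOn q (Set.Icc T₁ T₂))
    (hmc : ContinuousOn m (Set.Icc T₁ T₂))
    (hp : ∀ t ∈ Set.Icc T₁ T₂, 0 < p t) (hq : ∀ t ∈ Set.Icc T₁ T₂, 0 ≤ q t)
    (hm : Fucik.BothSignsOn m (Set.Icc T₁ T₂))
    (N : ℕ∞) (hN : N = Fucik.numSignChanges m T₁ T₂) :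
    1 ≤ N ∧
    -- the quadrant `ℝ₊ × ℝ₋`
    (Fucik.sigmaStar p q m T₁ T₂ ∩ Fucik.posNeg =
        ⋃ i ∈ Fucik.curveIndices p q m T₁ T₂ Fucik.posNeg,
          Fucik.piece p q m T₁ T₂ i.1 i.2 ∩ Fucik.posNeg) ∧
    (∀ i ∈ Fucik.curveIndices p q m T₁ T₂ Fucik.posNeg,
      Fucik.IsHyperbolicLikePosNeg (Fucik.piece p q m T₁ T₂ i.1 i.2 ∩ Fucik.posNeg)) ∧
    (Fucik.curveIndices p q m T₁ T₂ Fucik.posNeg).encard = 2 * N - 1 ∧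
    -- the quadrant `ℝ₋ × ℝ₊`
    (Fucik.sigmaStar p q m T₁ T₂ ∩ Fucik.negPos =
        ⋃ i ∈ Fucik.curveIndices p q m T₁ T₂ Fucik.negPos,
          Fucik.piece p q m T₁ T₂ i.1 i.2 ∩ Fucik.negPos) ∧
    (∀ i ∈ Fucik.curveIndices p q m T₁ T₂ Fucik.negPos,
      Fucik.IsHyperbolicLikeNegPos (Fucik.piece p q m T₁ T₂ i.1 i.2 ∩ Fucik.negPos)) ∧
    (Fucik.curveIndices p q m T₁ T₂ Fucik.negPos).encard = 2 * N - 1 := by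
  have halt : ∀ k, 1 ≤ k → (Fucik.HasAlternation m (Icc T₁ T₂) k ↔ (k : ℕ∞) ≤ N) := fun k hk => by
    rw [hN]; exact Fucik.hasAlternation_iff hmc hk
  have h1 : 1 ≤ N := by
    obtain ⟨⟨x, hx, hxm⟩, ⟨y, hy, hym⟩⟩ := hm
    have := (halt 1 le_rfl).1 (Fucik.hasAlternation_one hx hy
      (fun h => by rw [h] at hxm; linarith) (mul_neg_of_pos_of_neg hxm hym))
    simpa using this
  obtain ⟨C, rfl, rfl, ep, eq, em⟩ := Fucik.exists_coeffs hT hpc hqc hmc hp hq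
  have hC : ∀ k, 1 ≤ k →
      (Fucik.HasAlternation C.m (Icc C.T₁ C.T₂) k ↔ (k : ℕ∞) ≤ N) := fun k hk => by
    rw [← halt k hk]
    exact or_congr (Fucik.Alternates.congr fun t ht => (em ht).symm)
      (Fucik.Alternates.congr fun t ht => by rw [em ht])
  have hpiece : ∀ k s, Fucik.piece p q m C.T₁ C.T₂ k s =
      Fucik.piece C.p C.q C.m C.T₁ C.T₂ k s := fun k s => Fucik.piece_congr ep eq em k s
  have hidx : ∀ Q, Fucik.curveIndices p q m C.T₁ C.T₂ Q =
      Fucik.curveIndices C.p C.q C.m C.T₁ C.T₂ Q := fun Q => by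
    simp only [Fucik.curveIndices, hpiece]
  obtain ⟨a1, a2⟩ := C.posNeg_structure h1 hC
  obtain ⟨b1, b2⟩ := C.negPos_structure h1 hC
  refine ⟨h1, Fucik.iUnion_piece_inter _ _ _ _ _ _, ?_, ?_,
    Fucik.iUnion_piece_inter _ _ _ _ _ _, ?_, ?_⟩
  · simpa only [hidx, hpiece] using a1
  · rw [hidx]; exact a2
  · simpa only [hidx, hpiece] using b1
  · rw [hidx]; exact b2
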